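/- Let $H_g=\mathbb{Q}^{2g}$ with symplectic basis $x_1,\dots,x_g,y_1,\dots,y_g$, let $\mathcal{L}_{g,1}=\bigoplus_{n\ge1}\mathcal{L}_{g,1}(n)$ be the free graded Lie algebra on $H_g$, and let $\omega_0=\sum_i[x_i,y_i]$. For $k\ge 0$ let $\mathfrak{h}_{g,1}(k)$ be the space of symplectic derivations of degree $k$, i.e. the derivations $D$ of $\mathcal{L}_{g,1}$ with $D(\mathcal{L}_{g,1}(n))\subset\mathcal{L}_{g,1}(n+k)$ for all $n$ and $D(\omega_0)=0$; it is an $\mathrm{Sp}(2g,\mathbb{Q})$-module by conjugation. Identify $D\in\mathfrak{h}_{g,1}(k)$ with the tensor $\sum_i\big(x_i\otimes D(y_i)-y_i\otimes D(x_i)\big)\in H_g\otimes\mathcal{L}_{g,1}(k+1)\subset H_g^{\otimes(k+2)}$. Write $[m]$ for the irreducible $\mathrm{Sp}(2,\mathbb{Q})$-module $\mathrm{Sym}^m H_1$, and say that $c\,[m]$ (with $c>0$) is the leading term of an $\mathrm{Sp}(2,\mathbb{Q})$-module which is a direct sum of modules $[j]$ if $[m]$ occurs in it with multiplicity exactly $c$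 and no $[j]$ with $j>m$ occurs. For a Young diagram $\lambda$ with $n=k+1$ boxes define $H_\lambda\subset H_g^{\otimes(2k+2)}$ as follows. On the rational vector space with basis the linear chord diagrams $C$ with $2n$ vertices (the partitions of $\{1,\dots,2n\}$ into pairs), consider the symmetric bilinear form $\langle C,C'\rangle=(-1)^{n-r}(2g)^r$, where $r$ is the number of connected components of $C\cup C'$. Let $E_\lambda$ be the space of all vectors which, for the Gram matrix of this form with $g$ regarded as an indeterminate, are eigenvectors (or zero) with eigenvalue $\mu_\lambda=\prod_{b\in\lambda}(2g-2s_b+t_b)$, where $s_b$ (resp. $t_b$) is the number of columns to the left of (resp. rows above) the box $b$. Let $\Phi$ be the linear map which sends $C=(i_1j_1)\cdots(i_nj_n)$, $i_1<\dots<i_n$, $i_l<j_l$, to the sign of the permutation $(1,2,\dots,2n)\mapsto(i_1,j_1,\dots,i_n,j_n)$ times the tensor having a copy of $\omega_0=\sum_i (x_i\otimes y_i-y_i\otimes x_i)$ in the places $i_l,j_l$ for each $l$. Put $U_\lambda=\Phi(E_{\lambda'})$, where $\lambda'$ is the conjugate of $\lambda$, and $$H_\lambda=S_{2k+2}\circ(1\otimes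 p_{2k+1})(U_\lambda),\qquad p_m=(1-\sigma_m)(1-\sigma_{m-1})\cdots(1-\sigma_2),\quad S_m=\sum_{j=1}^m\sigma_m^j,\quad \sigma_i=(1\,2\cdots i),$$ where permutations act by permuting the tensor places and $1\otimes p_{2k+1}$ acts on the last $2k+1$ places. We write $H_\lambda^{(g)}$ for $H_\lambda$ if the genus has to be specified. (i) The leading term in the irreducible decomposition of the $\mathrm{Sp}(2,\mathbb{Q})$-module $\mathfrak{h}_{1,1}(k)$ is $[k-2]$ for every even $k\ge2$ and $\lfloor k/6\rfloor\,[k-4]$ for every odd $k\ge7$, and $\mathfrak{h}_{1,1}(k)=\{0\}$ for $k=1,3,5$. (ii) For every $k\ge 0$ there is a natural isomorphism $\mathfrak{h}_{1,1}(2k)^{\mathrm{Sp}}\cong H_{[k+1]}$. Precisely: in genus $1$ the two subspaces of $H_1^{\otimes(2k+2)}$ coincide, $\mathfrak{h}_{1,1}(2k)^{\mathrm{Sp}}=H^{(1)}_{[k+1]}$; and for every $g\ge1$ the projection $H_g^{\otimes(2k+2)}\to H_1^{\otimes(2k+2)}$ induced by $x_i,y_i\mapsto0$ for $i\ge2$ restricts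 to an isomorphism $H^{(g)}_{[k+1]}\to\mathfrak{h}_{1,1}(2k)^{\mathrm{Sp}}$. -/

import Mathlib

open scoped TensorProduct DirectSum Polynomial

noncomputable section

namespace GenusOne

/-! ### The symplectic space, its free Lie algebra and symplectic derivations -/

/-- Index set of the symplectic basis `x_1, …, x_g, y_1, …, y_g`:
`Sum.inl i` stands for `x_i` and `Sum.inr i` for `y_i`. -/
abbrev SpIdx (g : ℕ) : Type := Fin g ⊕ Fin g

/-- The rational homology `H_ℚ` of a surface of genus `g`, with its symplectic basis. -/
abbrev HQ (g : ℕ) : Type := SpIdx g → ℚ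

/-- The vectors of the symplectic basis of `H_ℚ`. -/
def basisVec (g : ℕ) (a : SpIdx g) : HQ g := Pi.single a 1

/-- The group `Sp(2g, ℚ)`; it acts on column vectors. -/
abbrev Sp (g : ℕ) : Type := Matrix.symplecticGroup (Fin g) ℚ

/-- The free Lie algebra `L_{g,1}` generated by `H_ℚ`. -/
abbrev FreeLie (g : ℕ) : Type := FreeLieAlgebra ℚ (SpIdx g)

/-- The generator of the free Lie algebra given by a basis vector. -/
def gen (g : ℕ) (a : SpIdx g) : FreeLie g := FreeLieAlgebra.of ℚ a

/-- `IsLieMonomial g n u`: the element `u` is an iterated bracket of `n` generators. -/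
inductive IsLieMonomial (g : ℕ) : ℕ → FreeLie g → Prop
  | gen (a : SpIdx g) : IsLieMonomial g 1 (gen g a)
  | lie {m n : ℕ} {u v : FreeLie g} :
      IsLieMonomial g m u → IsLieMonomial g n v → IsLieMonomial g (m + n) ⁅u, v⁆

/-- The degree `n` part `L_{g,1}(n)` of the free Lie algebra. -/
def lieDegree (g n : ℕ) : Submodule ℚ (FreeLie g) :=
  Submodule.span ℚ {u | IsLieMonomial g n u}

/-- The symplectic element `ω₀ = ∑ [x_i, y_i]` of `L_{g,1}(2)`. -/
def omega (g : ℕ) : FreeLie g := ∑ i : Fin g, ⁅gen g (Sum.inl i), gen g (Sum.inr i)⁆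

/-- The action of a matrix on the free Lie algebra which extends its action on `H_ℚ`. -/
def lieAct (g : ℕ) (A : Matrix (SpIdx g) (SpIdx g) ℚ) : FreeLie g →ₗ⁅ℚ⁆ FreeLie g :=
  FreeLieAlgebra.lift ℚ fun a => ∑ b, A b a • gen g b

theorem lieAct_gen (g : ℕ) (A : Matrix (SpIdx g) (SpIdx g) ℚ) (a : SpIdx g) :
    lieAct g A (gen g a) = ∑ b, A b a • gen g b := by
  simp [lieAct, gen, FreeLieAlgebra.lift_of_apply]

theorem lieAct_one (g : ℕ) (u : FreeLie g) : lieAct g 1 u = u := by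
  have h : lieAct g 1 = LieHom.id := by
    apply FreeLieAlgebra.hom_ext
    intro a
    change lieAct g 1 (gen g a) = gen g a
    rw [lieAct_gen]
    simp [Matrix.one_apply]
  rw [h]; rfl

theorem lieAct_mul (g : ℕ) (A B : Matrix (SpIdx g) (SpIdx g) ℚ) (u : FreeLie g) :
    lieAct g (A * B) u = lieAct g A (lieAct g B u) := by
  have h : lieAct g (A * B) = (lieAct g A).comp (lieAct g B) := by
    apply FreeLieAlgebra.hom_ext
    intro a
    change lieAct g (A * B) (gen g a) = lieAct g A (lieAct g B (gen g a))
    simp only [lieAct_gen, map_sum, map_smul, Matrix.mul_apply, Finset.sum_smul,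
      Finset.smul_sum, smul_smul]
    rw [Finset.sum_comm]
    simp only [mul_comm]
  rw [h]; rfl

theorem lie_mem_lieDegree {g m n : ℕ} {u v : FreeLie g} (hu : u ∈ lieDegree g m)
    (hv : v ∈ lieDegree g n) : ⁅u, v⁆ ∈ lieDegree g (m + n) := by
  induction hu using Submodule.span_induction with
  | mem u hu =>
    induction hv using Submodule.span_induction with
    | mem v hv => exact Submodule.subset_span (IsLieMonomial.lie hu hv)
    | zero => simp
    | add v w _ _ h1 h2 => rw [lie_add]; exact add_mem h1 h2
    | smul c v _ h1 => rw [lie_smul]; exact Submodule.smul_mem _ _ h1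
  | zero => simp
  | add u w _ _ h1 h2 => rw [add_lie]; exact add_mem h1 h2
  | smul c u _ h1 => rw [smul_lie]; exact Submodule.smul_mem _ _ h1

theorem lieAct_mem_lieDegree {g n : ℕ} (A : Matrix (SpIdx g) (SpIdx g) ℚ) {u : FreeLie g}
    (hu : u ∈ lieDegree g n) : lieAct g A u ∈ lieDegree g n := by
  induction hu using Submodule.span_induction with
  | mem u hu =>
    have hu' : IsLieMonomial g n u := hu
    clear hu
    induction hu' with
    | gen a =>
      rw [lieAct_gen]
      exact Submodule.sum_mem _ fun b _ =>
        Submodule.smul_mem _ _ (Submodule.subset_span (IsLieMonomial.gen b))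
    | lie _ _ h1 h2 => rw [LieHom.map_lie]; exact lie_mem_lieDegree h1 h2
  | zero => simp
  | add u w _ _ h1 h2 => rw [map_add]; exact add_mem h1 h2
  | smul c u _ h1 => rw [map_smul]; exact Submodule.smul_mem _ _ h1

theorem lieAct_form {g : ℕ} (A M : Matrix (SpIdx g) (SpIdx g) ℚ) :
    lieAct g A (∑ a, ∑ b, M a b • ⁅gen g a, gen g b⁆) =
      ∑ c, ∑ d, (A * M * A.transpose) c d • ⁅gen g c, gen g d⁆ := by
  have h : ∀ a b, lieAct g A (M a b • ⁅gen g a, gen g b⁆) =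
      ∑ c, ∑ d, (A c a * M a b * A d b) • ⁅gen g c, gen g d⁆ := by
    intro a b
    rw [map_smul, LieHom.map_lie, lieAct_gen, lieAct_gen, sum_lie, Finset.smul_sum]
    refine Finset.sum_congr rfl fun c _ => ?_
    rw [lie_sum, Finset.smul_sum]
    refine Finset.sum_congr rfl fun d _ => ?_
    rw [smul_lie, lie_smul, smul_smul, smul_smul]
    congr 1
    ring
  simp only [map_sum, h, Matrix.mul_apply, Matrix.transpose_apply, Finset.sum_mul, Finset.sum_smul]
  rw [Finset.sum_comm]
  rw [Finset.sum_congr rfl fun b _ => Finset.sum_comm, Finset.sum_comm]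
  refine Finset.sum_congr rfl fun c _ => ?_
  rw [Finset.sum_congr rfl fun b _ => Finset.sum_comm, Finset.sum_comm]

theorem two_smul_omega (g : ℕ) : (2 : ℚ) • omega g =
    ∑ a, ∑ b, (-Matrix.J (Fin g) ℚ) a b • ⁅gen g a, gen g b⁆ := by
  have h : ∀ i : Fin g, -⁅gen g (Sum.inr i), gen g (Sum.inl i)⁆ =
      ⁅gen g (Sum.inl i), gen g (Sum.inr i)⁆ := fun i => lie_skew _ _
  have h' : ∑ i, ⁅gen g (Sum.inl i), gen g (Sum.inr i)⁆ =
      -∑ i, ⁅gen g (Sum.inr i), gen g (Sum.inl i)⁆ := by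
    rw [← Finset.sum_neg_distrib]
    exact Finset.sum_congr rfl fun i _ => (h i).symm
  simp only [Fintype.sum_sum_type, Matrix.neg_apply, Matrix.J, Matrix.fromBlocks_apply₁₁,
    Matrix.fromBlocks_apply₁₂, Matrix.fromBlocks_apply₂₁, Matrix.fromBlocks_apply₂₂,
    Matrix.zero_apply, Matrix.one_apply, zero_smul, ite_smul, one_smul,
    neg_smul, Finset.sum_const_zero, zero_add, add_zero, Finset.sum_neg_distrib,
    Finset.sum_ite_eq, Finset.mem_univ, if_true]
  rw [omega, two_smul, h']
  abel

theorem lieAct_omega {g : ℕ} (A : Sp g) : lieAct g A.1 (omega g) = omega g := by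
  have hA : A.1 * Matrix.J (Fin g) ℚ * A.1.transpose = Matrix.J (Fin g) ℚ :=
    SymplecticGroup.mem_iff.mp A.2
  have key : lieAct g A.1 ((2 : ℚ) • omega g) = (2 : ℚ) • omega g := by
    rw [two_smul_omega, lieAct_form, Matrix.mul_neg, Matrix.neg_mul, hA]
  rw [map_smul] at key
  exact smul_right_injective _ (two_ne_zero : (2 : ℚ) ≠ 0) key

/-- The Lie algebra of derivations of the free Lie algebra. -/
abbrev Der (g : ℕ) : Type := LieDerivation ℚ (FreeLie g) (FreeLie g)

/-- The derivation `A ∘ D ∘ A⁻¹`, for `A` in `Sp(2g, ℚ)`. -/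
def conjDer {g : ℕ} (A : Sp g) (D : Der g) : Der g where
  toLinearMap := (lieAct g A.1 : FreeLie g →ₗ[ℚ] FreeLie g) ∘ₗ (D : FreeLie g →ₗ[ℚ] FreeLie g) ∘ₗ
    (lieAct g (A⁻¹).1 : FreeLie g →ₗ[ℚ] FreeLie g)
  leibniz' u v := by
    have h : ∀ w, lieAct g A.1 (lieAct g (A⁻¹).1 w) = w := by
      intro w
      rw [← lieAct_mul]
      have h1 : A.1 * (A⁻¹).1 = 1 := congrArg Subtype.val (mul_inv_cancel A)
      rw [h1, lieAct_one]
    simp [LieHom.map_lie, h]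

theorem conjDer_apply {g : ℕ} (A : Sp g) (D : Der g) (u : FreeLie g) :
    conjDer A D u = lieAct g A.1 (D (lieAct g (A⁻¹).1 u)) := rfl

/-- The action of `Sp(2g, ℚ)` on the derivations of the free Lie algebra. -/
def derRep (g : ℕ) : Representation ℚ (Sp g) (Der g) where
  toFun A :=
    { toFun := conjDer A
      map_add' := fun D E => by ext u; simp [conjDer_apply]
      map_smul' := fun c D => by ext u; simp [conjDer_apply] }
  map_one' := by
    ext D u
    change lieAct g 1 (D (lieAct g ((1 : Sp g)⁻¹).1 u)) = D u
    rw [inv_one]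
    change lieAct g 1 (D (lieAct g 1 u)) = D u
    rw [lieAct_one, lieAct_one]
  map_mul' A B := by
    ext D u
    change lieAct g (A.1 * B.1) (D (lieAct g ((A * B)⁻¹).1 u)) =
      lieAct g A.1 (lieAct g B.1 (D (lieAct g (B⁻¹).1 (lieAct g (A⁻¹).1 u))))
    rw [mul_inv_rev, lieAct_mul, ← lieAct_mul g (B⁻¹).1]
    rfl

/-- The degree `k` part `h_{g,1}(k)` of the Lie algebra of symplectic derivations: the
derivations of the free Lie algebra which raise degrees by `k` and annihilate `ω₀`, as an
`Sp(2g, ℚ)`-module. -/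
def sympDer (g k : ℕ) : Subrepresentation (derRep g) where
  toSubmodule :=
    { carrier := {D | (∀ n, ∀ u ∈ lieDegree g n, D u ∈ lieDegree g (n + k)) ∧ D (omega g) = 0}
      add_mem' := fun {D E} hD hE =>
        ⟨fun n u hu => by
          rw [LieDerivation.add_apply]; exact add_mem (hD.1 n u hu) (hE.1 n u hu), by
          rw [LieDerivation.add_apply, hD.2, hE.2, add_zero]⟩
      zero_mem' := ⟨fun n u _ => by rw [LieDerivation.zero_apply]; exact zero_mem _,
        LieDerivation.zero_apply _⟩
      smul_mem' := fun c D hD =>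
        ⟨fun n u hu => by
          rw [LieDerivation.smul_apply]; exact Submodule.smul_mem _ _ (hD.1 n u hu), by
          rw [LieDerivation.smul_apply, hD.2, smul_zero]⟩ }
  apply_mem_toSubmodule A D hD := by
    refine ⟨fun n u hu => ?_, ?_⟩
    · exact lieAct_mem_lieDegree _ (hD.1 n _ (lieAct_mem_lieDegree _ hu))
    · change lieAct g A.1 (D (lieAct g (A⁻¹).1 (omega g))) = 0
      rw [lieAct_omega, hD.2, map_zero]

/-- The representation of `Sp(2g, ℚ)` on `h_{g,1}(k)`. -/
abbrev sympDerRep (g k : ℕ) : Representation ℚ (Sp g) (sympDer g k).toSubmodule :=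
  (sympDer g k).toRepresentation

/-! ### The irreducible representations `[m]` and leading terms -/

/-- The substitution `X_a ↦ ∑ A_{b a} X_b`, which extends the action of the matrix `A` on `H_ℚ`
to the symmetric algebra of `H_ℚ`. -/
def polyAct (g : ℕ) (A : Matrix (SpIdx g) (SpIdx g) ℚ) :
    MvPolynomial (SpIdx g) ℚ →ₐ[ℚ] MvPolynomial (SpIdx g) ℚ :=
  MvPolynomial.aeval fun a => ∑ b, A b a • MvPolynomial.X b

/-- The action of `Sp(2g, ℚ)` on the symmetric algebra of `H_ℚ`. -/
def polyRep (g : ℕ) : Representation ℚ (Sp g) (MvPolynomial (SpIdx g) ℚ) where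
  toFun A := (polyAct g A.1).toLinearMap
  map_one' := by
    have h : polyAct g (1 : Matrix (SpIdx g) (SpIdx g) ℚ) = AlgHom.id ℚ _ := by
      ext a : 1
      simp [polyAct, Matrix.one_apply]
    change (polyAct g 1).toLinearMap = 1
    rw [h]; rfl
  map_mul' A B := by
    have h : polyAct g (A.1 * B.1) = (polyAct g A.1).comp (polyAct g B.1) := by
      ext a : 1
      simp only [polyAct, AlgHom.comp_apply, MvPolynomial.aeval_X, map_sum, map_smul,
        Matrix.mul_apply, Finset.sum_smul, Finset.smul_sum, smul_smul]
      rw [Finset.sum_comm]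
      simp only [mul_comm]
    change (polyAct g (A.1 * B.1)).toLinearMap = _
    rw [h]; rfl

/-- The representation `[m]` of `Sp(2g, ℚ)`, with a Young diagram of one row of `m` boxes: the
`m`-th symmetric power of `H_ℚ`, realized as the homogeneous polynomials of degree `m`. -/
def symPow (g m : ℕ) : Subrepresentation (polyRep g) where
  toSubmodule := MvPolynomial.homogeneousSubmodule (SpIdx g) ℚ m
  apply_mem_toSubmodule A p hp := by
    rw [MvPolynomial.mem_homogeneousSubmodule] at hp ⊢
    have h := hp.aeval (fun a => ∑ b, A.1 b a • (MvPolynomial.X b : MvPolynomial (SpIdx g) ℚ))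
      (n := 1) (fun a => MvPolynomial.IsHomogeneous.sum _ _ _ fun b _ => by
        rw [MvPolynomial.smul_eq_C_mul]
        simpa using (MvPolynomial.isHomogeneous_C _ _).mul (MvPolynomial.isHomogeneous_X ℚ b))
    rw [one_mul] at h
    exact h

/-- `∑ n_j [j]` is the irreducible decomposition of the representation `ρ` of `Sp(2, ℚ)`: the
representations `[j]` which occur are irreducible and `ρ` is isomorphic to the direct sum of
`n_j` copies of `[j]` over all `j`. -/
def IsIrredDecomp {V : Type} [AddCommGroup V] [Module ℚ V] (ρ : Representation ℚ (Sp 1) V)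
    (n : ℕ → ℕ) : Prop :=
  (∀ j, 0 < n j → (symPow 1 j).toRepresentation.IsIrreducible) ∧
  Nonempty (ρ.Equiv (Representation.directSum
    fun i : Σ j : ℕ, Fin (n j) => (symPow 1 i.1).toRepresentation))

/-- The leading term in the irreducible decomposition of `ρ` is `c [m]`: the representation
`[m]` occurs exactly `c > 0` times and no `[j]` with `j > m` occurs. -/
def HasLeadingTerm {V : Type} [AddCommGroup V] [Module ℚ V] (ρ : Representation ℚ (Sp 1) V)
    (c m : ℕ) : Prop :=
  0 < c ∧ ∃ n : ℕ → ℕ, IsIrredDecomp ρ n ∧ n m = c ∧ ∀ j, m < j → n j = 0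

/-! ### Linear chord diagrams and symplectic invariant tensors -/

/-- Linear chord diagrams with `2n` vertices: partitions of the vertices into pairs, encoded by
the involution without fixed points which exchanges the two ends of each chord. -/
def ChordDiagram (n : ℕ) : Type :=
  {C : Equiv.Perm (Fin (2 * n)) // ∀ i, C (C i) = i ∧ C i ≠ i}

instance (n : ℕ) : Fintype (ChordDiagram n) := by unfold ChordDiagram; infer_instance

namespace ChordDiagram

variable {n : ℕ}

/-- The number of crossings, that is of pairs of chords `(i j)`, `(i' j')` with
`i < i' < j < j'`. -/
def crossings (C : ChordDiagram n) : ℕ :=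
  (Finset.univ.filter fun p : Fin (2 * n) × Fin (2 * n) =>
    p.1 < p.2 ∧ p.2 < C.1 p.1 ∧ C.1 p.1 < C.1 p.2).card

/-- The sign `sgn C` of the permutation `1, 2, …, 2n ↦ i_1, j_1, …, i_n, j_n` where
`C = (i_1 j_1) ⋯ (i_n j_n)` with `i_1 < ⋯ < i_n` and `i_l < j_l`. Two chords give one inversion if
they cross, two if they are nested and none otherwise. -/
def sgn (C : ChordDiagram n) : ℚ := (-1) ^ C.crossings

/-- The graph with the `2n` vertices and the `n` chords as edges. -/
def graph (C : ChordDiagram n) : SimpleGraph (Fin (2 * n)) where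
  Adj i j := C.1 i = j
  symm := ⟨fun i j h => by rw [← h]; exact (C.2 i).1⟩
  loopless := ⟨fun i h => (C.2 i).2 h⟩

/-- The number of connected components of the graph `C ∪ C'`. -/
def components (C C' : ChordDiagram n) : ℕ :=
  Nat.card (C.graph ⊔ C'.graph).ConnectedComponent

/-- The pairing `⟨C, C'⟩ = (-1)^(n - r) (2g)^r`, a polynomial in the genus `g`, where `r` is the
number of connected components of `C ∪ C'`. -/
def pairing (C C' : ChordDiagram n) : ℚ[X] :=
  (-1) ^ (n - components C C') * (2 * Polynomial.X) ^ components C C'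

end ChordDiagram

/-- The eigenvalue `μ_λ = ∏ (2g - 2 s_b + t_b)` over the boxes `b` of `λ`, a polynomial in the
genus `g`, where `s_b` and `t_b` are the numbers of columns to the left of `b` and of rows
above `b`. -/
def eigenvalue (lam : YoungDiagram) : ℚ[X] :=
  ∏ b ∈ lam.cells, (2 * Polynomial.X - 2 * (b.2 : ℚ[X]) + (b.1 : ℚ[X]))

/-- The eigenspace `E_λ` with eigenvalue `μ_λ` of the matrix of the pairing, in the vector space
with basis the linear chord diagrams. -/
def eigenspace (n : ℕ) (lam : YoungDiagram) : Submodule ℚ (ChordDiagram n → ℚ) where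
  carrier := {v | ∀ C, ∑ C', C.pairing C' * Polynomial.C (v C') =
    eigenvalue lam * Polynomial.C (v C)}
  add_mem' := fun {v w} hv hw C => by
    simp only [Pi.add_apply, map_add, mul_add, Finset.sum_add_distrib, hv C, hw C]
  zero_mem' := fun C => by simp
  smul_mem' := fun c v hv C => by
    have := congrArg (fun p => Polynomial.C c * p) (hv C)
    simp only [Finset.mul_sum] at this
    simp only [Pi.smul_apply, smul_eq_mul, map_mul]
    calc _ = ∑ C', Polynomial.C c * (C.pairing C' * Polynomial.C (v C')) :=
          Finset.sum_congr rfl fun _ _ => by ring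
      _ = _ := by rw [this]; ring

/-- The coefficients of the symplectic element `ω₀ = ∑ (x_i ⊗ y_i - y_i ⊗ x_i)`. -/
def omegaCoeff (g : ℕ) : SpIdx g → SpIdx g → ℚ
  | Sum.inl i, Sum.inr j => if i = j then 1 else 0
  | Sum.inr i, Sum.inl j => if i = j then -1 else 0
  | _, _ => 0

/-- The invariant tensor `a_C`: the product of copies of `ω₀`, one for each chord of `C` with its
two factors placed at the ends of the chord, multiplied by `sgn C`. -/
def chordTensor (g : ℕ) {n : ℕ} (C : ChordDiagram n) : ⨂[ℚ]^(2 * n) (HQ g) :=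
  C.sgn • ∑ f : Fin (2 * n) → SpIdx g,
    (∏ i ∈ Finset.univ.filter (fun i => i < C.1 i), omegaCoeff g (f i) (f (C.1 i))) •
      PiTensorProduct.tprod ℚ fun i => basisVec g (f i)

/-- The linear map `Φ` with `Φ(C) = a_C`. -/
def Phi (g n : ℕ) : (ChordDiagram n → ℚ) →ₗ[ℚ] ⨂[ℚ]^(2 * n) (HQ g) :=
  Fintype.linearCombination ℚ fun C => chordTensor g C

/-- The subspace `U_λ = Φ(E_{λ'})` of the symplectic invariant tensors, where `λ'` is the
conjugate of `λ`. -/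
def invTensor (g n : ℕ) (lam : YoungDiagram) : Submodule ℚ (⨂[ℚ]^(2 * n) (HQ g)) :=
  (eigenspace n lam.transpose).map (Phi g n)

/-- A permutation `τ` of the places acts on tensors, moving the factor at the place `a` to the
place `τ a`. -/
def permAct (g : ℕ) {N : ℕ} (τ : Equiv.Perm (Fin N)) : Module.End ℚ (⨂[ℚ]^N (HQ g)) :=
  (PiTensorProduct.reindex ℚ (fun _ => HQ g) τ).toLinearMap

/-- With the places numbered `0, …, N - 1`, the cyclic permutation `1 ↦ 2 ↦ ⋯ ↦ i ↦ 1`. This is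
`σ_i` acting on all the places but the first. -/
def shiftedCycle (N i : ℕ) : Equiv.Perm (Fin N) :=
  ((List.finRange N).filter fun a => 1 ≤ a.1 ∧ a.1 ≤ i).formPerm

/-- The operator `1 ⊗ p_{m+1}` where `p_{m+1} = (1 - σ_{m+1}) (1 - σ_m) ⋯ (1 - σ_2)`. -/
def onePAct (g N : ℕ) : ℕ → Module.End ℚ (⨂[ℚ]^N (HQ g))
  | 0 => 1
  | m + 1 => (1 - permAct g (shiftedCycle N (m + 2))) * onePAct g N m

/-- The operator `S_N = ∑ σ_N^j`, `1 ≤ j ≤ N`, where `σ_N` is the cyclic permutation of all the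
places. -/
def cycSum (g N : ℕ) : Module.End ℚ (⨂[ℚ]^N (HQ g)) :=
  ∑ j ∈ Finset.range N, permAct g (finRotate N ^ (j + 1))

/-- The subspace `H_λ = S_{2n} ∘ (1 ⊗ p_{2n-1}) (U_λ)`. For `|λ| = n = k + 1` this is the
`λ`-component of the orthogonal decomposition of `h_{g,1}(2k)^Sp`. -/
def HLam (g n : ℕ) (lam : YoungDiagram) : Submodule ℚ (⨂[ℚ]^(2 * n) (HQ g)) :=
  (invTensor g n lam).map (cycSum g (2 * n) * onePAct g (2 * n) (2 * n - 2))

/-- The Young diagram `[m]` with one row of `m` boxes. -/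
def oneRow (m : ℕ) : YoungDiagram :=
  YoungDiagram.ofRowLens [m] (List.pairwise_singleton _ m).sortedGE

/-! ### Derivations as tensors -/

section

attribute [local instance] LieRing.ofAssociativeRing

/-- The inclusion of the free Lie algebra into the tensor algebra of `H_ℚ`. -/
def lieToTensor (g : ℕ) : FreeLie g →ₗ⁅ℚ⁆ TensorAlgebra ℚ (HQ g) :=
  FreeLieAlgebra.lift ℚ fun a => TensorAlgebra.ι ℚ (basisVec g a)

/-- The underlying linear map of the inclusion of the free Lie algebra into the tensor algebra. -/
def lieToTensorLin (g : ℕ) : FreeLie g →ₗ[ℚ] TensorAlgebra ℚ (HQ g) := (lieToTensor g).toLinearMap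

end

/-- A derivation `D` as a tensor `∑ (x_i ⊗ D(y_i) - y_i ⊗ D(x_i))`, through the identification of
`Hom(H_ℚ, L)` with `H_ℚ ⊗ L` by Poincaré duality. -/
def derToTensor (g : ℕ) : Der g →ₗ[ℚ] TensorAlgebra ℚ (HQ g) where
  toFun D := ∑ i : Fin g,
    (TensorAlgebra.ι ℚ (basisVec g (Sum.inl i)) * lieToTensorLin g (D (gen g (Sum.inr i))) -
      TensorAlgebra.ι ℚ (basisVec g (Sum.inr i)) * lieToTensorLin g (D (gen g (Sum.inl i))))
  map_add' D E := by
    rw [← Finset.sum_add_distrib]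
    refine Finset.sum_congr rfl fun i _ => ?_
    simp only [LieDerivation.add_apply, map_add, mul_add]
    abel
  map_smul' c D := by
    simp only [LieDerivation.smul_apply, map_smul, mul_smul_comm, ← smul_sub, ← Finset.smul_sum,
      RingHom.id_apply]

/-- The `Sp`-invariant part `h_{g,1}(k)^Sp`. -/
def sympDerInv (g k : ℕ) : Submodule ℚ (Der g) :=
  (sympDer g k).toSubmodule ⊓ (derRep g).invariants

/-- The projection `H_g → H_1` with `x_1 ↦ x_1`, `y_1 ↦ y_1` and `x_i, y_i ↦ 0` for `i ≥ 2`. -/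
def projOne (g : ℕ) (hg : 1 ≤ g) : HQ g →ₗ[ℚ] HQ 1 :=
  LinearMap.funLeft ℚ ℚ (Sum.map (Fin.castLE hg) (Fin.castLE hg))

end GenusOne

end

/-!
Part (ii). The tensors of symplectic derivations are the tensors in `H ⊗ L` which are invariant
under the cyclic permutation of the places: for `t = ∑ a ⊗ D_a` the bracket `∑ [a, D_a]`, which is
`D(ω₀)`, is the difference of `t` and its cyclic permutation (`rot_derToTensor`). The operator
`1 ⊗ p_{N-1}` maps `H^{⊗N}` into `H ⊗ L(N-1)` and, by the Dynkin identity, multiplies the elements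
of `H ⊗ L(N-1)` by `N - 1`; the operator `S_N` preserves `H ⊗ L(N-1)` and multiplies cyclically
invariant tensors by `N`. So the operator which defines `H_λ` maps the `Sp`-invariant tensors onto
the invariant derivations. The classical invariant theory of `SL(2)` says that the invariant
tensors are spanned by the chord tensors (`matchingFunctions_subset_range`).

It remains to see that in genus one these come from the single eigenspace with eigenvalue `μ_λ`,
`λ` a column. In genus one the Gram matrix of the chord tensors is the pairing at `g = 1`, and
`μ_λ` does not vanish there, so `Φ` is injective on the eigenspace (`eq_zero_of_Phi_eq_zero`). The
rows of this Gram matrix are skein functions: functions of chord diagrams satisfying the three-term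
relation which in genus one holds between the three ways to join four points. For every genus the
skein functions are eigenvectors with eigenvalue `μ_λ`, and a symmetric matrix has the same image
as its square, so every combination of chord tensors comes from the eigenspace
(`exists_mem_eigenspace_Phi_eq`).

Since the operator which defines `H_λ` is induced by an operator on chord diagrams that does not
depend on the genus, and the projection of a chord tensor to genus one is a chord tensor, the
statement for every genus follows from the one for genus one.

Part (i). Any finite-dimensional representation which embeds into the tensor algebra of `H` is a
sum of representations `[j]` (`exists_isIrredDecomp`), since the tensor algebra is generated by
images of symmetric powers (`symPowSpan_tensorRep`). The leading term is therefore determined by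
the dimensions of the eigenspaces of the torus element `diag(2, 1/2)`
(`hasLeadingTerm_of_weightSpace`). A derivation of degree `p + q` and weight `p - q` is a pair of
elements `u = D(x)`, `v = D(y)` of bidegrees `(p + 1, q)` and `(p, q + 1)` such that
`[u, y] + [x, v] = 0`. This bracket map is onto the part of bidegree `(p + 1, q + 1)`, so the
dimensions follow from those of the parts of the free Lie algebra of degree at most `3` in `y`
(`finrank_weightSpace_sympDer`). By Lazard elimination the part of positive degree in `y` is the
free Lie algebra on `z_i = ad(x)^i(y)`; the Dynkin identity with respect to the degree in `y`
(`zBracket_zEval`) exhibits each part as the image of a multiple of a projection of a space of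
words in the `z_i`, and its dimension is a trace (`finrank_biL_eq_sum`).
-/

noncomputable section

namespace GenusOne

variable {g : ℕ}

/-! ### Words in the tensor algebra -/

/-- The tensor algebra of `H_ℚ`. -/
abbrev TA (g : ℕ) : Type := TensorAlgebra ℚ (HQ g)

/-- A vector of the symplectic basis as an element of the tensor algebra. -/
def letter (g : ℕ) (a : SpIdx g) : TA g := TensorAlgebra.ι ℚ (basisVec g a)

/-- The product in the tensor algebra of a list of vectors of the symplectic basis. -/
def word (g : ℕ) (l : List (SpIdx g)) : TA g := (l.map (letter g)).prod

@[simp] theorem word_nil : word g [] = 1 := rfl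

@[simp] theorem word_cons (a : SpIdx g) (l : List (SpIdx g)) :
    word g (a :: l) = letter g a * word g l := by simp [word]

@[simp] theorem word_append (l m : List (SpIdx g)) :
    word g (l ++ m) = word g l * word g m := by simp [word]

/-- The words form a basis of the tensor algebra. -/
def wordBasis (g : ℕ) : Module.Basis (List (SpIdx g)) ℚ (TA g) :=
  ((Pi.basisFun ℚ (SpIdx g)).tensorAlgebra).reindex FreeMonoid.toList

@[simp] theorem wordBasis_apply (l : List (SpIdx g)) : wordBasis g l = word g l := by
  have h : FreeAlgebra.basisFreeMonoid ℚ (SpIdx g) (FreeMonoid.ofList l) =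
      (l.map (FreeAlgebra.ι ℚ)).prod := by
    change FreeAlgebra.equivMonoidAlgebraFreeMonoid.symm
      (MonoidAlgebra.single (FreeMonoid.ofList l) 1) = _
    rw [AlgEquiv.symm_apply_eq, map_list_prod, List.map_map]
    induction l with
    | nil => rfl
    | cons a l ih =>
      rw [List.map_cons, List.prod_cons, ← ih]
      simp [FreeAlgebra.equivMonoidAlgebraFreeMonoid, MonoidAlgebra.single_mul_single]
  simp only [wordBasis, Module.Basis.reindex_apply, Module.Basis.tensorAlgebra,
    Module.Basis.map_apply, FreeMonoid.toList_symm]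
  rw [h]
  change (TensorAlgebra.equivFreeAlgebra (Pi.basisFun ℚ (SpIdx g))).symm _ = _
  rw [map_list_prod, List.map_map, word]
  congr 2
  funext a
  simp [letter, basisVec]

theorem span_word : Submodule.span ℚ (Set.range (word g)) = ⊤ := by
  rw [← (wordBasis g).span_eq]
  congr 2
  funext l
  simp

/-- The basis of pure tensors of symplectic basis vectors. -/
def tensorBasis (g N : ℕ) : Module.Basis (Fin N → SpIdx g) ℚ (⨂[ℚ]^N (HQ g)) :=
  Basis.piTensorProduct fun _ => Pi.basisFun ℚ (SpIdx g)

@[simp] theorem tensorBasis_apply {N : ℕ} (f : Fin N → SpIdx g) :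
    tensorBasis g N f = PiTensorProduct.tprod ℚ fun i => basisVec g (f i) := by
  simp [tensorBasis, basisVec]

theorem toTensorAlgebra_tprod_basisVec {N : ℕ} (f : Fin N → SpIdx g) :
    TensorPower.toTensorAlgebra (PiTensorProduct.tprod ℚ fun i => basisVec g (f i)) =
      word g (List.ofFn f) := by
  rw [TensorPower.toTensorAlgebra_tprod, TensorAlgebra.tprod_apply, word, List.map_ofFn]
  rfl

theorem toTensorAlgebra_tensorBasis {N : ℕ} (f : Fin N → SpIdx g) :
    TensorPower.toTensorAlgebra (tensorBasis g N f) = word g (List.ofFn f) := by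
  rw [tensorBasis_apply, toTensorAlgebra_tprod_basisVec]

theorem toTensorAlgebra_injective {N : ℕ} :
    Function.Injective (TensorPower.toTensorAlgebra : ⨂[ℚ]^N (HQ g) →ₗ[ℚ] TA g) := by
  have h : LinearIndependent ℚ fun f : Fin N → SpIdx g =>
      TensorPower.toTensorAlgebra (tensorBasis g N f) := by
    simp only [toTensorAlgebra_tensorBasis]
    have := (wordBasis g).linearIndependent.comp (fun f : Fin N → SpIdx g => List.ofFn f)
      List.ofFn_injective
    simpa [Function.comp_def] using this
  have h' : (TensorPower.toTensorAlgebra : ⨂[ℚ]^N (HQ g) →ₗ[ℚ] TA g) =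
      Finsupp.linearCombination ℚ (fun f : Fin N → SpIdx g =>
        TensorPower.toTensorAlgebra (tensorBasis g N f)) ∘ₗ (tensorBasis g N).repr.toLinearMap :=
    (tensorBasis g N).ext fun f => by
      rw [LinearMap.comp_apply, LinearEquiv.coe_coe, Module.Basis.repr_self,
        Finsupp.linearCombination_single, one_smul]
  rw [h', LinearMap.coe_comp]
  exact Function.Injective.comp h (tensorBasis g N).repr.injective

/-! ### The Dynkin operator -/

@[simp] theorem lieToTensorLin_gen (a : SpIdx g) : lieToTensorLin g (gen g a) = letter g a := by
  simp [lieToTensorLin, lieToTensor, gen, letter, FreeLieAlgebra.lift_of_apply]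

theorem lieToTensorLin_lie (u v : FreeLie g) : lieToTensorLin g ⁅u, v⁆ =
    lieToTensorLin g u * lieToTensorLin g v - lieToTensorLin g v * lieToTensorLin g u := by
  let _ : LieRing (TA g) := LieRing.ofAssociativeRing
  exact LieHom.map_lie (lieToTensor g) u v

/-- Induction on a homogeneous element of the free Lie algebra, for properties closed under
linear combinations. -/
theorem lieDegree_induction {p : (n : ℕ) → FreeLie g → Prop}
    (gen : ∀ a, p 1 (gen g a))
    (lie : ∀ m n u v, u ∈ lieDegree g m → v ∈ lieDegree g n → p m u → p n v → p (m + n) ⁅u, v⁆)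
    (zero : ∀ n, p n 0) (add : ∀ n u v, p n u → p n v → p n (u + v))
    (smul : ∀ n (c : ℚ) u, p n u → p n (c • u)) {n : ℕ} {u : FreeLie g}
    (hu : u ∈ lieDegree g n) : p n u := by
  induction hu using Submodule.span_induction with
  | mem u hu =>
    have hu' : IsLieMonomial g n u := hu
    clear hu
    induction hu' with
    | gen a => exact gen a
    | lie h1 h2 ih1 ih2 =>
      exact lie _ _ _ _ (Submodule.subset_span h1) (Submodule.subset_span h2) ih1 ih2
  | zero => exact zero n
  | add u v _ _ h1 h2 => exact add _ _ _ h1 h2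
  | smul c u _ h1 => exact smul _ _ _ h1

/-- The right action of a vector `v` of `H_ℚ` on `ℚ × L_{g,1}`, given by
`(c, u) ↦ (0, c v + [u, v])`. -/
def rightStep (g : ℕ) : HQ g →ₗ[ℚ] (Module.End ℚ (ℚ × FreeLie g))ᵐᵒᵖ :=
  (MulOpposite.opLinearEquiv ℚ).toLinearMap ∘ₗ
    (Fintype.linearCombination ℚ fun a : SpIdx g =>
      (LinearMap.inr ℚ ℚ (FreeLie g) ∘ₗ (LinearMap.coprod (LinearMap.toSpanSingleton ℚ _ (gen g a))
        (-(LieAlgebra.ad ℚ (FreeLie g) (gen g a)))) : Module.End ℚ (ℚ × FreeLie g)))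

/-- The right action of the tensor algebra on `ℚ × L_{g,1}` which extends `rightStep`. -/
def rightAct (g : ℕ) : TA g →ₐ[ℚ] (Module.End ℚ (ℚ × FreeLie g))ᵐᵒᵖ :=
  TensorAlgebra.lift ℚ (rightStep g)

theorem rightAct_letter (a : SpIdx g) (p : ℚ × FreeLie g) :
    (rightAct g (letter g a)).unop p = (0, p.1 • gen g a + ⁅p.2, gen g a⁆) := by
  simp only [rightAct, letter, TensorAlgebra.lift_ι_apply, rightStep, basisVec]
  rw [LinearMap.comp_apply]
  simp [Fintype.linearCombination_apply_single]

theorem rightAct_mul (s t : TA g) (p : ℚ × FreeLie g) :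
    (rightAct g (s * t)).unop p = (rightAct g t).unop ((rightAct g s).unop p) := by
  simp [rightAct]

/-- The Dynkin operator `v_1 ⋯ v_n ↦ [[v_1, v_2], …, v_n]` from the tensor algebra to the free
Lie algebra. -/
def dynkin (g : ℕ) : TA g →ₗ[ℚ] FreeLie g where
  toFun t := ((rightAct g t).unop (1, 0)).2
  map_add' s t := by simp
  map_smul' c t := by simp

theorem dynkin_letter (a : SpIdx g) : dynkin g (letter g a) = gen g a := by
  simp [dynkin, rightAct_letter]

/-- A Lie element `v` of degree `n` acts on the right by `[·, v]` on the free Lie algebra and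
sends the vacuum `(1, 0)` to `n v`. -/
theorem rightAct_lieToTensorLin {n : ℕ} {v : FreeLie g} (hv : v ∈ lieDegree g n)
    (p : ℚ × FreeLie g) : (rightAct g (lieToTensorLin g v)).unop p =
      (0, (p.1 * n) • v + ⁅p.2, v⁆) := by
  revert p
  refine lieDegree_induction (p := fun n v => ∀ p, (rightAct g (lieToTensorLin g v)).unop p =
      (0, (p.1 * (n : ℚ)) • v + ⁅p.2, v⁆)) ?_ ?_ ?_ ?_ ?_ hv
  · intro a p
    rw [lieToTensorLin_gen, rightAct_letter]; simp
  · intro m n u v _ _ hu hv p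
    rw [lieToTensorLin_lie, map_sub, MulOpposite.unop_sub, LinearMap.sub_apply, rightAct_mul,
      rightAct_mul, hu, hv, hv, hu]
    simp only [Prod.mk_sub_mk, sub_self, zero_mul, zero_smul, zero_add, add_lie, smul_lie,
      Prod.mk.injEq, true_and]
    have h1 : ⁅⁅p.2, v⁆, u⁆ = ⁅⁅p.2, u⁆, v⁆ - ⁅p.2, ⁅u, v⁆⁆ := by
      rw [leibniz_lie p.2 u v, ← lie_skew u ⁅p.2, v⁆]; abel
    rw [h1, ← lie_skew u v]
    push_cast
    module
  · intro n p; simp [Prod.ext_iff]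
  · intro n u v hu hv p
    rw [map_add, map_add, MulOpposite.unop_add, LinearMap.add_apply, hu, hv]
    simp only [Prod.mk_add_mk, add_zero, lie_add, Prod.mk.injEq, true_and]
    module
  · intro n c u hu p
    rw [map_smul, map_smul, MulOpposite.unop_smul, LinearMap.smul_apply, hu]
    simp only [Prod.smul_mk, smul_zero, lie_smul, Prod.mk.injEq, true_and]
    module

/-- The theorem of Dynkin, Specht and Wever. -/
theorem dynkin_lieToTensorLin {n : ℕ} {v : FreeLie g} (hv : v ∈ lieDegree g n) :
    dynkin g (lieToTensorLin g v) = (n : ℚ) • v := by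
  simp [dynkin, rightAct_lieToTensorLin hv]

theorem lieToTensorLin_eq_zero {n : ℕ} (hn : n ≠ 0) {v : FreeLie g} (hv : v ∈ lieDegree g n)
    (h : lieToTensorLin g v = 0) : v = 0 := by
  have := dynkin_lieToTensorLin hv
  rw [h, map_zero] at this
  exact (smul_eq_zero.mp this.symm).resolve_left (by exact_mod_cast hn)

theorem rightAct_word_fst_snd (l : List (SpIdx g)) (a : SpIdx g) :
    dynkin g (word g (l ++ [a])) =
      (if l = [] then (1 : ℚ) else 0) • gen g a + ⁅dynkin g (word g l), gen g a⁆ := by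
  have h : ((rightAct g (word g l)).unop (1, 0)).1 = if l = [] then (1 : ℚ) else 0 := by
    induction l using List.reverseRecOn with
    | nil => simp
    | append_singleton l b _ => simp [rightAct_letter]
  simp only [dynkin, LinearMap.coe_mk, AddHom.coe_mk, word_append, rightAct_mul, word_cons,
    word_nil, mul_one, rightAct_letter, h]

theorem dynkin_word_mem {l : List (SpIdx g)} (hl : l ≠ []) :
    dynkin g (word g l) ∈ lieDegree g l.length := by
  induction l using List.reverseRecOn with
  | nil => exact absurd rfl hl
  | append_singleton l a ih =>
    rw [rightAct_word_fst_snd]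
    by_cases h : l = []
    · subst h
      simp only [if_true, one_smul, List.nil_append, List.length_singleton]
      have : dynkin g (word g []) = 0 := by simp [dynkin]
      rw [this, zero_lie, add_zero]
      exact Submodule.subset_span (IsLieMonomial.gen a)
    · rw [if_neg h, zero_smul, zero_add, List.length_append]
      exact lie_mem_lieDegree (ih h) (Submodule.subset_span (IsLieMonomial.gen a))

theorem lieToTensorLin_dynkin_word_append {l : List (SpIdx g)} (hl : l ≠ []) (a : SpIdx g) :
    lieToTensorLin g (dynkin g (word g (l ++ [a]))) =
      lieToTensorLin g (dynkin g (word g l)) * letter g a -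
        letter g a * lieToTensorLin g (dynkin g (word g l)) := by
  rw [rightAct_word_fst_snd, if_neg hl, zero_smul, zero_add, lieToTensorLin_lie,
    lieToTensorLin_gen]

/-- The span of the words of length `n`. -/
def wordDegree (g n : ℕ) : Submodule ℚ (TA g) :=
  Submodule.span ℚ {t | ∃ l : List (SpIdx g), l.length = n ∧ word g l = t}

theorem word_mem_wordDegree (l : List (SpIdx g)) : word g l ∈ wordDegree g l.length :=
  Submodule.subset_span ⟨l, rfl, rfl⟩

theorem mul_mem_wordDegree {m n : ℕ} {s t : TA g} (hs : s ∈ wordDegree g m)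
    (ht : t ∈ wordDegree g n) : s * t ∈ wordDegree g (m + n) := by
  induction hs using Submodule.span_induction with
  | mem s hs =>
    obtain ⟨l, rfl, rfl⟩ := hs
    induction ht using Submodule.span_induction with
    | mem t ht =>
      obtain ⟨l', rfl, rfl⟩ := ht
      rw [← word_append, ← List.length_append]
      exact word_mem_wordDegree _
    | zero => simp
    | add t t' _ _ h h' => rw [mul_add]; exact add_mem h h'
    | smul c t _ h => rw [mul_smul_comm]; exact Submodule.smul_mem _ _ h
  | zero => simp
  | add s s' _ _ h h' => rw [add_mul]; exact add_mem h h'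
  | smul c s _ h => rw [smul_mul_assoc]; exact Submodule.smul_mem _ _ h

theorem letter_mem_wordDegree (a : SpIdx g) : letter g a ∈ wordDegree g 1 := by
  simpa using word_mem_wordDegree [a]

theorem lieToTensorLin_mem_wordDegree {n : ℕ} {v : FreeLie g} (hv : v ∈ lieDegree g n) :
    lieToTensorLin g v ∈ wordDegree g n := by
  refine lieDegree_induction (p := fun n v => lieToTensorLin g v ∈ wordDegree g n)
    ?_ ?_ ?_ ?_ ?_ hv
  · intro a; rw [lieToTensorLin_gen]; exact letter_mem_wordDegree a
  · intro m n u v _ _ hu hv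
    rw [lieToTensorLin_lie]
    exact sub_mem (mul_mem_wordDegree hu hv) (add_comm m n ▸ mul_mem_wordDegree hv hu)
  · intro n; simp
  · intro n u v hu hv; rw [map_add]; exact add_mem hu hv
  · intro n c u hu; rw [map_smul]; exact Submodule.smul_mem _ _ hu

theorem range_toTensorAlgebra (g N : ℕ) :
    LinearMap.range (TensorPower.toTensorAlgebra : ⨂[ℚ]^N (HQ g) →ₗ[ℚ] TA g) =
      wordDegree g N := by
  rw [LinearMap.range_eq_map, ← (tensorBasis g N).span_eq, Submodule.map_span, ← Set.range_comp]
  congr 1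
  ext t
  simp only [Set.mem_range, Function.comp_apply, toTensorAlgebra_tensorBasis, Set.mem_ofPred_eq]
  constructor
  · rintro ⟨f, rfl⟩
    exact ⟨_, by simp, rfl⟩
  · rintro ⟨l, rfl, rfl⟩
    exact ⟨l.get, by rw [List.ofFn_get]⟩

/-- The subspace `H_ℚ ⊗ L_{g,1}(n)` of the tensor algebra. -/
def tensorLie (g n : ℕ) : Submodule ℚ (TA g) :=
  Submodule.span ℚ {t | ∃ a, ∃ u ∈ lieDegree g n, letter g a * lieToTensorLin g u = t}

theorem letter_mul_mem_tensorLie {n : ℕ} (a : SpIdx g) {u : FreeLie g} (hu : u ∈ lieDegree g n) :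
    letter g a * lieToTensorLin g u ∈ tensorLie g n := Submodule.subset_span ⟨a, u, hu, rfl⟩

theorem tensorLie_le_wordDegree (g n : ℕ) : tensorLie g n ≤ wordDegree g (n + 1) := by
  refine Submodule.span_le.mpr ?_
  rintro _ ⟨a, u, hu, rfl⟩
  rw [add_comm]
  exact mul_mem_wordDegree (letter_mem_wordDegree a) (lieToTensorLin_mem_wordDegree hu)

theorem mem_tensorLie_iff {n : ℕ} {t : TA g} : t ∈ tensorLie g n ↔
    ∃ u : SpIdx g → FreeLie g, (∀ a, u a ∈ lieDegree g n) ∧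
      ∑ a, letter g a * lieToTensorLin g (u a) = t := by
  constructor
  · intro ht
    induction ht using Submodule.span_induction with
    | mem t ht =>
      obtain ⟨a, u, hu, rfl⟩ := ht
      refine ⟨Pi.single a u, fun b => ?_, ?_⟩
      · by_cases h : b = a
        · subst h; simpa using hu
        · simp [Pi.single_eq_of_ne h]
      · rw [Finset.sum_eq_single a]
        · simp
        · intro b _ h; simp [Pi.single_eq_of_ne h]
        · simp
    | zero => exact ⟨0, by simp, by simp⟩
    | add s t _ _ hs ht =>
      obtain ⟨u, hu, rfl⟩ := hs
      obtain ⟨v, hv, rfl⟩ := ht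
      exact ⟨u + v, fun a => add_mem (hu a) (hv a), by simp [mul_add, Finset.sum_add_distrib]⟩
    | smul c t _ ht =>
      obtain ⟨u, hu, rfl⟩ := ht
      exact ⟨c • u, fun a => Submodule.smul_mem _ _ (hu a), by simp [Finset.smul_sum]⟩
  · rintro ⟨u, hu, rfl⟩
    exact Submodule.sum_mem _ fun a _ => letter_mul_mem_tensorLie a (hu a)

/-- A tensor has at most one expression with a given first factor. -/
theorem letter_mul_sum_injective {s t : SpIdx g → TA g}
    (h : ∑ a, letter g a * s a = ∑ a, letter g a * t a) : s = t := by
  -- removing the letter `a` at the front of a word inverts the multiplication by it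
  let strip (a : SpIdx g) : TA g →ₗ[ℚ] TA g := (wordBasis g).constr ℚ fun l =>
    match l with
    | [] => 0
    | b :: m => if b = a then word g m else 0
  have hs : ∀ a b (w : TA g), strip a (letter g b * w) = if b = a then w else 0 := by
    intro a b w
    have : strip a ∘ₗ LinearMap.mulLeft ℚ (letter g b) =
        if b = a then LinearMap.id else 0 := by
      refine (wordBasis g).ext fun l => ?_
      rw [LinearMap.comp_apply, LinearMap.mulLeft_apply, wordBasis_apply, ← word_cons,
        ← wordBasis_apply, Module.Basis.constr_basis]
      by_cases h : b = a <;> simp [h]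
    have := LinearMap.congr_fun this w
    rw [LinearMap.comp_apply, LinearMap.mulLeft_apply] at this
    rw [this]
    split_ifs <;> rfl
  funext a
  have := congrArg (strip a) h
  simpa only [map_sum, hs, Finset.sum_ite_eq', Finset.mem_univ, if_true] using this

/-! ### Cyclic symmetrization -/

/-- The sum of `z * b * t * a` over all factorizations `a ++ [z] ++ b` of a list. -/
def cutList (g : ℕ) : List (SpIdx g) → TA g →ₗ[ℚ] TA g
  | [] => 0
  | z :: l => LinearMap.mulLeft ℚ (word g (z :: l)) +
      cutList g l ∘ₗ LinearMap.mulRight ℚ (letter g z)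

/-- The bilinear map which sends a word `w` and a tensor `t` to the sum of `z b t a` over all
letters `z` of `w`, where `w = a z b`. -/
def cut (g : ℕ) : TA g →ₗ[ℚ] TA g →ₗ[ℚ] TA g := (wordBasis g).constr ℚ (cutList g)

theorem cut_word (l : List (SpIdx g)) : cut g (word g l) = cutList g l := by
  rw [← wordBasis_apply, cut, Module.Basis.constr_basis]

theorem cut_letter (a : SpIdx g) (t : TA g) : cut g (letter g a) t = letter g a * t := by
  have : letter g a = word g [a] := by simp
  rw [this, cut_word]
  simp [cutList]

theorem cutList_append (l m : List (SpIdx g)) (t : TA g) :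
    cutList g (l ++ m) t = cutList g l (word g m * t) + cutList g m (t * word g l) := by
  induction l generalizing t with
  | nil => simp [cutList]
  | cons z l ih =>
    simp only [List.cons_append, cutList, LinearMap.add_apply, LinearMap.comp_apply,
      LinearMap.mulLeft_apply, LinearMap.mulRight_apply, word_cons, word_append, ih, mul_assoc]
    abel

theorem tensor_induction {p : TA g → Prop} (word : ∀ l, p (word g l)) (zero : p 0)
    (add : ∀ s t, p s → p t → p (s + t)) (smul : ∀ (c : ℚ) t, p t → p (c • t)) (t : TA g) :
    p t := by
  have ht : t ∈ Submodule.span ℚ (Set.range (GenusOne.word g)) := span_word ▸ Submodule.mem_top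
  induction ht using Submodule.span_induction with
  | mem t ht => obtain ⟨l, rfl⟩ := ht; exact word l
  | zero => exact zero
  | add s t _ _ h1 h2 => exact add s t h1 h2
  | smul c t _ h => exact smul c t h

theorem cut_mul (s s' t : TA g) : cut g (s * s') t = cut g s (s' * t) + cut g s' (t * s) := by
  induction s using tensor_induction with
  | word l =>
    induction s' using tensor_induction with
    | word m => rw [← word_append, cut_word, cut_word, cut_word, cutList_append]
    | zero => simp
    | add u v hu hv => simp only [mul_add, add_mul, map_add, LinearMap.add_apply, hu, hv]; abel
    | smul c u hu => simp only [mul_smul_comm, smul_mul_assoc, map_smul, LinearMap.smul_apply, hu,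
        smul_add]
  | zero => simp
  | add u v hu hv => simp only [mul_add, add_mul, map_add, LinearMap.add_apply, hu, hv]; abel
  | smul c u hu => simp only [mul_smul_comm, smul_mul_assoc, map_smul, LinearMap.smul_apply, hu,
        smul_add]

/-- Cutting the tree of a Lie element `u` at each of its leaves and grafting the Lie element `t`
at the root gives trees with a new root. -/
theorem cut_lie_mem_tensorLie {m n N : ℕ} {u t : FreeLie g} (hu : u ∈ lieDegree g m)
    (ht : t ∈ lieDegree g n) (hN : m + n = N + 1) :
    cut g (lieToTensorLin g u) (lieToTensorLin g t) ∈ tensorLie g N := by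
  revert n t N
  refine lieDegree_induction (p := fun m u => ∀ {n N : ℕ} {t : FreeLie g}, t ∈ lieDegree g n →
    m + n = N + 1 → cut g (lieToTensorLin g u) (lieToTensorLin g t) ∈ tensorLie g N)
    ?_ ?_ ?_ ?_ ?_ hu
  · intro a n N t ht hN
    obtain rfl : n = N := by omega
    rw [lieToTensorLin_gen, cut_letter]
    exact letter_mul_mem_tensorLie a ht
  · intro p q u v hu hv ihu ihv n N t ht hN
    have h : cut g (lieToTensorLin g ⁅u, v⁆) (lieToTensorLin g t) =
        cut g (lieToTensorLin g u) (lieToTensorLin g ⁅v, t⁆) -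
          cut g (lieToTensorLin g v) (lieToTensorLin g ⁅u, t⁆) := by
      simp only [lieToTensorLin_lie, map_sub, LinearMap.sub_apply, cut_mul]
      abel
    rw [h]
    exact sub_mem (ihu (lie_mem_lieDegree hv ht) (by omega))
      (ihv (lie_mem_lieDegree hu ht) (by omega))
  · intro m n N t _ _; simp
  · intro m u v hu hv n N t ht hN
    rw [map_add, map_add, LinearMap.add_apply]; exact add_mem (hu ht hN) (hv ht hN)
  · intro m c u hu n N t ht hN
    rw [map_smul, map_smul, LinearMap.smul_apply]; exact Submodule.smul_mem _ _ (hu ht hN)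

/-- The sum of all cyclic rotations of a word. -/
def cyc (g : ℕ) : TA g →ₗ[ℚ] TA g := (cut g).flip 1

theorem cutList_word (l m : List (SpIdx g)) : cutList g l (word g m) =
    ∑ j ∈ Finset.range l.length, word g ((m ++ l).rotate (m.length + j)) := by
  induction l generalizing m with
  | nil => simp [cutList]
  | cons z l ih =>
    rw [List.length_cons, Finset.sum_range_succ', cutList, LinearMap.add_apply,
      LinearMap.comp_apply, LinearMap.mulLeft_apply, LinearMap.mulRight_apply, add_comm]
    congr 1
    · have : word g m * letter g z = word g (m ++ [z]) := by simp
      rw [this, ih]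
      refine Finset.sum_congr rfl fun j _ => ?_
      simp only [List.append_assoc, List.singleton_append, List.length_append,
        List.length_singleton, add_assoc, add_comm 1 j]
    · rw [add_zero, List.rotate_append_length_eq, ← word_append]

theorem cyc_word (l : List (SpIdx g)) :
    cyc g (word g l) = ∑ j ∈ Finset.range l.length, word g (l.rotate j) := by
  rw [cyc, LinearMap.flip_apply, cut_word, ← word_nil, cutList_word]
  simp

theorem cyc_mem_tensorLie {n : ℕ} {t : TA g} (ht : t ∈ tensorLie g n) :
    cyc g t ∈ tensorLie g n := by
  induction ht using Submodule.span_induction with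
  | mem t ht =>
    obtain ⟨a, u, hu, rfl⟩ := ht
    rw [cyc, LinearMap.flip_apply, cut_mul, cut_letter, mul_one, one_mul, ← lieToTensorLin_gen]
    refine add_mem ?_ (cut_lie_mem_tensorLie hu
      (Submodule.subset_span (IsLieMonomial.gen a)) rfl)
    rw [lieToTensorLin_gen]
    exact letter_mul_mem_tensorLie a hu
  | zero => simp
  | add s t _ _ h1 h2 => rw [map_add]; exact add_mem h1 h2
  | smul c t _ h => rw [map_smul]; exact Submodule.smul_mem _ _ h

/-- The cyclic rotation which moves the first letter of a word to its end. -/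
def rot (g : ℕ) : TA g →ₗ[ℚ] TA g := (wordBasis g).constr ℚ fun l => word g (l.rotate 1)

theorem rot_word (l : List (SpIdx g)) : rot g (word g l) = word g (l.rotate 1) := by
  rw [← wordBasis_apply, rot, Module.Basis.constr_basis]

theorem rot_letter_mul (a : SpIdx g) (t : TA g) : rot g (letter g a * t) = t * letter g a := by
  induction t using tensor_induction with
  | word l => rw [← word_cons, rot_word]; simp
  | zero => simp
  | add s t hs ht => rw [mul_add, map_add, hs, ht, add_mul]
  | smul c t ht => rw [mul_smul_comm, map_smul, ht, smul_mul_assoc]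

theorem rot_cyc (t : TA g) : rot g (cyc g t) = cyc g t := by
  induction t using tensor_induction with
  | word l =>
    simp only [cyc_word, map_sum, rot_word, List.rotate_rotate]
    have h1 := Finset.sum_range_succ (fun j => word g (l.rotate j)) l.length
    have h2 := Finset.sum_range_succ' (fun j => word g (l.rotate j)) l.length
    rw [h1, List.rotate_length, List.rotate_zero] at h2
    exact (add_right_cancel h2).symm
  | zero => simp
  | add s t hs ht => simp only [map_add, hs, ht]
  | smul c t ht => simp only [map_smul, ht]

theorem cyc_eq_smul {N : ℕ} {t : TA g} (ht : t ∈ wordDegree g N) (h : rot g t = t) :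
    cyc g t = (N : ℚ) • t := by
  have h1 : cyc g t = ∑ j ∈ Finset.range N, ((rot g) ^ j) t := by
    clear h
    induction ht using Submodule.span_induction with
    | mem t ht =>
      obtain ⟨l, rfl, rfl⟩ := ht
      rw [cyc_word]
      refine Finset.sum_congr rfl fun j hj => ?_
      clear hj
      induction j with
      | zero => simp
      | succ j ih => rw [pow_succ', Module.End.mul_apply, ← ih, rot_word, List.rotate_rotate]
    | zero => simp
    | add s t _ _ h1 h2 => simp only [map_add, h1, h2, Finset.sum_add_distrib]
    | smul c t _ h => simp only [map_smul, h, Finset.smul_sum]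
  have h2 : ∀ j, ((rot g) ^ j) t = t := by
    intro j
    induction j with
    | zero => simp
    | succ j ih => rw [pow_succ, Module.End.mul_apply, h, ih]
  simp [h1, h2, Nat.cast_smul_eq_nsmul]

/-! ### Derivations of the free Lie algebra -/

/-- The Lie algebra `L ⊗ ℚ[ε]` over the dual numbers, as pairs `u + ε v`. -/
def DualLie (g : ℕ) : Type := FreeLie g × FreeLie g

namespace DualLie

instance : AddCommGroup (DualLie g) := inferInstanceAs (AddCommGroup (FreeLie g × FreeLie g))

instance : Module ℚ (DualLie g) := inferInstanceAs (Module ℚ (FreeLie g × FreeLie g))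

instance : Bracket (DualLie g) (DualLie g) :=
  ⟨fun p q => (⁅p.1, q.1⁆, ⁅p.1, q.2⁆ + ⁅p.2, q.1⁆)⟩

instance : LieRing (DualLie g) where
  add_lie p q r := by
    refine Prod.ext (add_lie p.1 q.1 r.1) ?_
    change ⁅p.1 + q.1, r.2⁆ + ⁅p.2 + q.2, r.1⁆ =
      (⁅p.1, r.2⁆ + ⁅p.2, r.1⁆) + (⁅q.1, r.2⁆ + ⁅q.2, r.1⁆)
    rw [add_lie, add_lie]; abel
  lie_add p q r := by
    refine Prod.ext (lie_add p.1 q.1 r.1) ?_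
    change ⁅p.1, q.2 + r.2⁆ + ⁅p.2, q.1 + r.1⁆ =
      (⁅p.1, q.2⁆ + ⁅p.2, q.1⁆) + (⁅p.1, r.2⁆ + ⁅p.2, r.1⁆)
    rw [lie_add, lie_add]; abel
  lie_self p := by
    refine Prod.ext (lie_self p.1) ?_
    change ⁅p.1, p.2⁆ + ⁅p.2, p.1⁆ = 0
    rw [← lie_skew p.1 p.2]; abel
  leibniz_lie p q r := by
    refine Prod.ext (leibniz_lie p.1 q.1 r.1) ?_
    change ⁅p.1, ⁅q.1, r.2⁆ + ⁅q.2, r.1⁆⁆ + ⁅p.2, ⁅q.1, r.1⁆⁆ =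
      (⁅⁅p.1, q.1⁆, r.2⁆ + ⁅⁅p.1, q.2⁆ + ⁅p.2, q.1⁆, r.1⁆) +
        (⁅q.1, ⁅p.1, r.2⁆ + ⁅p.2, r.1⁆⁆ + ⁅q.2, ⁅p.1, r.1⁆⁆)
    rw [lie_add, add_lie, lie_add, leibniz_lie p.1 q.1 r.2, leibniz_lie p.1 q.2 r.1,
      leibniz_lie p.2 q.1 r.1]
    abel

instance : LieAlgebra ℚ (DualLie g) where
  lie_smul c p q := by
    refine Prod.ext (lie_smul c p.1 q.1) ?_
    change ⁅p.1, c • q.2⁆ + ⁅p.2, c • q.1⁆ = c • (⁅p.1, q.2⁆ + ⁅p.2, q.1⁆)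
    rw [lie_smul, lie_smul, smul_add]

/-- The projection `u + ε v ↦ u`. -/
def fstHom (g : ℕ) : DualLie g →ₗ⁅ℚ⁆ FreeLie g :=
  { LinearMap.fst ℚ (FreeLie g) (FreeLie g) with map_lie' := rfl }

/-- The homomorphism `u ↦ u + ε D(u)` for a derivation `D`. -/
def ofDer (D : Der g) : FreeLie g →ₗ⁅ℚ⁆ DualLie g where
  toFun u := (u, D u)
  map_add' u v := by rw [map_add]; rfl
  map_smul' c u := by rw [map_smul]; rfl
  map_lie' {u v} := by
    exact Prod.ext rfl (LieDerivation.apply_lie_eq_add D u v)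

/-- The homomorphism to `L ⊗ ℚ[ε]` which sends a generator `a` to `a + ε u_a`. -/
def liftGen (u : SpIdx g → FreeLie g) : FreeLie g →ₗ⁅ℚ⁆ DualLie g :=
  FreeLieAlgebra.lift ℚ fun a => ((gen g a, u a) : FreeLie g × FreeLie g)

theorem liftGen_gen (u : SpIdx g → FreeLie g) (a : SpIdx g) :
    liftGen u (gen g a) = (gen g a, u a) := FreeLieAlgebra.lift_of_apply ..

theorem liftGen_fst (u : SpIdx g → FreeLie g) (v : FreeLie g) : (liftGen u v).1 = v := by
  have : (fstHom g).comp (liftGen u) = LieHom.id := by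
    apply FreeLieAlgebra.hom_ext
    intro a
    change (liftGen u (gen g a)).1 = gen g a
    rw [liftGen_gen]
  exact LieHom.congr_fun this v

end DualLie

theorem der_ext {D E : Der g} (h : ∀ a, D (gen g a) = E (gen g a)) : D = E := by
  have h' : DualLie.ofDer D = DualLie.ofDer E := by
    apply FreeLieAlgebra.hom_ext
    intro a
    exact Prod.ext rfl (h a)
  ext u
  exact congrArg Prod.snd (LieHom.congr_fun h' u)

/-- The derivation of the free Lie algebra with prescribed values on the generators. -/
def derOfGen (u : SpIdx g → FreeLie g) : Der g where
  toFun v := (DualLie.liftGen u v).2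
  map_add' v w := by rw [map_add]; rfl
  map_smul' c v := by rw [map_smul]; rfl
  leibniz' v w := by
    change (DualLie.liftGen u ⁅v, w⁆).2 =
      ⁅v, (DualLie.liftGen u w).2⁆ - ⁅w, (DualLie.liftGen u v).2⁆
    rw [LieHom.map_lie]
    change ⁅(DualLie.liftGen u v).1, _⁆ + ⁅_, (DualLie.liftGen u w).1⁆ = _
    rw [DualLie.liftGen_fst, DualLie.liftGen_fst, ← lie_skew w]
    abel

theorem derOfGen_gen (u : SpIdx g → FreeLie g) (a : SpIdx g) : derOfGen u (gen g a) = u a := by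
  change (DualLie.liftGen u (gen g a)).2 = u a
  rw [DualLie.liftGen_gen]

theorem der_mem_lieDegree {k n : ℕ} {D : Der g} (hD : ∀ a, D (gen g a) ∈ lieDegree g (k + 1))
    {u : FreeLie g} (hu : u ∈ lieDegree g n) : D u ∈ lieDegree g (n + k) := by
  refine lieDegree_induction (p := fun n u => D u ∈ lieDegree g (n + k)) ?_ ?_ ?_ ?_ ?_ hu
  · intro a; rw [add_comm]; exact hD a
  · intro m n u v hu hv ihu ihv
    rw [LieDerivation.apply_lie_eq_add]
    refine add_mem ?_ ?_
    · rw [add_assoc]; exact lie_mem_lieDegree hu ihv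
    · rw [add_right_comm]; exact lie_mem_lieDegree ihu hv
  · intro n; simp
  · intro n u v hu hv; rw [map_add]; exact add_mem hu hv
  · intro n c u hu; rw [map_smul]; exact Submodule.smul_mem _ _ hu

/-! ### Symplectic derivations as cyclically invariant tensors -/

/-- The component of the tensor of a derivation `D` with first factor `x_i` or `y_i`, that is
`D(y_i)` or `- D(x_i)`. -/
def dualValue (D : Der g) : SpIdx g → FreeLie g
  | Sum.inl i => D (gen g (Sum.inr i))
  | Sum.inr i => -D (gen g (Sum.inl i))

theorem derToTensor_eq_sum (D : Der g) :
    derToTensor g D = ∑ a, letter g a * lieToTensorLin g (dualValue D a) := by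
  rw [Fintype.sum_sum_type, ← Finset.sum_add_distrib]
  change ∑ i : Fin g, _ = _
  refine Finset.sum_congr rfl fun i _ => ?_
  simp only [dualValue, map_neg, mul_neg, letter]
  rw [sub_eq_add_neg]

theorem der_omega (D : Der g) : D (omega g) = ∑ a, ⁅gen g a, dualValue D a⁆ := by
  rw [Fintype.sum_sum_type, ← Finset.sum_add_distrib, omega, map_sum]
  refine Finset.sum_congr rfl fun i _ => ?_
  rw [LieDerivation.apply_lie_eq_add]
  simp only [dualValue, lie_neg, lie_skew]

theorem sub_rot_sum (u : SpIdx g → FreeLie g) :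
    (∑ a, letter g a * lieToTensorLin g (u a)) -
      rot g (∑ a, letter g a * lieToTensorLin g (u a)) =
        lieToTensorLin g (∑ a, ⁅gen g a, u a⁆) := by
  simp only [map_sum, rot_letter_mul, ← Finset.sum_sub_distrib, lieToTensorLin_lie,
    lieToTensorLin_gen]

theorem dualValue_mem {k : ℕ} {D : Der g} (hD : D ∈ (sympDer g k).toSubmodule) (a : SpIdx g) :
    dualValue D a ∈ lieDegree g (k + 1) := by
  have h : ∀ b, D (gen g b) ∈ lieDegree g (k + 1) := fun b => by
    rw [add_comm]; exact hD.1 1 _ (Submodule.subset_span (IsLieMonomial.gen b))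
  cases a with
  | inl i => exact h _
  | inr i => exact neg_mem (h _)

theorem derToTensor_mem_tensorLie {k : ℕ} {D : Der g} (hD : D ∈ (sympDer g k).toSubmodule) :
    derToTensor g D ∈ tensorLie g (k + 1) := by
  rw [derToTensor_eq_sum]
  exact Submodule.sum_mem _ fun a _ => letter_mul_mem_tensorLie a (dualValue_mem hD a)

theorem rot_derToTensor {k : ℕ} {D : Der g} (hD : D ∈ (sympDer g k).toSubmodule) :
    rot g (derToTensor g D) = derToTensor g D := by
  have h := sub_rot_sum (dualValue D)
  rw [← der_omega, hD.2, map_zero, ← derToTensor_eq_sum] at h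
  exact (sub_eq_zero.mp h).symm

/-- Every cyclically invariant tensor in `H_ℚ ⊗ L_{g,1}(k + 1)` comes from a symplectic
derivation of degree `k`. -/
theorem exists_sympDer {k : ℕ} {t : TA g} (ht : t ∈ tensorLie g (k + 1)) (hr : rot g t = t) :
    ∃ D ∈ (sympDer g k).toSubmodule, derToTensor g D = t := by
  obtain ⟨u, hu, rfl⟩ := mem_tensorLie_iff.mp ht
  let D : Der g := derOfGen fun a => match a with
    | Sum.inl i => -u (Sum.inr i)
    | Sum.inr i => u (Sum.inl i)
  have hD : dualValue D = u := by
    funext a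
    cases a with
    | inl i => simp [dualValue, D, derOfGen_gen]
    | inr i => simp [dualValue, D, derOfGen_gen]
  refine ⟨D, ⟨fun n v hv => der_mem_lieDegree (fun a => ?_) hv, ?_⟩, ?_⟩
  · cases a with
    | inl i => simp only [D, derOfGen_gen]; exact neg_mem (hu _)
    | inr i => simp only [D, derOfGen_gen]; exact hu _
  · have h1 := sub_rot_sum u
    rw [hr, sub_self] at h1
    rw [der_omega, hD]
    refine lieToTensorLin_eq_zero (n := 1 + (k + 1)) (by omega) ?_ h1.symm
    exact Submodule.sum_mem _ fun a _ =>
      lie_mem_lieDegree (Submodule.subset_span (IsLieMonomial.gen a)) (hu a)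
  · rw [derToTensor_eq_sum, hD]

theorem derToTensor_eq_zero {k : ℕ} {D : Der g} (hD : D ∈ (sympDer g k).toSubmodule)
    (h : derToTensor g D = 0) : D = 0 := by
  rw [derToTensor_eq_sum] at h
  have h' : (fun a => lieToTensorLin g (dualValue D a)) = 0 :=
    letter_mul_sum_injective (t := 0) (by rw [h]; simp)
  have h2 : ∀ a, dualValue D a = 0 := fun a =>
    lieToTensorLin_eq_zero k.succ_ne_zero (dualValue_mem hD a) (congrFun h' a)
  refine der_ext fun a => ?_
  cases a with
  | inl i => simpa [dualValue] using h2 (Sum.inr i)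
  | inr i => simpa [dualValue] using h2 (Sum.inl i)

/-! ### The action of the symplectic group on tensors -/

/-- The action of a matrix on the tensor algebra. -/
def tensorAct (g : ℕ) (A : Matrix (SpIdx g) (SpIdx g) ℚ) : TA g →ₐ[ℚ] TA g :=
  TensorAlgebra.lift ℚ (TensorAlgebra.ι ℚ ∘ₗ A.toLin')

theorem tensorAct_letter (A : Matrix (SpIdx g) (SpIdx g) ℚ) (a : SpIdx g) :
    tensorAct g A (letter g a) = ∑ b, A b a • letter g b := by
  simp only [tensorAct, letter, TensorAlgebra.lift_ι_apply, LinearMap.comp_apply, ← map_smul,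
    ← map_sum]
  congr 1
  funext b
  rw [basisVec, Matrix.toLin'_apply, Matrix.mulVec_single_one]
  simp [basisVec, Finset.sum_apply, Pi.single_apply, Matrix.col]

theorem tensorAct_lieToTensorLin (A : Matrix (SpIdx g) (SpIdx g) ℚ) (u : FreeLie g) :
    tensorAct g A (lieToTensorLin g u) = lieToTensorLin g (lieAct g A u) := by
  let _ : LieRing (TA g) := LieRing.ofAssociativeRing
  have h : ((tensorAct g A : TA g →ₗ⁅ℚ⁆ TA g)).comp (lieToTensor g) =
      (lieToTensor g).comp (lieAct g A) := by
    apply FreeLieAlgebra.hom_ext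
    intro a
    change tensorAct g A (lieToTensorLin g (gen g a)) = lieToTensorLin g (lieAct g A (gen g a))
    rw [lieToTensorLin_gen, tensorAct_letter, lieAct_gen, map_sum]
    simp
  exact LieHom.congr_fun h u

theorem tensorAct_one : tensorAct g 1 = AlgHom.id ℚ _ := by
  simp only [tensorAct, Matrix.toLin'_one]
  ext; simp

theorem tensorAct_mul (A B : Matrix (SpIdx g) (SpIdx g) ℚ) :
    tensorAct g (A * B) = (tensorAct g A).comp (tensorAct g B) := by
  simp only [tensorAct, Matrix.toLin'_mul]
  ext; simp

/-- The representation of `Sp(2g, ℚ)` on the tensor algebra. -/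
def tensorRep (g : ℕ) : Representation ℚ (Sp g) (TA g) where
  toFun A := (tensorAct g A.1).toLinearMap
  map_one' := by
    change (tensorAct g 1).toLinearMap = 1
    rw [tensorAct_one]; rfl
  map_mul' A B := by
    change (tensorAct g (A.1 * B.1)).toLinearMap = _
    rw [tensorAct_mul]; rfl

theorem tensorRep_apply (A : Sp g) (t : TA g) : tensorRep g A t = tensorAct g A.1 t := rfl

/-- The matrix of the symplectic form. -/
def omegaMat (g : ℕ) : Matrix (SpIdx g) (SpIdx g) ℚ := Matrix.of (omegaCoeff g)

theorem omegaMat_eq : omegaMat g = -Matrix.J (Fin g) ℚ := by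
  ext a b
  rcases a with i | i <;> rcases b with j | j <;>
    simp [omegaMat, omegaCoeff, Matrix.J, Matrix.one_apply]
  split_ifs <;> simp

theorem symplectic_omegaMat (A : Sp g) : A.1 * omegaMat g * A.1.transpose = omegaMat g := by
  rw [omegaMat_eq, Matrix.mul_neg, Matrix.neg_mul, SymplecticGroup.mem_iff.mp A.2]

theorem derToTensor_eq_omega (D : Der g) : derToTensor g D =
    ∑ a, ∑ b, omegaCoeff g a b • (letter g a * lieToTensorLin g (D (gen g b))) := by
  rw [derToTensor_eq_sum]
  refine Finset.sum_congr rfl fun a _ => ?_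
  rw [Fintype.sum_sum_type]
  rcases a with i | i <;> simp [omegaCoeff, dualValue]

theorem derToTensor_conjDer (A : Sp g) (D : Der g) :
    derToTensor g (derRep g A D) = tensorRep g A (derToTensor g D) := by
  have hA : omegaMat g * (A⁻¹).1.transpose = A.1 * omegaMat g := by
    have h1 : A.1 * (A⁻¹).1 = 1 := congrArg Subtype.val (mul_inv_cancel A)
    have h2 : A.1.transpose * (A⁻¹).1.transpose = 1 := by
      rw [← Matrix.transpose_mul, (show (A⁻¹).1 * A.1 = 1 from
        congrArg Subtype.val (inv_mul_cancel A)), Matrix.transpose_one]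
    calc omegaMat g * (A⁻¹).1.transpose
        = A.1 * omegaMat g * (A.1.transpose * (A⁻¹).1.transpose) := by
          rw [← Matrix.mul_assoc, symplectic_omegaMat]
      _ = A.1 * omegaMat g := by rw [h2, Matrix.mul_one]
  have hA' : ∀ a c, ∑ b, omegaCoeff g a b * (A⁻¹).1 c b = ∑ d, A.1 a d * omegaCoeff g d c := by
    intro a c
    exact congrFun (congrFun hA a) c
  rw [derToTensor_eq_omega, derToTensor_eq_omega, tensorRep_apply]
  have hD : ∀ b, derRep g A D (gen g b) =
      ∑ c, (A⁻¹).1 c b • lieAct g A.1 (D (gen g c)) := by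
    intro b
    change lieAct g A.1 (D (lieAct g (A⁻¹).1 (gen g b))) = _
    rw [lieAct_gen]
    simp
  simp only [hD, map_sum, map_smul, map_mul, tensorAct_letter, tensorAct_lieToTensorLin,
    Finset.sum_mul, Finset.mul_sum, Finset.smul_sum, smul_mul_assoc, mul_smul_comm, smul_smul]
  calc _ = ∑ a, ∑ c, (∑ b, omegaCoeff g a b * (A⁻¹).1 c b) •
        (letter g a * lieToTensorLin g (lieAct g A.1 (D (gen g c)))) := by
        refine Finset.sum_congr rfl fun a _ => ?_
        rw [Finset.sum_comm]
        simp only [Finset.sum_smul]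
    _ = ∑ a, ∑ c, ∑ d, (A.1 a d * omegaCoeff g d c) •
        (letter g a * lieToTensorLin g (lieAct g A.1 (D (gen g c)))) := by
        simp only [hA', Finset.sum_smul]
    _ = _ := by
        rw [Finset.sum_comm]
        rw [Finset.sum_congr rfl fun c _ => Finset.sum_comm]
        rw [Finset.sum_comm]
        simp only [mul_comm]

/-! ### The operators of the definition of `H_λ` in the tensor algebra -/

theorem permAct_tensorBasis {N : ℕ} (τ : Equiv.Perm (Fin N)) (f : Fin N → SpIdx g) :
    permAct g τ (tensorBasis g N f) = tensorBasis g N (f ∘ τ.symm) := by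
  rw [tensorBasis_apply, tensorBasis_apply, permAct]
  exact PiTensorProduct.reindex_tprod ..

theorem ofFn_comp_finRotate_pow {α : Type*} {N : ℕ} (h : Fin N → α) (k : ℕ) :
    List.ofFn (h ∘ (finRotate N ^ k : Equiv.Perm (Fin N))) = (List.ofFn h).rotate k := by
  induction k generalizing h with
  | zero => simp
  | succ k ih =>
    have h1 : List.ofFn (h ∘ finRotate N) = (List.ofFn h).rotate 1 := by
      apply List.ext_getElem
      · simp
      · intro i h1 h2
        have hi : i < N := by simpa using h1
        obtain ⟨M, rfl⟩ : ∃ M, N = M + 1 := ⟨N - 1, by omega⟩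
        simp only [List.getElem_ofFn, Function.comp_apply, List.getElem_rotate, List.length_ofFn]
        congr 1
        apply Fin.ext
        rw [finRotate_apply, Fin.val_add]
        simp
    have h2 : h ∘ (finRotate N ^ (k + 1) : Equiv.Perm (Fin N)) =
        (h ∘ finRotate N) ∘ (finRotate N ^ k : Equiv.Perm (Fin N)) := by
      rw [pow_succ']; rfl
    rw [h2, ih, h1, List.rotate_rotate, add_comm]

theorem toTensorAlgebra_cycSum {N : ℕ} (t : ⨂[ℚ]^N (HQ g)) :
    TensorPower.toTensorAlgebra (cycSum g N t) = cyc g (TensorPower.toTensorAlgebra t) := by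
  suffices h : TensorPower.toTensorAlgebra ∘ₗ cycSum g N =
      cyc g ∘ₗ TensorPower.toTensorAlgebra from LinearMap.congr_fun h t
  refine (tensorBasis g N).ext fun f => ?_
  rw [LinearMap.comp_apply, LinearMap.comp_apply, toTensorAlgebra_tensorBasis, cyc_word, cycSum,
    LinearMap.sum_apply, map_sum, List.length_ofFn,
    ← Finset.sum_range_reflect (fun j => word g ((List.ofFn f).rotate j))]
  refine Finset.sum_congr rfl fun j hj => ?_
  rw [permAct_tensorBasis, toTensorAlgebra_tensorBasis]
  congr 1
  have hj' := Finset.mem_range.mp hj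
  have h1 := ofFn_comp_finRotate_pow (f ∘ (finRotate N ^ (j + 1)).symm) (j + 1)
  have h2 : (f ∘ (finRotate N ^ (j + 1)).symm) ∘ (finRotate N ^ (j + 1) : Equiv.Perm (Fin N)) =
      f := by
    funext i; simp
  rw [h2] at h1
  rw [h1, List.rotate_rotate]
  have h3 : j + 1 + (N - 1 - j) = (List.ofFn (f ∘ (finRotate N ^ (j + 1)).symm)).length := by
    rw [List.length_ofFn]; omega
  rw [h3, List.rotate_length]

theorem map_val_shiftedCycle_support {N i : ℕ} (hi : i < N) :
    ((List.finRange N).filter fun a => 1 ≤ a.1 ∧ a.1 ≤ i).map Fin.val = List.range' 1 i := by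
  have h1 : ((List.finRange N).filter fun a => 1 ≤ a.1 ∧ a.1 ≤ i).map Fin.val =
      ((List.finRange N).map Fin.val).filter fun a => 1 ≤ a ∧ a ≤ i := by
    rw [List.filter_map]; rfl
  rw [h1, List.map_coe_finRange_eq_range]
  obtain ⟨r, rfl⟩ : ∃ r, N = 1 + (i + r) := ⟨N - i - 1, by omega⟩
  rw [List.range_eq_range', ← List.range'_append_1, ← List.range'_append_1, List.filter_append,
    List.filter_append]
  have ha : (List.range' 0 1).filter (fun a => decide (1 ≤ a ∧ a ≤ i)) = [] := by
    rw [List.filter_eq_nil_iff]; intro a ha; simp at ha; simp [ha]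
  have hb : (List.range' (0 + 1) i).filter (fun a => decide (1 ≤ a ∧ a ≤ i)) =
      List.range' 1 i := by
    rw [List.filter_eq_self]; intro a ha
    rw [List.mem_range'_1] at ha; simp; omega
  have hc : (List.range' (0 + 1 + i) r).filter (fun a => decide (1 ≤ a ∧ a ≤ i)) = [] := by
    rw [List.filter_eq_nil_iff]; intro a ha
    rw [List.mem_range'_1] at ha; simp; omega
  rw [ha, hb, hc]; simp

theorem shiftedCycle_val {N i : ℕ} (hi : i < N) (a : Fin N) : (shiftedCycle N i a).1 =
    if a.1 = 0 ∨ i < a.1 then a.1 else if a.1 = i then 1 else a.1 + 1 := by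
  set s := (List.finRange N).filter fun a => 1 ≤ a.1 ∧ a.1 ≤ i with hs
  have hmap : s.map Fin.val = List.range' 1 i := map_val_shiftedCycle_support hi
  have hlen : s.length = i := by simpa using congrArg List.length hmap
  have hget : ∀ (j : ℕ) (hj : j < s.length), (s[j]).1 = j + 1 := by
    intro j hj
    have : (s.map Fin.val)[j]'(by simpa using hj) = j + 1 := by
      simp only [hmap, List.getElem_range']; omega
    simpa using this
  have hnd : s.Nodup := (List.nodup_finRange N).filter _
  change (s.formPerm a).1 = _
  by_cases h0 : a.1 = 0 ∨ i < a.1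
  · rw [if_pos h0, List.formPerm_apply_of_notMem]
    rw [hs, List.mem_filter]; simp; omega
  · rw [if_neg h0]
    push Not at h0
    have hj : a.1 - 1 < s.length := by omega
    have ha : a = s[a.1 - 1] := Fin.ext (by rw [hget]; omega)
    conv_lhs => rw [ha]
    rw [List.formPerm_apply_getElem s hnd, hget, hlen]
    split_ifs with h
    · rw [h, Nat.sub_add_cancel (by omega), Nat.mod_self]
    · rw [Nat.mod_eq_of_lt (by omega)]; omega

/-- The cyclic permutation `σ_i` on the places of a list other than the first. -/
def cycleTail {α : Type*} (i : ℕ) : List α → List α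
  | [] => []
  | a :: l => a :: ((l.take i).rotate (i - 1) ++ l.drop i)

theorem ofFn_comp_shiftedCycle {α : Type*} {N i : ℕ} (hi : i < N) (h1 : 1 ≤ i) (h : Fin N → α) :
    cycleTail i (List.ofFn (h ∘ shiftedCycle N i)) = List.ofFn h := by
  obtain ⟨M, rfl⟩ : ∃ M, N = M + 1 := ⟨N - 1, by omega⟩
  rw [List.ofFn_succ, cycleTail]
  apply List.ext_getElem
  · simp; omega
  · intro j hj1 hj2
    have hj : j < M + 1 := by simpa using hj2
    have hv : ∀ (b c : Fin (M + 1)), (shiftedCycle (M + 1) i b).1 = c.1 →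
        h (shiftedCycle (M + 1) i b) = h c := fun b c hbc => by rw [Fin.ext hbc]
    rw [List.getElem_ofFn]
    rcases j with - | j
    · rw [List.getElem_cons_zero]
      exact hv _ _ (by rw [shiftedCycle_val hi]; simp)
    · rw [List.getElem_cons_succ, List.getElem_append]
      split_ifs with hlt
      · have hlt' : j < i := by
          simp at hlt; omega
        rw [List.getElem_rotate, List.getElem_take, List.getElem_ofFn]
        refine hv _ _ ?_
        rw [shiftedCycle_val hi]
        simp only [List.length_take, List.length_ofFn, Fin.val_succ,
          Nat.min_eq_left (show i ≤ M by omega)]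
        rcases Nat.eq_zero_or_pos j with rfl | hj0
        · rw [Nat.zero_add, Nat.mod_eq_of_lt (by omega)]
          rw [if_neg (by omega), if_pos (by omega)]
        · have : (j + (i - 1)) % i = j - 1 := by
            rw [show j + (i - 1) = j - 1 + i by omega, Nat.add_mod_right,
              Nat.mod_eq_of_lt (by omega)]
          rw [this]
          rw [if_neg (by omega), if_neg (by omega)]; omega
      · simp only [List.length_rotate, List.length_take, List.length_ofFn,
          Nat.min_eq_left (show i ≤ M by omega)] at hlt
        rw [List.getElem_drop, List.getElem_ofFn]
        refine hv _ _ ?_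
        rw [shiftedCycle_val hi]
        simp only [List.length_rotate, List.length_take, List.length_ofFn, Fin.val_succ,
          Nat.min_eq_left (show i ≤ M by omega)]
        split_ifs <;> omega

/-- The linear map of the tensor algebra given by `cycleTail` on words. -/
def cycleTailLin (g i : ℕ) : TA g →ₗ[ℚ] TA g :=
  (wordBasis g).constr ℚ fun l => word g (cycleTail i l)

theorem cycleTailLin_word (i : ℕ) (l : List (SpIdx g)) :
    cycleTailLin g i (word g l) = word g (cycleTail i l) := by
  rw [← wordBasis_apply, cycleTailLin, Module.Basis.constr_basis]

theorem toTensorAlgebra_permAct_shiftedCycle {N i : ℕ} (hi : i < N) (h1 : 1 ≤ i)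
    (t : ⨂[ℚ]^N (HQ g)) : TensorPower.toTensorAlgebra (permAct g (shiftedCycle N i) t) =
      cycleTailLin g i (TensorPower.toTensorAlgebra t) := by
  suffices h : TensorPower.toTensorAlgebra ∘ₗ permAct g (shiftedCycle N i) =
      cycleTailLin g i ∘ₗ TensorPower.toTensorAlgebra from LinearMap.congr_fun h t
  refine (tensorBasis g N).ext fun f => ?_
  rw [LinearMap.comp_apply, LinearMap.comp_apply, permAct_tensorBasis,
    toTensorAlgebra_tensorBasis, toTensorAlgebra_tensorBasis, cycleTailLin_word]
  congr 1
  have h2 : (f ∘ (shiftedCycle N i).symm) ∘ shiftedCycle N i = f := by funext j; simp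
  rw [← ofFn_comp_shiftedCycle hi h1 (f ∘ (shiftedCycle N i).symm), h2]

theorem cycleTailLin_mul {m : ℕ} {u : TA g} (hu : u ∈ wordDegree g m) (a b : SpIdx g)
    (w : List (SpIdx g)) :
    cycleTailLin g (m + 1) (letter g a * (u * (letter g b * word g w))) =
      letter g a * (letter g b * (u * word g w)) := by
  induction hu using Submodule.span_induction with
  | mem u hu =>
    obtain ⟨l, rfl, rfl⟩ := hu
    have h : letter g a * (word g l * (letter g b * word g w)) =
        word g (a :: ((l ++ [b]) ++ w)) := by simp
    rw [h, cycleTailLin_word, cycleTail]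
    have h1 : l.length + 1 = (l ++ [b]).length := by simp
    rw [h1, List.take_left, List.drop_left]
    simp [List.rotate_append_length_eq]
  | zero => simp
  | add s t _ _ h1 h2 => simp only [mul_add, add_mul, map_add, h1, h2]
  | smul c t _ h => simp only [mul_smul_comm, smul_mul_assoc, map_smul, h]

theorem toTensorAlgebra_onePAct_tensorBasis {N m : ℕ} (f : Fin N → SpIdx g) (a : SpIdx g)
    (l w : List (SpIdx g)) (hl : l.length = m + 1) (hf : List.ofFn f = a :: (l ++ w)) :
    TensorPower.toTensorAlgebra (onePAct g N m (tensorBasis g N f)) =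
      letter g a * (lieToTensorLin g (dynkin g (word g l)) * word g w) := by
  induction m generalizing l w with
  | zero =>
    obtain ⟨b, rfl⟩ := List.length_eq_one_iff.mp hl
    rw [onePAct, Module.End.one_apply, toTensorAlgebra_tensorBasis, hf, word_cons, word_append]
    simp [dynkin_letter]
  | succ m ih =>
    obtain ⟨l, b, rfl⟩ : ∃ l' b, l = l' ++ [b] :=
      ⟨l.dropLast, l.getLast (by intro h; simp [h] at hl), (List.dropLast_append_getLast _).symm⟩
    have hl' : l.length = m + 1 := by simpa using hl
    have hne : l ≠ [] := by intro h; simp [h] at hl'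
    have hN : N = m + 3 + w.length := by
      have := congrArg List.length hf
      simp at this; omega
    rw [onePAct, Module.End.mul_apply, LinearMap.sub_apply, Module.End.one_apply, map_sub,
      toTensorAlgebra_permAct_shiftedCycle (by omega) (by omega),
      ih l (b :: w) hl' (by rw [hf]; simp), word_cons,
      cycleTailLin_mul (hl' ▸ lieToTensorLin_mem_wordDegree (dynkin_word_mem hne)),
      lieToTensorLin_dynkin_word_append hne]
    simp only [sub_mul, mul_sub, mul_assoc]

/-- The operator `1 ⊗ p` on `H_ℚ ⊗ H_ℚ^{⊗(N-1)}`, through the Dynkin operator. -/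
theorem toTensorAlgebra_onePAct {m : ℕ} (f : Fin (m + 2) → SpIdx g) :
    TensorPower.toTensorAlgebra (onePAct g (m + 2) m (tensorBasis g (m + 2) f)) =
      letter g (f 0) * lieToTensorLin g (dynkin g (word g (List.ofFn (Fin.tail f)))) := by
  rw [toTensorAlgebra_onePAct_tensorBasis f (f 0) (List.ofFn (Fin.tail f)) [] (by simp)
    (by rw [List.append_nil, List.ofFn_succ]; rfl), word_nil, mul_one]

theorem toTensorAlgebra_onePAct_mem {m : ℕ} (t : ⨂[ℚ]^(m + 2) (HQ g)) :
    TensorPower.toTensorAlgebra (onePAct g (m + 2) m t) ∈ tensorLie g (m + 1) := by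
  have ht : t ∈ Submodule.span ℚ (Set.range (tensorBasis g (m + 2))) :=
    (tensorBasis g (m + 2)).mem_span t
  induction ht using Submodule.span_induction with
  | mem t ht =>
    obtain ⟨f, rfl⟩ := ht
    rw [toTensorAlgebra_onePAct]
    refine letter_mul_mem_tensorLie _ ?_
    have := dynkin_word_mem (l := List.ofFn (Fin.tail f)) (by simp)
    rwa [List.length_ofFn] at this
  | zero => simp
  | add s t _ _ h1 h2 => rw [map_add, map_add]; exact add_mem h1 h2
  | smul c t _ h => rw [map_smul, map_smul]; exact Submodule.smul_mem _ _ h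

/-- On `H_ℚ ⊗ L_{g,1}(m + 1)` the operator `1 ⊗ p` is multiplication by `m + 1`. -/
theorem onePAct_eq_smul {m : ℕ} {t : ⨂[ℚ]^(m + 2) (HQ g)}
    (ht : TensorPower.toTensorAlgebra t ∈ tensorLie g (m + 1)) :
    onePAct g (m + 2) m t = ((m + 1 : ℕ) : ℚ) • t := by
  let strip : TA g →ₗ[ℚ] TA g := (wordBasis g).constr ℚ fun l =>
    match l with
    | [] => 0
    | a :: l => letter g a * lieToTensorLin g (dynkin g (word g l))
  have hstrip : ∀ a (w : TA g), strip (letter g a * w) =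
      letter g a * lieToTensorLin g (dynkin g w) := by
    intro a w
    induction w using tensor_induction with
    | word l => rw [← word_cons, ← wordBasis_apply, Module.Basis.constr_basis]
    | zero => simp
    | add s t hs ht => simp only [mul_add, map_add, hs, ht]
    | smul c t ht => simp only [mul_smul_comm, map_smul, ht]
  have h1 : ∀ s : ⨂[ℚ]^(m + 2) (HQ g), TensorPower.toTensorAlgebra (onePAct g (m + 2) m s) =
      strip (TensorPower.toTensorAlgebra s) := by
    intro s
    suffices h : TensorPower.toTensorAlgebra ∘ₗ onePAct g (m + 2) m =
        strip ∘ₗ TensorPower.toTensorAlgebra from LinearMap.congr_fun h s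
    refine (tensorBasis g (m + 2)).ext fun f => ?_
    rw [LinearMap.comp_apply, LinearMap.comp_apply, toTensorAlgebra_onePAct,
      toTensorAlgebra_tensorBasis, List.ofFn_succ (f := f), word_cons, hstrip]
    rfl
  apply toTensorAlgebra_injective
  rw [h1, map_smul]
  obtain ⟨u, hu, hsum⟩ := mem_tensorLie_iff.mp ht
  rw [← hsum, map_sum, Finset.smul_sum]
  refine Finset.sum_congr rfl fun a _ => ?_
  rw [hstrip, dynkin_lieToTensorLin (hu a), map_smul, mul_smul_comm]

theorem toTensorAlgebra_mem_wordDegree {N : ℕ} (t : ⨂[ℚ]^N (HQ g)) :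
    TensorPower.toTensorAlgebra t ∈ wordDegree g N := by
  rw [← range_toTensorAlgebra]; exact ⟨t, rfl⟩

/-- The image of `S_N ∘ (1 ⊗ p)` consists of tensors of symplectic derivations. -/
theorem exists_sympDer_of_symmetrize {m : ℕ} (t : ⨂[ℚ]^(m + 2) (HQ g)) :
    ∃ D ∈ (sympDer g m).toSubmodule, derToTensor g D =
      TensorPower.toTensorAlgebra ((cycSum g (m + 2) * onePAct g (m + 2) m) t) := by
  refine exists_sympDer ?_ ?_
  · rw [Module.End.mul_apply, toTensorAlgebra_cycSum]
    exact cyc_mem_tensorLie (toTensorAlgebra_onePAct_mem t)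
  · rw [Module.End.mul_apply, toTensorAlgebra_cycSum, rot_cyc]

/-- The operator `S_N ∘ (1 ⊗ p)` is a multiple of a projection onto the tensors of symplectic
derivations. -/
theorem symmetrize_eq_smul {m : ℕ} {D : Der g} (hD : D ∈ (sympDer g m).toSubmodule)
    {t : ⨂[ℚ]^(m + 2) (HQ g)} (ht : TensorPower.toTensorAlgebra t = derToTensor g D) :
    (cycSum g (m + 2) * onePAct g (m + 2) m) t = ((m + 1 : ℕ) * (m + 2 : ℕ) : ℚ) • t := by
  rw [Module.End.mul_apply, onePAct_eq_smul (ht ▸ derToTensor_mem_tensorLie hD), map_smul,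
    mul_smul]
  congr 1
  apply toTensorAlgebra_injective
  rw [toTensorAlgebra_cycSum, map_smul]
  exact cyc_eq_smul (toTensorAlgebra_mem_wordDegree t) (by rw [ht, rot_derToTensor hD])

theorem exists_tensor_of_sympDer {m : ℕ} {D : Der g} (hD : D ∈ (sympDer g m).toSubmodule) :
    ∃ t : ⨂[ℚ]^(m + 2) (HQ g), TensorPower.toTensorAlgebra t = derToTensor g D := by
  have := tensorLie_le_wordDegree g (m + 1) (derToTensor_mem_tensorLie hD)
  rwa [← range_toTensorAlgebra] at this

/-! ### Permuting the vertices of a chord diagram -/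

namespace ChordDiagram

variable {n : ℕ}

instance : DecidableEq (ChordDiagram n) := by unfold ChordDiagram; infer_instance

@[ext] theorem ext {C C' : ChordDiagram n} (h : ∀ i, C.1 i = C'.1 i) : C = C' :=
  Subtype.ext (Equiv.ext h)

@[simp] theorem apply_apply (C : ChordDiagram n) (i : Fin (2 * n)) : C.1 (C.1 i) = i := (C.2 i).1

theorem apply_ne (C : ChordDiagram n) (i : Fin (2 * n)) : C.1 i ≠ i := (C.2 i).2

theorem apply_eq_iff (C : ChordDiagram n) {i j : Fin (2 * n)} : C.1 i = j ↔ i = C.1 j :=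
  ⟨fun h => by rw [← h, apply_apply], fun h => by rw [h, apply_apply]⟩

/-- The chord diagram obtained from `C` by applying `τ` to the vertices. -/
def perm (τ : Equiv.Perm (Fin (2 * n))) (C : ChordDiagram n) : ChordDiagram n :=
  ⟨τ * C.1 * τ⁻¹, fun i => ⟨by simp, fun h => by
    have h' : τ (C.1 (τ⁻¹ i)) = i := h
    exact C.apply_ne (τ⁻¹ i) (Equiv.Perm.eq_inv_iff_eq.mpr h')⟩⟩

@[simp] theorem perm_apply (τ : Equiv.Perm (Fin (2 * n))) (C : ChordDiagram n)
    (i : Fin (2 * n)) : (perm τ C).1 i = τ (C.1 (τ.symm i)) := rfl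

theorem perm_one (C : ChordDiagram n) : perm 1 C = C := ext fun _ => rfl

theorem perm_mul (σ τ : Equiv.Perm (Fin (2 * n))) (C : ChordDiagram n) :
    perm (σ * τ) C = perm σ (perm τ C) := by
  apply ext
  intro i
  rfl

/-- The action of a permutation of the vertices as a permutation of the chord diagrams. -/
def permEquiv (τ : Equiv.Perm (Fin (2 * n))) : ChordDiagram n ≃ ChordDiagram n where
  toFun := perm τ
  invFun := perm τ⁻¹
  left_inv C := by rw [← perm_mul, inv_mul_cancel, perm_one]
  right_inv C := by rw [← perm_mul, mul_inv_cancel, perm_one]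

@[simp] theorem permEquiv_apply (τ : Equiv.Perm (Fin (2 * n))) (C : ChordDiagram n) :
    permEquiv τ C = perm τ C := rfl

end ChordDiagram

theorem swap_succ_lt_swap_succ {N : ℕ} {i j : Fin N} (hij : j.1 = i.1 + 1) (a b : Fin N) :
    Equiv.swap i j a < Equiv.swap i j b ↔ (a < b ∧ ¬ (a = i ∧ b = j)) ∨ (a = j ∧ b = i) := by
  simp only [Equiv.swap_apply_def, Fin.lt_def, Fin.ext_iff]
  split_ifs <;> omega

theorem perm_induction_adjacent {N : ℕ} {p : Equiv.Perm (Fin N) → Prop} (one : p 1)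
    (mul : ∀ i j τ, j.1 = i.1 + 1 → p τ → p (Equiv.swap i j * τ)) (τ : Equiv.Perm (Fin N)) :
    p τ := by
  rcases N with - | N
  · rwa [Subsingleton.elim τ 1]
  · have hτ : τ ∈ Submonoid.closure
        (Set.range fun i : Fin N => Equiv.swap i.castSucc i.succ) := by
      rw [Equiv.Perm.mclosure_swap_castSucc_succ]; trivial
    induction hτ using Submonoid.closure_induction_left with
    | one => exact one
    | mul_left x hx y _ hy =>
      obtain ⟨i, rfl⟩ := hx
      exact mul _ _ y (by simp) hy

namespace ChordDiagram

variable {n : ℕ}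

/-- Exchanging the adjacent vertices `i` and `j`, when they are on two different chords, changes
for exactly one pair of vertices whether they are the left ends of crossing chords. -/
theorem exists_unique_crossing_change (C : ChordDiagram n) {i j : Fin (2 * n)}
    (hij : j.1 = i.1 + 1) (h : C.1 i ≠ j) : ∃ p q : Fin (2 * n), ∀ x y : Fin (2 * n),
      ((x < y ∧ y < C.1 x ∧ C.1 x < C.1 y) ↔
        (Equiv.swap i j x < Equiv.swap i j y ∧ Equiv.swap i j y < Equiv.swap i j (C.1 x) ∧
          Equiv.swap i j (C.1 x) < Equiv.swap i j (C.1 y))) ↔ ¬ (x = p ∧ y = q) := by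
  have hi := C.apply_ne i
  have hj := C.apply_ne j
  have hcj : C.1 j ≠ i := fun h' => h (by rw [← h', apply_apply])
  have hcc : C.1 i ≠ C.1 j := fun h' => by
    have := C.1.injective h'
    rw [this] at hij; omega
  -- the pair depends on the relative position of the two chords
  have hcases : (j < C.1 i ∧ C.1 i < C.1 j) ∨ (j < C.1 j ∧ C.1 j < C.1 i) ∨
      (C.1 j < i ∧ j < C.1 i) ∨ (C.1 i < i ∧ j < C.1 j) ∨
      (C.1 i < C.1 j ∧ C.1 j < i) ∨ (C.1 j < C.1 i ∧ C.1 i < i) := by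
    simp only [Fin.lt_def, ne_eq, Fin.ext_iff] at *
    omega
  have e1 : ∀ z, C.1 z = i ↔ z = C.1 i := fun z => C.apply_eq_iff
  have e2 : ∀ z, C.1 z = j ↔ z = C.1 j := fun z => C.apply_eq_iff
  have key : ∀ p q : Fin (2 * n), ((p = i ∧ q = j) ∧ (j < C.1 i ∧ C.1 i < C.1 j) ∨
      (p = j ∧ q = i) ∧ (j < C.1 j ∧ C.1 j < C.1 i) ∨
      (p = C.1 j ∧ q = i) ∧ (C.1 j < i ∧ j < C.1 i) ∨
      (p = C.1 i ∧ q = j) ∧ (C.1 i < i ∧ j < C.1 j) ∨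
      (p = C.1 i ∧ q = C.1 j) ∧ (C.1 i < C.1 j ∧ C.1 j < i) ∨
      (p = C.1 j ∧ q = C.1 i) ∧ (C.1 j < C.1 i ∧ C.1 i < i)) → ∀ x y : Fin (2 * n),
      ((x < y ∧ y < C.1 x ∧ C.1 x < C.1 y) ↔
        (Equiv.swap i j x < Equiv.swap i j y ∧ Equiv.swap i j y < Equiv.swap i j (C.1 x) ∧
          Equiv.swap i j (C.1 x) < Equiv.swap i j (C.1 y))) ↔ ¬ (x = p ∧ y = q) := by
    intro p q hpq x y
    rw [swap_succ_lt_swap_succ hij, swap_succ_lt_swap_succ hij, swap_succ_lt_swap_succ hij,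
      e1, e1, e2, e2]
    have hx := C.apply_ne x
    have hy := C.apply_ne y
    have hci := C.apply_apply i
    have hcj' := C.apply_apply j
    rcases hpq with ⟨⟨hp, hq⟩, h1, h2⟩ | ⟨⟨hp, hq⟩, h1, h2⟩ | ⟨⟨hp, hq⟩, h1, h2⟩ |
      ⟨⟨hp, hq⟩, h1, h2⟩ | ⟨⟨hp, hq⟩, h1, h2⟩ | ⟨⟨hp, hq⟩, h1, h2⟩
    all_goals
      rw [hp, hq]
      clear hp hq
      by_cases x1 : x = i
      · grind
      by_cases x2 : x = j
      · grind
      by_cases y1 : y = i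
      · grind
      by_cases y2 : y = j
      · grind
      grind
  rcases hcases with h1 | h1 | h1 | h1 | h1 | h1
  · exact ⟨_, _, key _ _ (Or.inl ⟨⟨rfl, rfl⟩, h1⟩)⟩
  · exact ⟨_, _, key _ _ (Or.inr (Or.inl ⟨⟨rfl, rfl⟩, h1⟩))⟩
  · exact ⟨_, _, key _ _ (Or.inr (Or.inr (Or.inl ⟨⟨rfl, rfl⟩, h1⟩)))⟩
  · exact ⟨_, _, key _ _ (Or.inr (Or.inr (Or.inr (Or.inl ⟨⟨rfl, rfl⟩, h1⟩))))⟩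
  · exact ⟨_, _, key _ _ (Or.inr (Or.inr (Or.inr (Or.inr (Or.inl ⟨⟨rfl, rfl⟩, h1⟩)))))⟩
  · exact ⟨_, _, key _ _ (Or.inr (Or.inr (Or.inr (Or.inr (Or.inr ⟨⟨rfl, rfl⟩, h1⟩)))))⟩

theorem sgn_eq_prod (C : ChordDiagram n) : C.sgn = ∏ p : Fin (2 * n) × Fin (2 * n),
    if p.1 < p.2 ∧ p.2 < C.1 p.1 ∧ C.1 p.1 < C.1 p.2 then (-1 : ℚ) else 1 := by
  rw [sgn, crossings, Finset.prod_ite, Finset.prod_const_one, mul_one, Finset.prod_const]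

theorem sgn_mul_self (C : ChordDiagram n) : C.sgn * C.sgn = 1 := by
  rw [sgn, ← mul_pow]; simp

theorem perm_swap_of_chord (C : ChordDiagram n) {i j : Fin (2 * n)} (h : C.1 i = j) :
    perm (Equiv.swap i j) C = C := by
  have h' : C.1 j = i := by rw [← h, apply_apply]
  apply ext
  intro x
  rw [perm_apply, Equiv.symm_swap]
  by_cases hx : x = i
  · subst hx; rw [Equiv.swap_apply_left, h', Equiv.swap_apply_left, h]
  by_cases hx' : x = j
  · subst hx'; rw [Equiv.swap_apply_right, h, Equiv.swap_apply_right, h']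
  rw [Equiv.swap_apply_of_ne_of_ne hx hx', Equiv.swap_apply_of_ne_of_ne]
  · intro h2; exact hx' (by rw [C.apply_eq_iff.mp h2, h])
  · intro h2; exact hx (by rw [C.apply_eq_iff.mp h2, h'])

theorem sgn_perm_swap (C : ChordDiagram n) {i j : Fin (2 * n)} (hij : j.1 = i.1 + 1)
    (h : C.1 i ≠ j) : (perm (Equiv.swap i j) C).sgn = -C.sgn := by
  obtain ⟨p, q, hpq⟩ := C.exists_unique_crossing_change hij h
  set s := Equiv.swap i j with hs
  have h1 : (perm s C).sgn = ∏ x : Fin (2 * n) × Fin (2 * n),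
      if s x.1 < s x.2 ∧ s x.2 < s (C.1 x.1) ∧ s (C.1 x.1) < s (C.1 x.2) then (-1 : ℚ) else 1 := by
    rw [sgn_eq_prod]
    symm
    refine Fintype.prod_equiv (s.prodCongr s) _ _ fun x => ?_
    simp
  have h2 : (perm s C).sgn * C.sgn = -1 := by
    rw [h1, sgn_eq_prod, ← Finset.prod_mul_distrib, Finset.prod_eq_single (p, q)]
    · have := hpq p q
      simp only [and_self, not_true_eq_false, iff_false] at this
      by_cases ha : p < q ∧ q < C.1 p ∧ C.1 p < C.1 q
      · rw [if_pos ha, if_neg fun hb => this (iff_of_true ha hb)]; norm_num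
      · rw [if_neg ha, if_pos (by by_contra hb; exact this (iff_of_false ha hb))]; norm_num
    · rintro ⟨x, y⟩ _ hxy
      have := (hpq x y).mpr (by rintro ⟨rfl, rfl⟩; exact hxy rfl)
      by_cases ha : x < y ∧ y < C.1 x ∧ C.1 x < C.1 y
      · rw [if_pos ha, if_pos (this.mp ha)]; norm_num
      · rw [if_neg ha, if_neg fun hb => ha (this.mpr hb)]; norm_num
    · simp
  have h3 := congrArg (· * C.sgn) h2
  simp only [mul_assoc, sgn_mul_self] at h3
  linarith

end ChordDiagram

theorem omegaCoeff_antisymm (a b : SpIdx g) : omegaCoeff g a b = -omegaCoeff g b a := by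
  rcases a with i | i <;> rcases b with j | j <;> simp [omegaCoeff, eq_comm]
  all_goals split_ifs <;> simp

/-- The coordinate of `a_C` at a pure tensor of symplectic basis vectors. -/
def chordCoeff (g : ℕ) {n : ℕ} (C : ChordDiagram n) (f : Fin (2 * n) → SpIdx g) : ℚ :=
  C.sgn * ∏ i ∈ Finset.univ.filter (fun i => i < C.1 i), omegaCoeff g (f i) (f (C.1 i))

theorem chordTensor_eq {n : ℕ} (C : ChordDiagram n) :
    chordTensor g C = ∑ f, chordCoeff g C f • tensorBasis g (2 * n) f := by
  rw [chordTensor, Finset.smul_sum]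
  refine Finset.sum_congr rfl fun f _ => ?_
  rw [smul_smul, tensorBasis_apply, chordCoeff]

theorem chordCoeff_comp_swap {n : ℕ} (C : ChordDiagram n) {i j : Fin (2 * n)}
    (hij : j.1 = i.1 + 1) (f : Fin (2 * n) → SpIdx g) :
    chordCoeff g C (f ∘ Equiv.swap i j) =
      -chordCoeff g (ChordDiagram.perm (Equiv.swap i j) C) f := by
  have hprod : ∀ F : Fin (2 * n) → Fin (2 * n) → ℚ,
      ∏ x ∈ Finset.univ.filter (fun x => x < (ChordDiagram.perm (Equiv.swap i j) C).1 x),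
        F x ((ChordDiagram.perm (Equiv.swap i j) C).1 x) =
      ∏ x ∈ Finset.univ.filter (fun x => Equiv.swap i j x < Equiv.swap i j (C.1 x)),
        F (Equiv.swap i j x) (Equiv.swap i j (C.1 x)) := by
    intro F
    rw [Finset.prod_filter, Finset.prod_filter]
    symm
    refine Fintype.prod_equiv (Equiv.swap i j) _ _ fun x => ?_
    simp
  have hne : i ≠ j := fun h => by rw [h] at hij; omega
  by_cases h : C.1 i = j
  · have h' : C.1 j = i := by rw [← h, ChordDiagram.apply_apply]
    rw [ChordDiagram.perm_swap_of_chord C h, chordCoeff, chordCoeff, ← mul_neg]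
    congr 1
    have hmem : i ∈ Finset.univ.filter (fun x => x < C.1 x) := by
      rw [Finset.mem_filter, h, Fin.lt_def]
      exact ⟨Finset.mem_univ _, by omega⟩
    rw [← Finset.mul_prod_erase _ _ hmem, ← Finset.mul_prod_erase _ _ hmem, ← neg_mul]
    congr 1
    · simp only [Function.comp_apply, h, Equiv.swap_apply_left, Equiv.swap_apply_right]
      exact omegaCoeff_antisymm _ _
    · refine Finset.prod_congr rfl fun x hx => ?_
      rw [Finset.mem_erase, Finset.mem_filter] at hx
      have hxj : x ≠ j := by
        rintro rfl
        have := hx.2.2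
        rw [h', Fin.lt_def] at this; omega
      simp only [Function.comp_apply]
      rw [Equiv.swap_apply_of_ne_of_ne hx.1 hxj, Equiv.swap_apply_of_ne_of_ne]
      · intro h2; exact hxj (by rw [C.apply_eq_iff.mp h2, h])
      · intro h2; exact hx.1 (by rw [C.apply_eq_iff.mp h2, h'])
  · rw [chordCoeff, chordCoeff, ChordDiagram.sgn_perm_swap C hij h, neg_mul, neg_neg,
      hprod fun x y => omegaCoeff g (f x) (f y)]
    congr 1
    refine Finset.prod_congr ?_ fun x _ => rfl
    ext x
    rw [Finset.mem_filter, Finset.mem_filter, swap_succ_lt_swap_succ hij]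
    simp only [Finset.mem_univ, true_and]
    constructor
    · intro hx
      exact Or.inl ⟨hx, fun ⟨h1, h2⟩ => h (by rw [← h1, h2])⟩
    · rintro (hx | ⟨h1, h2⟩)
      · exact hx.1
      · exact absurd (by rw [← h2, ChordDiagram.apply_apply, h1]) h

/-- The symmetric group acts on the tensors `a_C` by permuting chord diagrams, up to sign. -/
theorem chordCoeff_comp_perm {n : ℕ} (τ : Equiv.Perm (Fin (2 * n))) (C : ChordDiagram n)
    (f : Fin (2 * n) → SpIdx g) : chordCoeff g C (f ∘ τ) =
      ((Equiv.Perm.sign τ : ℤ) : ℚ) * chordCoeff g (ChordDiagram.perm τ C) f := by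
  induction τ using perm_induction_adjacent generalizing f with
  | one => simp [ChordDiagram.perm_one]
  | mul i j τ hij ih =>
    have hne : i ≠ j := fun h => by rw [h] at hij; omega
    have h1 : f ∘ (Equiv.swap i j * τ : Equiv.Perm _) = (f ∘ Equiv.swap i j) ∘ τ := rfl
    rw [h1, ih, chordCoeff_comp_swap _ hij, ChordDiagram.perm_mul, Equiv.Perm.sign_mul,
      Equiv.Perm.sign_swap hne]
    simp

theorem permAct_chordTensor {n : ℕ} (τ : Equiv.Perm (Fin (2 * n))) (C : ChordDiagram n) :
    permAct g τ (chordTensor g C) =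
      ((Equiv.Perm.sign τ : ℤ) : ℚ) • chordTensor g (ChordDiagram.perm τ C) := by
  rw [chordTensor_eq, chordTensor_eq, map_sum, Finset.smul_sum]
  refine Fintype.sum_equiv (Equiv.arrowCongr τ (Equiv.refl _)) _ _ fun f => ?_
  rw [map_smul, permAct_tensorBasis, smul_smul, ← chordCoeff_comp_perm]
  congr 2
  funext i
  simp

/-! ### Colourings and connected components -/

/-- Functions on the vertices of a graph which are constant along edges are functions on the set
of connected components. -/
def edgeConstantEquiv {V α : Type*} (G : SimpleGraph V) :
    {f : V → α // ∀ u v, G.Adj u v → f u = f v} ≃ (G.ConnectedComponent → α) where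
  toFun f := fun c => c.lift f.1 fun u v p _ => by
    induction p with
    | nil => rfl
    | cons h _ ih => exact (f.2 _ _ h).trans (ih (by simp_all))
  invFun F := ⟨fun v => F (G.connectedComponentMk v), fun _ _ h =>
    congrArg F (SimpleGraph.ConnectedComponent.connectedComponentMk_eq_of_adj h)⟩
  left_inv f := by ext v; rfl
  right_inv F := by
    funext c
    induction c using SimpleGraph.ConnectedComponent.ind
    rfl

namespace ChordDiagram

variable {n : ℕ}

/-- A colouring of the vertices is compatible with a chord diagram if the two ends of each chord
have the same colour. -/
def Compat {α : Type*} (C : ChordDiagram n) (f : Fin (2 * n) → α) : Prop := ∀ i, f (C.1 i) = f i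

instance {α : Type*} [DecidableEq α] (C : ChordDiagram n) : DecidablePred (Compat (α := α) C) :=
  fun _ => inferInstanceAs (Decidable (∀ _, _))

/-- The set of left ends of the chords. -/
abbrev LeftEnds (C : ChordDiagram n) : Type := {i : Fin (2 * n) // i < C.1 i}

theorem not_lt_iff (C : ChordDiagram n) (i : Fin (2 * n)) : ¬ i < C.1 i ↔ C.1 i < i :=
  ⟨fun h => lt_of_le_of_ne (not_lt.mp h) (C.apply_ne i), fun h => not_lt.mpr h.le⟩

theorem card_leftEnds (C : ChordDiagram n) : Fintype.card C.LeftEnds = n := by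
  have h1 : Fintype.card {i : Fin (2 * n) // ¬ i < C.1 i} = Fintype.card C.LeftEnds :=
    Fintype.card_congr
      { toFun := fun i => ⟨C.1 i.1, by
          rw [apply_apply]; exact (C.not_lt_iff _).mp i.2⟩
        invFun := fun i => ⟨C.1 i.1, by rw [apply_apply]; exact not_lt.mpr i.2.le⟩
        left_inv := fun i => by simp
        right_inv := fun i => by simp }
  have h2 := Fintype.card_subtype_compl (fun i : Fin (2 * n) => i < C.1 i)
  have h3 := Fintype.card_subtype_le (fun i : Fin (2 * n) => i < C.1 i)
  rw [h1, Fintype.card_fin] at h2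
  rw [Fintype.card_fin] at h3
  change Fintype.card C.LeftEnds = _ - Fintype.card C.LeftEnds at h2
  change Fintype.card C.LeftEnds ≤ _ at h3
  omega

/-- A compatible colouring is a colouring of the chords. -/
def compatEquiv {α : Type*} (C : ChordDiagram n) :
    {f : Fin (2 * n) → α // C.Compat f} ≃ (C.LeftEnds → α) where
  toFun f i := f.1 i.1
  invFun F := ⟨fun i => if h : i < C.1 i then F ⟨i, h⟩ else
      F ⟨C.1 i, by rw [apply_apply]; exact (C.not_lt_iff i).mp h⟩, fun i => by
    by_cases h : i < C.1 i
    · have h' : ¬ C.1 i < C.1 (C.1 i) := by rw [apply_apply]; exact not_lt.mpr h.le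
      simp [h, h.not_gt]
    · have h' : C.1 i < C.1 (C.1 i) := by rw [apply_apply]; exact (C.not_lt_iff i).mp h
      simp only [dif_neg h, dif_pos h']⟩
  left_inv f := by
    apply Subtype.ext
    funext i
    dsimp only
    split_ifs with h
    · rfl
    · exact f.2 i
  right_inv F := by
    funext i
    exact dif_pos i.2

theorem card_compat_compat {α : Type*} [Fintype α] [DecidableEq α] (C C' : ChordDiagram n) :
    (Finset.univ.filter fun f : Fin (2 * n) → α => C.Compat f ∧ C'.Compat f).card =
      Fintype.card α ^ components C C' := by
  rw [← Fintype.card_subtype, ← Nat.card_eq_fintype_card, components, ← Nat.card_eq_fintype_card,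
    ← Nat.card_fun, ← Nat.card_congr (edgeConstantEquiv (C.graph ⊔ C'.graph))]
  refine Nat.card_congr (Equiv.subtypeEquivRight fun f => ⟨?_, ?_⟩)
  · rintro ⟨h1, h2⟩ u v (h | h)
    · change C.1 u = v at h; rw [← h, h1]
    · change C'.1 u = v at h; rw [← h, h2]
  · intro h
    exact ⟨fun i => (h i _ (Or.inl rfl)).symm, fun i => (h i _ (Or.inr rfl)).symm⟩

theorem card_compat {α : Type*} [Fintype α] [DecidableEq α] (C : ChordDiagram n) :
    (Finset.univ.filter fun f : Fin (2 * n) → α => C.Compat f).card = Fintype.card α ^ n := by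
  rw [← Fintype.card_subtype, Fintype.card_congr C.compatEquiv, Fintype.card_fun, card_leftEnds]

theorem components_self (C : ChordDiagram n) : components C C = n := by
  have h := card_compat_compat (α := Fin 2) C C
  simp only [and_self, card_compat, Fintype.card_fin] at h
  exact (Nat.pow_right_injective le_rfl h).symm

theorem components_le (C C' : ChordDiagram n) : components C C' ≤ n := by
  have h : (2 : ℕ) ^ components C C' ≤ 2 ^ n := by
    have h1 := card_compat_compat (α := Fin 2) C C'
    have h2 := card_compat (α := Fin 2) C
    rw [Fintype.card_fin] at h1 h2
    rw [← h1, ← h2]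
    exact Finset.card_le_card fun f => by simp +contextual
  exact (Nat.pow_le_pow_iff_right (by norm_num)).mp h

theorem components_perm (τ : Equiv.Perm (Fin (2 * n))) (C C' : ChordDiagram n) :
    components (perm τ C) (perm τ C') = components C C' := by
  symm
  refine Nat.card_congr (SimpleGraph.Iso.connectedComponentEquiv ⟨τ, ?_⟩)
  intro u v
  change τ (C.1 (τ.symm (τ u))) = τ v ∨ τ (C'.1 (τ.symm (τ u))) = τ v ↔ C.1 u = v ∨ C'.1 u = v
  simp

theorem pairing_perm (τ : Equiv.Perm (Fin (2 * n))) (C C' : ChordDiagram n) :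
    pairing (perm τ C) (perm τ C') = pairing C C' := by
  rw [pairing, pairing, components_perm]

/-! ### Rewiring two chords -/

/-- The cyclic permutation `p ↦ q ↦ r ↦ p`. -/
def threeCycle (p q r : Fin (2 * n)) : Equiv.Perm (Fin (2 * n)) := Equiv.swap p q * Equiv.swap q r

/-- For a chord diagram with chords `a p` and `q r`, the diagram obtained by replacing them by the
chords `a q` and `r p`. -/
def rewire (C : ChordDiagram n) (a q : Fin (2 * n)) : ChordDiagram n :=
  perm (threeCycle (C.1 a) q (C.1 q)) C

theorem sign_threeCycle {p q r : Fin (2 * n)} (h1 : p ≠ q) (h2 : q ≠ r) :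
    Equiv.Perm.sign (threeCycle p q r) = 1 := by
  rw [threeCycle, Equiv.Perm.sign_mul, Equiv.Perm.sign_swap h1, Equiv.Perm.sign_swap h2]; rfl

theorem rewire_apply (C : ChordDiagram n) {a q : Fin (2 * n)} (h1 : q ≠ a) (h2 : q ≠ C.1 a)
    (x : Fin (2 * n)) : (rewire C a q).1 x = if x = a then q else if x = q then a else
      if x = C.1 a then C.1 q else if x = C.1 q then C.1 a else C.1 x := by
  have e : (rewire C a q).1 x = Equiv.swap (C.1 a) q (Equiv.swap q (C.1 q)
      (C.1 (Equiv.swap q (C.1 q) (Equiv.swap (C.1 a) q x)))) := by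
    simp [rewire, threeCycle, perm_apply, Equiv.Perm.mul_apply, ← Equiv.Perm.inv_def]
  rw [e]
  have f1 := C.apply_ne a
  have f2 := C.apply_ne q
  have f3 := C.apply_apply a
  have f4 := C.apply_apply q
  have f5 : C.1 q ≠ a := fun h => h2 (by rw [← h, apply_apply])
  have f6 : C.1 a ≠ C.1 q := fun h => h1 (C.1.injective h).symm
  by_cases x1 : x = a
  · subst x1
    rw [if_pos rfl, Equiv.swap_apply_of_ne_of_ne f1.symm h1.symm,
      Equiv.swap_apply_of_ne_of_ne h1.symm f5.symm, Equiv.swap_apply_of_ne_of_ne h2.symm f6,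
      Equiv.swap_apply_left]
  by_cases x2 : x = q
  · subst x2
    rw [if_neg x1, if_pos rfl, Equiv.swap_apply_right, Equiv.swap_apply_of_ne_of_ne h2.symm f6, f3,
      Equiv.swap_apply_of_ne_of_ne h1.symm f5.symm, Equiv.swap_apply_of_ne_of_ne f1.symm h1.symm]
  by_cases x3 : x = C.1 a
  · subst x3
    rw [if_neg x1, if_neg x2, if_pos rfl, Equiv.swap_apply_left, Equiv.swap_apply_left, f4,
      Equiv.swap_apply_left, Equiv.swap_apply_of_ne_of_ne f6.symm f2]
  by_cases x4 : x = C.1 q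
  · subst x4
    rw [if_neg x1, if_neg x2, if_neg x3, if_pos rfl, Equiv.swap_apply_of_ne_of_ne f6.symm f2,
      Equiv.swap_apply_right, Equiv.swap_apply_right, Equiv.swap_apply_right]
  rw [if_neg x1, if_neg x2, if_neg x3, if_neg x4, Equiv.swap_apply_of_ne_of_ne x3 x2,
    Equiv.swap_apply_of_ne_of_ne x2 x4,
    Equiv.swap_apply_of_ne_of_ne (fun h => x4 (C.apply_eq_iff.mp h)) fun h => x2 (C.1.injective h),
    Equiv.swap_apply_of_ne_of_ne (fun h => x1 (C.1.injective h)) fun h => x4 (C.apply_eq_iff.mp h)]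

section rewire

variable (C : ChordDiagram n) {a q : Fin (2 * n)}

theorem rewire_left (h1 : q ≠ a) (h2 : q ≠ C.1 a) : (rewire C a q).1 a = q := by
  rw [rewire_apply C h1 h2, if_pos rfl]

theorem apply_ne_rewire_left (h2 : q ≠ C.1 a) : C.1 q ≠ a :=
  fun h => h2 (by rw [← h, apply_apply])

theorem rewire_apply_partner (h1 : q ≠ a) (h2 : q ≠ C.1 a) :
    (rewire C a q).1 (C.1 q) = C.1 a := by
  rw [rewire_apply C h1 h2, if_neg (C.apply_ne_rewire_left h2), if_neg (C.apply_ne q),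
    if_neg fun h => h1 (C.1.injective h), if_pos rfl]

/-- Rewiring twice: the chords `a p`, `q r` are replaced by `a r`, `p q`. -/
theorem rewire_rewire_apply (h1 : q ≠ a) (h2 : q ≠ C.1 a) (x : Fin (2 * n)) :
    (rewire (rewire C a q) a (C.1 q)).1 x = if x = a then C.1 q else if x = C.1 q then a else
      if x = q then C.1 a else if x = C.1 a then q else C.1 x := by
  have f5 := C.apply_ne_rewire_left h2
  rw [rewire_apply _ f5 (by rw [rewire_left C h1 h2]; exact C.apply_ne q), rewire_left C h1 h2,
    rewire_apply_partner C h1 h2, rewire_apply C h1 h2]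
  by_cases x1 : x = a
  · simp [x1]
  by_cases x2 : x = C.1 q
  · simp [x2, f5]
  by_cases x3 : x = q
  · simp [x3, h1]
  by_cases x4 : x = C.1 a
  · simp [x4, h2.symm, C.apply_ne]
  simp [x1, x2, x3, x4]

theorem rewire_rewire_rewire (h1 : q ≠ a) (h2 : q ≠ C.1 a) :
    rewire (rewire (rewire C a q) a (C.1 q)) a (C.1 a) = C := by
  have f5 := C.apply_ne_rewire_left h2
  apply ext
  intro x
  have e1 : (rewire (rewire C a q) a (C.1 q)).1 a = C.1 q := by
    rw [rewire_rewire_apply C h1 h2, if_pos rfl]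
  have e2 : (rewire (rewire C a q) a (C.1 q)).1 (C.1 a) = q := by
    rw [rewire_rewire_apply C h1 h2, if_neg (C.apply_ne a),
      if_neg fun h => h1 (C.1.injective h).symm,
      if_neg h2.symm, if_pos rfl]
  rw [rewire_apply _ (C.apply_ne a) (by rw [e1]; exact fun h => h1 (C.1.injective h).symm), e1, e2,
    rewire_rewire_apply C h1 h2]
  by_cases x1 : x = a
  · simp [x1]
  by_cases x2 : x = C.1 q
  · simp [x2, f5, h1]
  by_cases x3 : x = q
  · simp [x3, h1, h2, (C.apply_ne q).symm]
  by_cases x4 : x = C.1 a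
  · simp [x4, C.apply_ne]
  simp [x1, x2, x3, x4]

end rewire

/-- The functions on chord diagrams whose sum over the three ways to join four vertices by two
chords vanishes. -/
def IsSkein (w : ChordDiagram n → ℚ) : Prop := ∀ (C : ChordDiagram n) (a q : Fin (2 * n)),
  q ≠ a → q ≠ C.1 a → w C + w (rewire C a q) + w (rewire (rewire C a q) a (C.1 q)) = 0

end ChordDiagram

namespace ChordDiagram

variable {n : ℕ}

/-! ### Skein functions are eigenvectors -/

theorem threeCycle_rotate {p q r : Fin (2 * n)} (h1 : p ≠ q) (h2 : q ≠ r) (h3 : r ≠ p) :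
    threeCycle q r p = threeCycle p q r := by
  ext x
  simp only [threeCycle, Equiv.Perm.mul_apply, Equiv.swap_apply_def]
  split_ifs <;> simp_all

theorem rewire_compat {α : Type*} {C : ChordDiagram n} {f : Fin (2 * n) → α} (hf : C.Compat f)
    {a q : Fin (2 * n)} (h1 : q ≠ a) (h2 : q ≠ C.1 a) (haq : f q = f a) :
    (rewire C a q).Compat f := by
  intro x
  rw [rewire_apply C h1 h2]
  have h3 := hf a
  have h4 := hf q
  split_ifs with x1 x2 x3 x4
  · rw [x1, haq]
  · rw [x2, haq]
  · rw [x3, h3, h4, haq]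
  · rw [x4, h3, h4, haq]
  · exact hf x

/-- The sum of a skein function over the chord diagrams which are compatible with a colouring
vanishes if two chords have the same colour. -/
theorem IsSkein.sum_compat_eq_zero {α : Type*} [DecidableEq α] {w : ChordDiagram n → ℚ}
    (hw : IsSkein w) {C₀ : ChordDiagram n} {f : Fin (2 * n) → α} (hf : C₀.Compat f)
    {a b : Fin (2 * n)} (hab : f b = f a) (h1 : b ≠ a) (h2 : b ≠ C₀.1 a) :
    ∑ C ∈ Finset.univ.filter (fun C : ChordDiagram n => C.Compat f), w C = 0 := by
  -- the pairs of a compatible diagram and a vertex on another chord of the same colour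
  set S : Finset (ChordDiagram n × Fin (2 * n)) := Finset.univ.filter fun x =>
    x.1.Compat f ∧ f x.2 = f a ∧ x.2 ≠ a ∧ x.2 ≠ x.1.1 a with hS
  let φ : ChordDiagram n × Fin (2 * n) → ChordDiagram n × Fin (2 * n) :=
    fun x => (rewire x.1 a x.2, x.1.1 x.2)
  have hmem : ∀ x, x ∈ S ↔ x.1.Compat f ∧ f x.2 = f a ∧ x.2 ≠ a ∧ x.2 ≠ x.1.1 a := by
    intro x; rw [hS, Finset.mem_filter]; simp
  have hφ : ∀ x ∈ S, φ x ∈ S := by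
    intro x hx
    rw [hmem] at hx ⊢
    obtain ⟨hx1, hx2, hx3, hx4⟩ := hx
    refine ⟨rewire_compat hx1 hx3 hx4 hx2, (hx1 _).trans hx2, x.1.apply_ne_rewire_left hx4, ?_⟩
    change x.1.1 x.2 ≠ (rewire x.1 a x.2).1 a
    rw [rewire_left _ hx3 hx4]
    exact x.1.apply_ne _
  have hφ3 : ∀ x ∈ S, φ (φ (φ x)) = x := by
    intro x hx
    rw [hmem] at hx
    obtain ⟨hx1, hx2, hx3, hx4⟩ := hx
    have e2 : (rewire x.1 a x.2).1 (x.1.1 x.2) = x.1.1 a := rewire_apply_partner _ hx3 hx4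
    refine Prod.ext ?_ ?_
    · change rewire (rewire (rewire x.1 a x.2) a (x.1.1 x.2)) a
        ((rewire x.1 a x.2).1 (x.1.1 x.2)) = x.1
      rw [e2, rewire_rewire_rewire _ hx3 hx4]
    · change (rewire (rewire x.1 a x.2) a (x.1.1 x.2)).1 ((rewire x.1 a x.2).1 (x.1.1 x.2)) = x.2
      rw [e2, rewire_rewire_apply _ hx3 hx4, if_neg (x.1.apply_ne a),
        if_neg fun h => hx3 (x.1.1.injective h).symm, if_neg hx4.symm, if_pos rfl]
  have hsum : ∀ F : ChordDiagram n × Fin (2 * n) → ℚ, ∑ x ∈ S, F (φ x) = ∑ x ∈ S, F x := by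
    intro F
    refine Finset.sum_nbij' φ (fun x => φ (φ x)) hφ (fun x hx => hφ _ (hφ _ hx)) hφ3 hφ3 ?_
    intro x _; rfl
  have hzero : ∑ x ∈ S, w x.1 = 0 := by
    have h3 : ∑ x ∈ S, (w x.1 + w (φ x).1 + w (φ (φ x)).1) = 0 := by
      refine Finset.sum_eq_zero fun x hx => ?_
      rw [hmem] at hx
      exact hw x.1 a x.2 hx.2.2.1 hx.2.2.2
    rw [Finset.sum_add_distrib, Finset.sum_add_distrib, hsum fun x => w (φ x).1,
      hsum fun x => w x.1] at h3
    linarith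
  have hcount : ∑ x ∈ S, w x.1 = ((Finset.univ.filter fun q => f q = f a).card - 2 : ℚ) *
      ∑ C ∈ Finset.univ.filter (fun C : ChordDiagram n => C.Compat f), w C := by
    rw [hS, Finset.sum_filter, Fintype.sum_prod_type, Finset.mul_sum, Finset.sum_filter]
    refine Finset.sum_congr rfl fun C _ => ?_
    by_cases hC : C.Compat f
    · rw [if_pos hC, ← Finset.sum_filter]
      change ∑ q ∈ Finset.univ.filter (fun q => C.Compat f ∧ f q = f a ∧ q ≠ a ∧ q ≠ C.1 a), w C = _
      rw [Finset.sum_const, nsmul_eq_mul]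
      congr 1
      have : (Finset.univ.filter fun q => C.Compat f ∧ f q = f a ∧ q ≠ a ∧ q ≠ C.1 a) =
          ((Finset.univ.filter fun q => f q = f a).erase a).erase (C.1 a) := by
        ext q; simp [hC]; tauto
      rw [this, Finset.card_erase_of_mem, Finset.card_erase_of_mem (by simp)]
      · have h3 : 2 ≤ (Finset.univ.filter fun q => f q = f a).card := by
          have : ({a, C.1 a} : Finset _) ⊆ Finset.univ.filter fun q => f q = f a := by
            intro q hq
            rw [Finset.mem_insert, Finset.mem_singleton] at hq
            rcases hq with rfl | rfl <;> simp [hC _]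
          have := Finset.card_le_card this
          rwa [Finset.card_pair (C.apply_ne a).symm] at this
        rw [Nat.sub_sub, Nat.cast_sub h3]; norm_num
      · simp [hC a, C.apply_ne]
    · rw [if_neg hC]
      exact Finset.sum_eq_zero fun q _ => if_neg fun h => hC h.1
  have hpos : (0 : ℚ) < (Finset.univ.filter fun q => f q = f a).card - 2 := by
    have : ({a, C₀.1 a, b} : Finset _) ⊆ Finset.univ.filter fun q => f q = f a := by
      intro q hq
      simp only [Finset.mem_insert, Finset.mem_singleton] at hq
      rcases hq with rfl | rfl | rfl <;> simp [hf _, hab]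
    have h3 := Finset.card_le_card this
    rw [Finset.card_eq_three.mpr ⟨a, C₀.1 a, b, (C₀.apply_ne a).symm, h1.symm, h2.symm, rfl⟩] at h3
    have : (3 : ℚ) ≤ (Finset.univ.filter fun q => f q = f a).card := by exact_mod_cast h3
    linarith
  rw [hzero] at hcount
  exact (mul_eq_zero.mp hcount.symm).resolve_left hpos.ne'

theorem compat_unique {α : Type*} {C C' : ChordDiagram n} {f : Fin (2 * n) → α}
    (hsep : ∀ a b, f b = f a → b ≠ a → b = C.1 a) (hf' : C'.Compat f) : C' = C :=
  ext fun i => hsep i _ (hf' i) (C'.apply_ne i)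

/-- The number of colourings with `N` colours for which different chords have different
colours. -/
theorem card_compat_separating (C : ChordDiagram n) (N : ℕ) :
    (Finset.univ.filter fun f : Fin (2 * n) → Fin N =>
      C.Compat f ∧ ∀ a b, f b = f a → b ≠ a → b = C.1 a).card = N.descFactorial n := by
  rw [← Fintype.card_subtype]
  have h := Fintype.card_embedding_eq (α := C.LeftEnds) (β := Fin N)
  rw [card_leftEnds, Fintype.card_fin] at h
  rw [← h, ← Fintype.card_congr (Equiv.subtypeInjectiveEquivEmbedding C.LeftEnds (Fin N))]
  refine Fintype.card_congr ((Equiv.subtypeSubtypeEquivSubtypeInter _ _).symm.trans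
    (C.compatEquiv.subtypeEquiv ?_))
  rintro ⟨f, hf⟩
  constructor
  · rintro hsep ⟨i, hi⟩ ⟨j, hj⟩ hij
    by_contra hne
    have hne' : j ≠ i := fun h => hne (Subtype.ext h.symm)
    have := hsep i j hij.symm hne'
    rw [this, apply_apply] at hj
    exact lt_asymm hi hj
  · intro hinj a b hab hne
    -- the left ends of the chords of `a` and `b` have the same colour
    have key : ∀ x : Fin (2 * n), ∃ i : C.LeftEnds, f i.1 = f x ∧ (i.1 = x ∨ i.1 = C.1 x) := by
      intro x
      by_cases hx : x < C.1 x
      · exact ⟨⟨x, hx⟩, rfl, Or.inl rfl⟩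
      · exact ⟨⟨C.1 x, by rw [apply_apply]; exact (C.not_lt_iff x).mp hx⟩, hf x, Or.inr rfl⟩
    obtain ⟨i, hi, hi'⟩ := key a
    obtain ⟨j, hj, hj'⟩ := key b
    have hij : i = j := hinj (by change f i.1 = f j.1; rw [hi, hj]; exact hab.symm)
    subst hij
    rcases hi' with hi' | hi' <;> rcases hj' with hj' | hj'
    · exact absurd (hj'.symm.trans hi') hne
    · rw [← hi', hj', apply_apply]
    · rw [← hj', hi']
    · exact absurd (C.1.injective (hj'.symm.trans hi')) hne

theorem IsSkein.sum_pow_components {w : ChordDiagram n → ℚ} (hw : IsSkein w)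
    (C : ChordDiagram n) (N : ℕ) :
    ∑ C', (N : ℚ) ^ components C C' * w C' = N.descFactorial n * w C := by
  have h1 : ∀ C', (N : ℚ) ^ components C C' * w C' =
      ∑ f : Fin (2 * n) → Fin N, if C.Compat f then (if C'.Compat f then w C' else 0) else 0 := by
    intro C'
    have := card_compat_compat (α := Fin N) C C'
    rw [Fintype.card_fin] at this
    rw [← Nat.cast_pow, ← this]
    simp only [← ite_and]
    rw [← Finset.sum_filter, Finset.sum_const, nsmul_eq_mul]
  rw [Finset.sum_congr rfl fun C' _ => h1 C', Finset.sum_comm]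
  have h2 : ∀ f : Fin (2 * n) → Fin N,
      (∑ C' : ChordDiagram n, if C.Compat f then (if C'.Compat f then w C' else 0) else 0) =
        if C.Compat f ∧ ∀ a b, f b = f a → b ≠ a → b = C.1 a then w C else 0 := by
    intro f
    by_cases hf : C.Compat f
    · simp only [if_pos hf]
      by_cases hs : ∀ a b, f b = f a → b ≠ a → b = C.1 a
      · rw [if_pos ⟨hf, hs⟩, Finset.sum_eq_single C]
        · rw [if_pos hf]
        · intro C' _ hne
          exact if_neg fun hf' => hne (compat_unique hs hf')
        · simp
      · rw [if_neg fun h => hs h.2]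
        push Not at hs
        obtain ⟨a, b, hab, hne, hne'⟩ := hs
        rw [← Finset.sum_filter]
        exact hw.sum_compat_eq_zero hf hab hne hne'
    · rw [if_neg fun h => hf h.1]; simp [hf]
  rw [Finset.sum_congr rfl fun f _ => h2 f, ← Finset.sum_filter, Finset.sum_const, nsmul_eq_mul,
    card_compat_separating]

end ChordDiagram

theorem eigenvalue_transpose_oneRow (n : ℕ) : eigenvalue (oneRow n).transpose =
    ∏ t ∈ Finset.range n, (2 * Polynomial.X + (t : ℚ[X])) := by
  have hmem : ∀ i j : ℕ, (i, j) ∈ (oneRow n).transpose ↔ j = 0 ∧ i < n := by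
    intro i j
    rw [YoungDiagram.mem_transpose, oneRow]
    simp only [Prod.swap_prod_mk, YoungDiagram.mem_ofRowLens, List.length_singleton]
    constructor
    · rintro ⟨h, h'⟩
      have h0 : j = 0 := by omega
      subst h0
      exact ⟨rfl, h'⟩
    · rintro ⟨rfl, h⟩
      exact ⟨by omega, h⟩
  have hcells : (oneRow n).transpose.cells = (Finset.range n).image fun t => (t, 0) := by
    ext ⟨i, j⟩
    rw [YoungDiagram.mem_cells, hmem, Finset.mem_image]
    constructor
    · rintro ⟨rfl, h⟩; exact ⟨i, Finset.mem_range.mpr h, rfl⟩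
    · rintro ⟨t, ht, h⟩
      obtain ⟨rfl, rfl⟩ := Prod.mk.inj h
      exact ⟨rfl, Finset.mem_range.mp ht⟩
  rw [eigenvalue, hcells, Finset.prod_image fun a _ b _ h => (Prod.mk.inj h).1]
  simp

theorem pairing_eval {n : ℕ} (C C' : ChordDiagram n) (N : ℚ) :
    (C.pairing C').eval (-N / 2) = (-1) ^ n * N ^ ChordDiagram.components C C' := by
  obtain ⟨d, hd⟩ := Nat.exists_eq_add_of_le (ChordDiagram.components_le C C')
  rw [ChordDiagram.pairing]
  simp only [Polynomial.eval_mul, Polynomial.eval_pow, Polynomial.eval_neg, Polynomial.eval_one,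
    Polynomial.eval_X, Polynomial.eval_ofNat]
  have h1 : n - ChordDiagram.components C C' = d := by omega
  rw [h1, show (2 : ℚ) * (-N / 2) = -1 * N by ring, mul_pow, ← mul_assoc, ← pow_add]
  congr 2
  omega

/-- Skein functions are eigenvectors of the pairing for the diagram with one column. Both sides of
the eigenvector equation are polynomials in the genus, which agree for `2g = -N` with `N` a natural
number: then the pairing counts colourings with `N` colours. -/
theorem ChordDiagram.IsSkein.mem_eigenspace {n : ℕ} {w : ChordDiagram n → ℚ} (hw : IsSkein w) :
    w ∈ eigenspace n (oneRow n).transpose := by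
  intro C
  apply Polynomial.eq_of_infinite_eval_eq
  refine Set.Infinite.mono (s := Set.range fun N : ℕ => -((N + n : ℕ) : ℚ) / 2) ?_ ?_
  · rintro _ ⟨N, rfl⟩
    change Polynomial.eval _ _ = Polynomial.eval _ _
    simp only [Polynomial.eval_finsetSum, Polynomial.eval_mul, Polynomial.eval_C, pairing_eval,
      eigenvalue_transpose_oneRow, Polynomial.eval_prod, Polynomial.eval_add, Polynomial.eval_X,
      Polynomial.eval_natCast, Polynomial.eval_ofNat, mul_assoc]
    rw [← Finset.mul_sum, hw.sum_pow_components, ← mul_assoc]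
    congr 1
    rw [Nat.descFactorial_eq_prod_range, Nat.cast_prod]
    have : ∀ t ∈ Finset.range n, (2 : ℚ) * (-((N + n : ℕ) : ℚ) / 2) + t =
        -1 * ((N + n - t : ℕ) : ℚ) := by
      intro t ht
      have := Finset.mem_range.mp ht
      rw [Nat.cast_sub (by omega)]; ring
    rw [Finset.prod_congr rfl this, Finset.prod_mul_distrib, Finset.prod_const, Finset.card_range]
  · refine Set.infinite_range_of_injective fun a b h => ?_
    have : ((a + n : ℕ) : ℚ) = ((b + n : ℕ) : ℚ) := by
      have h' : -((a + n : ℕ) : ℚ) / 2 = -((b + n : ℕ) : ℚ) / 2 := h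
      linarith
    have := Nat.cast_injective this
    omega

/-! ### The Gram matrix of the invariant tensors in genus one -/

/-- The contribution of one chord to a product over the chords of a diagram. -/
theorem prod_chords_peel {n : ℕ} (C : ChordDiagram n) {S : Finset (Fin (2 * n))}
    (hS : ∀ x ∈ S, C.1 x ∈ S) {a : Fin (2 * n)} (ha : a ∈ S) (f : Fin (2 * n) → SpIdx g) :
    ∏ i ∈ S.filter (fun i => i < C.1 i), omegaCoeff g (f i) (f (C.1 i)) =
      (if a < C.1 a then 1 else -1) * omegaCoeff g (f a) (f (C.1 a)) *
        ∏ i ∈ ((S.erase a).erase (C.1 a)).filter (fun i => i < C.1 i),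
          omegaCoeff g (f i) (f (C.1 i)) := by
  have hne := C.apply_ne a
  rw [Finset.prod_filter, Finset.prod_filter, ← Finset.mul_prod_erase _ _ ha,
    ← Finset.mul_prod_erase _ _ (Finset.mem_erase.mpr ⟨hne, hS a ha⟩), ← mul_assoc]
  congr 1
  rw [ChordDiagram.apply_apply]
  by_cases h : a < C.1 a
  · simp [h, h.not_gt]
  · rw [if_neg h, if_pos ((C.not_lt_iff a).mp h), if_neg h, omegaCoeff_antisymm]
    ring

/-- The Plücker relation. -/
theorem omegaCoeff_plucker (a p q r : SpIdx 1) :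
    omegaCoeff 1 a p * omegaCoeff 1 q r + omegaCoeff 1 a q * omegaCoeff 1 r p +
      omegaCoeff 1 a r * omegaCoeff 1 p q = 0 := by
  rcases a with a | a <;> rcases p with p | p <;> rcases q with q | q <;> rcases r with r | r <;>
    simp [omegaCoeff, Subsingleton.elim a 0, Subsingleton.elim p 0, Subsingleton.elim q 0,
      Subsingleton.elim r 0]

theorem chordCoeff_isSkein {n : ℕ} (f : Fin (2 * n) → SpIdx 1) :
    ChordDiagram.IsSkein fun C => chordCoeff 1 C f := by
  intro C a q h1 h2
  have hpq : C.1 a ≠ q := h2.symm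
  have hqr : q ≠ C.1 q := (C.apply_ne q).symm
  have hrp : C.1 q ≠ C.1 a := fun h => h1 (C.1.injective h)
  have hra : C.1 q ≠ a := C.apply_ne_rewire_left h2
  have hpa : C.1 a ≠ a := C.apply_ne a
  set τ := ChordDiagram.threeCycle (C.1 a) q (C.1 q) with hτ
  have hsign : ((Equiv.Perm.sign τ : ℤ) : ℚ) = 1 := by
    rw [hτ, ChordDiagram.sign_threeCycle hpq hqr]; simp
  have e1 : chordCoeff 1 (ChordDiagram.rewire C a q) f = chordCoeff 1 C (f ∘ τ) := by
    rw [chordCoeff_comp_perm, hsign, one_mul, hτ, ChordDiagram.rewire]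
  have e2 : chordCoeff 1 (ChordDiagram.rewire (ChordDiagram.rewire C a q) a (C.1 q)) f =
      chordCoeff 1 C ((f ∘ τ) ∘ τ) := by
    have : ChordDiagram.rewire (ChordDiagram.rewire C a q) a (C.1 q) =
        ChordDiagram.perm τ (ChordDiagram.rewire C a q) := by
      conv_lhs => rw [ChordDiagram.rewire]
      rw [ChordDiagram.rewire_left C h1 h2, ChordDiagram.rewire_apply_partner C h1 h2,
        ChordDiagram.threeCycle_rotate hpq hqr hrp]
    rw [this, chordCoeff_comp_perm, hsign, one_mul]
    have h3 := chordCoeff_comp_perm τ (ChordDiagram.rewire C a q) f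
    rw [hsign, one_mul] at h3
    rw [← h3]
    rfl
  have τp : τ (C.1 a) = q := by
    rw [hτ, ChordDiagram.threeCycle, Equiv.Perm.mul_apply,
      Equiv.swap_apply_of_ne_of_ne hpq hrp.symm, Equiv.swap_apply_left]
  have τq : τ q = C.1 q := by
    rw [hτ, ChordDiagram.threeCycle, Equiv.Perm.mul_apply, Equiv.swap_apply_left,
      Equiv.swap_apply_of_ne_of_ne hrp hqr.symm]
  have τr : τ (C.1 q) = C.1 a := by
    rw [hτ, ChordDiagram.threeCycle, Equiv.Perm.mul_apply, Equiv.swap_apply_right,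
      Equiv.swap_apply_right]
  have τx : ∀ x, x ≠ C.1 a → x ≠ q → x ≠ C.1 q → τ x = x := by
    intro x x1 x2 x3
    rw [hτ, ChordDiagram.threeCycle, Equiv.Perm.mul_apply, Equiv.swap_apply_of_ne_of_ne x2 x3,
      Equiv.swap_apply_of_ne_of_ne x1 x2]
  -- the product over the chords other than the two chords through `a` and `q`
  set R := (((((Finset.univ.erase a).erase (C.1 a)).erase q).erase (C.1 q)).filter
    fun i => i < C.1 i) with hR
  have hcoeff : ∀ F : Fin (2 * n) → SpIdx 1, chordCoeff 1 C F =
      C.sgn * (if a < C.1 a then 1 else -1) * (if q < C.1 q then 1 else -1) *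
        (∏ i ∈ R, omegaCoeff 1 (F i) (F (C.1 i))) *
        (omegaCoeff 1 (F a) (F (C.1 a)) * omegaCoeff 1 (F q) (F (C.1 q))) := by
    intro F
    rw [chordCoeff, prod_chords_peel C (a := a) (by simp) (Finset.mem_univ _),
      prod_chords_peel C (a := q) _ (by simp [h1, h2])]
    · ring
    · intro x hx
      simp only [Finset.mem_erase, Finset.mem_univ, and_true] at hx ⊢
      exact ⟨fun h => hx.2 (C.1.injective h), fun h => hx.1 (C.apply_eq_iff.mp h)⟩
  have hRτ : ∀ F : Fin (2 * n) → SpIdx 1, ∏ i ∈ R, omegaCoeff 1 ((F ∘ τ) i) ((F ∘ τ) (C.1 i)) =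
      ∏ i ∈ R, omegaCoeff 1 (F i) (F (C.1 i)) := by
    intro F
    refine Finset.prod_congr rfl fun x hx => ?_
    simp only [hR, Finset.mem_filter, Finset.mem_erase, Finset.mem_univ, and_true] at hx
    obtain ⟨⟨x1, x2, x3, x4⟩, -⟩ := hx
    simp only [Function.comp_apply]
    rw [τx x x3 x2 x1, τx]
    · exact fun h => x4 (C.1.injective h)
    · exact fun h => x1 (C.apply_eq_iff.mp h)
    · exact fun h => x2 (C.1.injective h)
  change chordCoeff 1 C f + chordCoeff 1 (ChordDiagram.rewire C a q) f +
    chordCoeff 1 (ChordDiagram.rewire (ChordDiagram.rewire C a q) a (C.1 q)) f = 0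
  rw [e1, e2, hcoeff f, hcoeff (f ∘ τ), hcoeff ((f ∘ τ) ∘ τ), hRτ (f ∘ τ), hRτ f]
  have τa : τ a = a := τx a hpa.symm h1.symm hra.symm
  simp only [Function.comp_apply, τp, τq, τr, τa]
  have := omegaCoeff_plucker (f a) (f (C.1 a)) (f q) (f (C.1 q))
  linear_combination (C.sgn * (if a < C.1 a then 1 else -1) * (if q < C.1 q then 1 else -1) *
        (∏ i ∈ R, omegaCoeff 1 (f i) (f (C.1 i)))) * this

/-- The standard scalar product of two invariant tensors in genus one. -/
def gram {n : ℕ} (C C' : ChordDiagram n) : ℚ :=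
  ∑ f : Fin (2 * n) → SpIdx 1, chordCoeff 1 C f * chordCoeff 1 C' f

theorem gram_isSkein {n : ℕ} (C : ChordDiagram n) : ChordDiagram.IsSkein (gram C) := by
  intro C' a q h1 h2
  simp only [gram, ← Finset.sum_add_distrib, ← mul_add]
  exact Finset.sum_eq_zero fun f _ => by
    rw [chordCoeff_isSkein f C' a q h1 h2, mul_zero]

theorem gram_perm {n : ℕ} (τ : Equiv.Perm (Fin (2 * n))) (C C' : ChordDiagram n) :
    gram (ChordDiagram.perm τ C) (ChordDiagram.perm τ C') = gram C C' := by
  have hs : ((Equiv.Perm.sign τ : ℤ) : ℚ) * ((Equiv.Perm.sign τ : ℤ) : ℚ) = 1 := by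
    rw [← Int.cast_mul, ← Units.val_mul, Int.units_mul_self]; simp
  refine Fintype.sum_equiv (Equiv.arrowCongr τ.symm (Equiv.refl _)) _ _ fun f => ?_
  have hf : (Equiv.arrowCongr τ.symm (Equiv.refl (SpIdx 1))) f = f ∘ τ := by funext i; simp
  rw [hf, chordCoeff_comp_perm, chordCoeff_comp_perm]
  linear_combination -(chordCoeff 1 (ChordDiagram.perm τ C) f *
    chordCoeff 1 (ChordDiagram.perm τ C') f) * hs

theorem gram_self {n : ℕ} (C : ChordDiagram n) : gram C C = 2 ^ n := by
  -- flipping the values at the left ends turns the squares of the coordinates of `a_C` into the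
  -- indicator function of the compatible colourings with two colours
  let flip : Equiv.Perm (Fin (2 * n) → SpIdx 1) :=
    Equiv.piCongrRight fun i => if i < C.1 i then Equiv.sumComm _ _ else Equiv.refl _
  have h : ∀ f, chordCoeff 1 C (flip f) * chordCoeff 1 C (flip f) =
      if C.Compat f then 1 else 0 := by
    intro f
    rw [chordCoeff, mul_mul_mul_comm, C.sgn_mul_self, one_mul, ← Finset.prod_mul_distrib]
    have hfac : ∀ i ∈ Finset.univ.filter (fun i => i < C.1 i),
        omegaCoeff 1 (flip f i) (flip f (C.1 i)) * omegaCoeff 1 (flip f i) (flip f (C.1 i)) =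
          if f (C.1 i) = f i then 1 else 0 := by
      intro i hi
      have hi' := (Finset.mem_filter.mp hi).2
      simp only [flip, Equiv.piCongrRight_apply, Pi.map_apply, hi', if_true,
        ChordDiagram.apply_apply, hi'.not_gt, if_false]
      rcases f i with x | x <;> rcases f (C.1 i) with y | y <;>
        simp [omegaCoeff, Subsingleton.elim x 0, Subsingleton.elim y 0]
    rw [Finset.prod_congr rfl hfac, Finset.prod_ite_zero, Finset.prod_const_one]
    have hiff : (∀ i ∈ Finset.univ.filter (fun i => i < C.1 i), f (C.1 i) = f i) ↔ C.Compat f := by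
      refine ⟨fun h i => ?_, fun h i _ => h i⟩
      by_cases hi : i < C.1 i
      · exact h i (by simp [hi])
      · have := h (C.1 i) (by simpa using (C.not_lt_iff i).mp hi)
        rw [ChordDiagram.apply_apply] at this
        exact this.symm
    by_cases hc : C.Compat f
    · rw [if_pos hc, if_pos (hiff.mpr hc)]
    · rw [if_neg hc, if_neg (hiff.not.mpr hc)]
  rw [gram, ← Equiv.sum_comp flip, Finset.sum_congr rfl fun f _ => h f, ← Finset.sum_filter,
    Finset.sum_const, ChordDiagram.card_compat]
  simp

/-- Replacing two chords `a c`, `b d` of `C` by `a b`, `c d`, where `a b` is a chord of `C₀`,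
splits one component of `C₀ ∪ C` into two. -/
theorem components_rewire {n : ℕ} (C₀ C : ChordDiagram n) {a : Fin (2 * n)}
    (h : C₀.1 a ≠ C.1 a) : ChordDiagram.components C₀ (ChordDiagram.rewire C a (C₀.1 a)) =
      ChordDiagram.components C₀ C + 1 := by
  have hba := C₀.apply_ne a
  have hb := C₀.apply_apply a
  set b := C₀.1 a with hbdef
  have hca := C.apply_ne a
  have hdb := C.apply_ne b
  have hda : C.1 b ≠ a := C.apply_ne_rewire_left h
  have hdc : C.1 b ≠ C.1 a := fun h' => hba (C.1.injective h')
  -- compatible colourings with two colours are counted through the bijection which changes the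
  -- colour of `a` and `b`
  have key : Fintype.card {f : Fin (2 * n) → Fin 2 //
      C₀.Compat f ∧ (ChordDiagram.rewire C a b).Compat f} =
      Fintype.card ({f : Fin (2 * n) → Fin 2 // C₀.Compat f ∧ C.Compat f} × Fin 2) := by
    have hrew := ChordDiagram.rewire_apply C hba h
    have hC₀x : ∀ x, x ≠ a → x ≠ b → C₀.1 x ≠ a ∧ C₀.1 x ≠ b := fun x x1 x2 =>
      ⟨fun h' => x2 (C₀.apply_eq_iff.mp h'), fun h' => x1 (C₀.1.injective h')⟩
    refine Fintype.card_congr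
      { toFun := fun f => (⟨fun x => if x = a ∨ x = b then f.1 (C.1 a) else f.1 x, ?_, ?_⟩, f.1 a)
        invFun := fun p => ⟨fun x => if x = a ∨ x = b then p.2 else p.1.1 x, ?_, ?_⟩
        left_inv := ?_
        right_inv := ?_ }
    · intro x
      by_cases x1 : x = a
      · simp [x1, ← hbdef]
      by_cases x2 : x = b
      · simp [x2, hb]
      have := hC₀x x x1 x2
      simp only [this.1, this.2, x1, x2, or_self, if_false]
      exact f.2.1 x
    · intro x
      have hcd : f.1 (C.1 a) = f.1 (C.1 b) := by
        have := f.2.2 (C.1 b)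
        rwa [ChordDiagram.rewire_apply_partner C hba h] at this
      by_cases x1 : x = a
      · simp [x1]
      by_cases x2 : x = b
      · simp [x2, hda, hdb, hcd]
      by_cases x3 : x = C.1 a
      · simp [x3, hca, h.symm]
      by_cases x4 : x = C.1 b
      · simp [x4, hda, hdb, hcd]
      have y1 : C.1 x ≠ a := fun h' => x3 (C.apply_eq_iff.mp h')
      have y2 : C.1 x ≠ b := fun h' => x4 (C.apply_eq_iff.mp h')
      have := f.2.2 x
      rw [hrew, if_neg x1, if_neg x2, if_neg x3, if_neg x4] at this
      simp only [x1, x2, y1, y2, or_self, if_false]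
      exact this
    · intro x
      by_cases x1 : x = a
      · simp [x1, ← hbdef]
      by_cases x2 : x = b
      · simp [x2, hb]
      have := hC₀x x x1 x2
      simp only [this.1, this.2, x1, x2, or_self, if_false]
      exact p.1.2.1 x
    · intro x
      have hcd : p.1.1 (C.1 a) = p.1.1 (C.1 b) := by
        rw [p.1.2.2, p.1.2.2, hbdef, p.1.2.1]
      rw [hrew]
      by_cases x1 : x = a
      · simp [x1]
      by_cases x2 : x = b
      · simp [x2]
      by_cases x3 : x = C.1 a
      · simp [x3, hca, h.symm, hda, hdb, hcd]
      by_cases x4 : x = C.1 b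
      · simp [x4, hda, hdb, hcd, hdc, hca, h.symm]
      have y1 : C.1 x ≠ a := fun h' => x3 (C.apply_eq_iff.mp h')
      have y2 : C.1 x ≠ b := fun h' => x4 (C.apply_eq_iff.mp h')
      simp only [x1, x2, x3, x4, y1, y2, or_self, if_false]
      exact p.1.2.2 x
    · rintro ⟨f, hf⟩
      apply Subtype.ext
      funext x
      by_cases x1 : x = a
      · simp [x1]
      by_cases x2 : x = b
      · have := hf.1 a
        rw [← hbdef] at this
        simp [x2, this]
      simp [x1, x2]
    · rintro ⟨⟨f, hf⟩, i⟩
      refine Prod.ext (Subtype.ext ?_) (by simp)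
      funext x
      by_cases x1 : x = a
      · have := hf.2 a
        simp [x1, hca, h.symm, this]
      by_cases x2 : x = b
      · have h1 := hf.2 a
        have h2 := hf.1 a
        rw [← hbdef] at h2
        simp [x2, hca, h.symm, h1, h2]
      simp [x1, x2]
  rw [Fintype.card_prod, Fintype.card_subtype, Fintype.card_subtype,
    ChordDiagram.card_compat_compat, ChordDiagram.card_compat_compat, Fintype.card_fin,
    ← pow_succ] at key
  exact Nat.pow_right_injective le_rfl key

theorem gram_rewire {n : ℕ} (C₀ C : ChordDiagram n) {a : Fin (2 * n)} (h : C₀.1 a ≠ C.1 a) :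
    gram C₀ (ChordDiagram.rewire C a (C₀.1 a)) = -2 * gram C₀ C := by
  have hba := C₀.apply_ne a
  have hsk := gram_isSkein C₀ C a (C₀.1 a) hba h
  have hswap : ChordDiagram.rewire (ChordDiagram.rewire C a (C₀.1 a)) a (C.1 (C₀.1 a)) =
      ChordDiagram.perm (Equiv.swap a (C₀.1 a)) C := by
    set b := C₀.1 a with hbdef
    have hca := C.apply_ne a
    have hdb := C.apply_ne b
    have hda : C.1 b ≠ a := C.apply_ne_rewire_left h
    have hdc : C.1 b ≠ C.1 a := fun h' => hba (C.1.injective h')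
    apply ChordDiagram.ext
    intro x
    rw [ChordDiagram.rewire_rewire_apply C hba h, ChordDiagram.perm_apply, Equiv.symm_swap]
    by_cases x1 : x = a
    · rw [if_pos x1, x1, Equiv.swap_apply_left, Equiv.swap_apply_of_ne_of_ne hda hdb]
    by_cases x2 : x = b
    · rw [if_neg x1, x2, if_neg hdb.symm, if_pos rfl, Equiv.swap_apply_right,
        Equiv.swap_apply_of_ne_of_ne hca h.symm]
    rw [if_neg x1, if_neg x2, Equiv.swap_apply_of_ne_of_ne x1 x2]
    by_cases x4 : x = C.1 b
    · rw [if_pos x4, x4, ChordDiagram.apply_apply, Equiv.swap_apply_right]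
    by_cases x3 : x = C.1 a
    · rw [if_neg x4, if_pos x3, x3, ChordDiagram.apply_apply, Equiv.swap_apply_left]
    rw [if_neg x4, if_neg x3, Equiv.swap_apply_of_ne_of_ne]
    · exact fun h' => x3 (C.apply_eq_iff.mp h')
    · exact fun h' => x4 (C.apply_eq_iff.mp h')
  have hinv : gram C₀ (ChordDiagram.perm (Equiv.swap a (C₀.1 a)) C) = gram C₀ C := by
    have h1 := gram_perm (Equiv.swap a (C₀.1 a)) C₀ C
    rwa [ChordDiagram.perm_swap_of_chord C₀ (i := a) (j := C₀.1 a) rfl] at h1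
  rw [hswap, hinv] at hsk
  linarith

/-- In genus one the pairing of chord diagrams is the scalar product of the invariant tensors. -/
theorem gram_eq_pairing {n : ℕ} (C₀ C : ChordDiagram n) :
    gram C₀ C = (C₀.pairing C).eval 1 := by
  have hpair : ∀ C, (C₀.pairing C).eval 1 = (-1) ^ n * (-2) ^ ChordDiagram.components C₀ C := by
    intro C
    rw [← pairing_eval]; norm_num
  rw [hpair]
  induction hm : (Finset.univ.filter fun i => C.1 i ≠ C₀.1 i).card using Nat.strong_induction_on
    generalizing C with
  | _ m ih =>
    by_cases hC : ∃ a, C₀.1 a ≠ C.1 a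
    · obtain ⟨a, ha⟩ := hC
      have hba := C₀.apply_ne a
      have h1 := gram_rewire C₀ C ha
      have hlt : (Finset.univ.filter fun i =>
          (ChordDiagram.rewire C a (C₀.1 a)).1 i ≠ C₀.1 i).card < m := by
        rw [← hm]
        refine Finset.card_lt_card (Finset.ssubset_iff_of_subset ?_ |>.mpr ⟨a, ?_, ?_⟩)
        · intro x hx
          rw [Finset.mem_filter] at hx ⊢
          refine ⟨Finset.mem_univ _, fun hx' => hx.2 ?_⟩
          rw [ChordDiagram.rewire_apply C hba ha]
          split_ifs with x1 x2 x3 x4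
          · rw [x1]
          · rw [x2, ChordDiagram.apply_apply]
          · rw [x3, ChordDiagram.apply_apply] at hx'
            exact absurd (C₀.apply_eq_iff.mp hx'.symm).symm ha
          · rw [x4, ChordDiagram.apply_apply] at hx'
            exact absurd (C₀.1.injective hx').symm (C.apply_ne_rewire_left ha)
          · exact hx'
        · simpa using ha.symm
        · simp [ChordDiagram.rewire_left C hba ha]
      have h2 := ih _ hlt _ rfl
      rw [h1, components_rewire C₀ C ha, pow_succ] at h2
      linarith
    · push Not at hC
      have : C = C₀ := ChordDiagram.ext fun i => (hC i).symm
      subst this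
      rw [gram_self, ChordDiagram.components_self, ← mul_pow]; norm_num

/-! ### The eigenspace of the one-row diagram and the invariant tensors -/

theorem repr_chordTensor {n : ℕ} (C : ChordDiagram n) (f : Fin (2 * n) → SpIdx g) :
    (tensorBasis g (2 * n)).repr (chordTensor g C) f = chordCoeff g C f := by
  classical
  simp only [chordTensor_eq, map_sum, map_smul, Module.Basis.repr_self, Finsupp.finsetSum_apply,
    Finsupp.smul_apply, Finsupp.single_apply, smul_eq_mul]
  simp

theorem repr_Phi {n : ℕ} (v : ChordDiagram n → ℚ) (f : Fin (2 * n) → SpIdx g) :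
    (tensorBasis g (2 * n)).repr (Phi g n v) f = ∑ C, v C * chordCoeff g C f := by
  rw [Phi, Fintype.linearCombination_apply, map_sum, Finsupp.finsetSum_apply]
  simp [repr_chordTensor]

theorem eigenspace_mem_eval_one {n : ℕ} {v : ChordDiagram n → ℚ}
    (hv : v ∈ eigenspace n (oneRow n).transpose) (C : ChordDiagram n) :
    ∑ C', gram C C' * v C' = (∏ t ∈ Finset.range n, (2 + (t : ℚ))) * v C := by
  have h := congrArg (Polynomial.eval 1) (hv C)
  rw [eigenvalue_transpose_oneRow] at h
  simpa [Polynomial.eval_finsetSum, Polynomial.eval_prod, gram_eq_pairing] using h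

/-- In genus one `Φ` is injective on the eigenspace, because its Gram matrix acts there as a
positive scalar. -/
theorem eq_zero_of_Phi_eq_zero {n : ℕ} {v : ChordDiagram n → ℚ}
    (hv : v ∈ eigenspace n (oneRow n).transpose) (h : Phi 1 n v = 0) : v = 0 := by
  funext C
  have h0 : ∑ C', gram C C' * v C' = 0 := by
    simp only [gram, Finset.sum_mul]
    rw [Finset.sum_comm]
    refine Finset.sum_eq_zero fun f _ => ?_
    have hf := repr_Phi (g := 1) v f
    rw [h, map_zero, Finsupp.zero_apply] at hf
    calc ∑ C', chordCoeff 1 C f * chordCoeff 1 C' f * v C'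
        = chordCoeff 1 C f * ∑ C', v C' * chordCoeff 1 C' f := by
          rw [Finset.mul_sum]; exact Finset.sum_congr rfl fun _ _ => by ring
      _ = 0 := by rw [← hf, mul_zero]
  rw [eigenspace_mem_eval_one hv C] at h0
  rcases mul_eq_zero.mp h0 with h1 | h1
  · exfalso
    exact (Finset.prod_pos fun t _ => by positivity : (0 : ℚ) <
      ∏ t ∈ Finset.range n, (2 + (t : ℚ))).ne' h1
  · exact h1

/-- In genus one the eigenspace is mapped by `Φ` onto the image of `Φ`: writing `Φ` as a matrix
`M`, the matrices `M` and `M Mᵀ` have the same range, and the columns of `Mᵀ` are skein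
functions. -/
theorem exists_mem_eigenspace_Phi_eq {n : ℕ} (v : ChordDiagram n → ℚ) :
    ∃ w ∈ eigenspace n (oneRow n).transpose, Phi 1 n w = Phi 1 n v := by
  let M : Matrix (Fin (2 * n) → SpIdx 1) (ChordDiagram n) ℚ := fun f C => chordCoeff 1 C f
  have hle : LinearMap.range (M * M.transpose).mulVecLin ≤ LinearMap.range M.mulVecLin := by
    rw [Matrix.mulVecLin_mul]
    exact LinearMap.range_comp_le_range _ _
  have heq := Submodule.eq_of_le_of_finrank_eq hle (Matrix.rank_self_mul_transpose M)
  obtain ⟨u, hu⟩ : M.mulVecLin v ∈ LinearMap.range (M * M.transpose).mulVecLin := by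
    rw [heq]; exact ⟨v, rfl⟩
  refine ⟨M.transpose.mulVec u, ChordDiagram.IsSkein.mem_eigenspace ?_, ?_⟩
  · intro C a q h1 h2
    simp only [Matrix.mulVec, dotProduct, ← Finset.sum_add_distrib, ← add_mul]
    exact Finset.sum_eq_zero fun f _ =>
      mul_eq_zero_of_left (chordCoeff_isSkein f C a q h1 h2) _
  · apply (tensorBasis 1 (2 * n)).repr.injective
    ext f
    rw [repr_Phi, repr_Phi]
    have := congrFun hu f
    simp only [Matrix.mulVecLin_apply] at this
    rw [← Matrix.mulVec_mulVec] at this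
    simp only [Matrix.mulVec, dotProduct, M] at this ⊢
    simpa [mul_comm] using this

/-- The action of a permutation of the vertices on combinations of chord diagrams, twisted by the
sign. -/
def signedPerm {n : ℕ} (τ : Equiv.Perm (Fin (2 * n))) : Module.End ℚ (ChordDiagram n → ℚ) :=
  ((Equiv.Perm.sign τ : ℤ) : ℚ) • LinearMap.funLeft ℚ ℚ (ChordDiagram.perm τ⁻¹)

theorem signedPerm_mem_eigenspace {n : ℕ} {lam : YoungDiagram} (τ : Equiv.Perm (Fin (2 * n)))
    {v : ChordDiagram n → ℚ} (hv : v ∈ eigenspace n lam) : signedPerm τ v ∈ eigenspace n lam := by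
  refine Submodule.smul_mem _ _ fun C => ?_
  rw [LinearMap.funLeft_apply, ← hv, ← (ChordDiagram.permEquiv τ⁻¹).sum_comp fun C' =>
    (ChordDiagram.perm τ⁻¹ C).pairing C' * Polynomial.C (v C')]
  exact Finset.sum_congr rfl fun C' _ => by
    rw [ChordDiagram.permEquiv_apply, ChordDiagram.pairing_perm, LinearMap.funLeft_apply]

theorem permAct_Phi {n : ℕ} (τ : Equiv.Perm (Fin (2 * n))) (v : ChordDiagram n → ℚ) :
    permAct g τ (Phi g n v) = Phi g n (signedPerm τ v) := by
  simp only [Phi, Fintype.linearCombination_apply, map_sum, map_smul, permAct_chordTensor,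
    signedPerm, LinearMap.smul_apply, LinearMap.funLeft_apply]
  rw [← (ChordDiagram.permEquiv τ).sum_comp fun C => v (ChordDiagram.perm τ⁻¹ C) • chordTensor g C,
    Finset.smul_sum]
  refine Finset.sum_congr rfl fun C _ => ?_
  rw [ChordDiagram.permEquiv_apply, ← ChordDiagram.perm_mul, inv_mul_cancel,
    ChordDiagram.perm_one, smul_comm]

/-- A family of operators on tensors, one for each genus, is induced by chord diagrams if on the
image of `Φ` it is given by one operator on combinations of chord diagrams, which preserves the
eigenspaces of the pairing. -/
def InducedByChords (n : ℕ) (θ : ∀ g : ℕ, Module.End ℚ (⨂[ℚ]^(2 * n) (HQ g))) : Prop :=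
  ∃ θ' : Module.End ℚ (ChordDiagram n → ℚ),
    (∀ lam, ∀ v ∈ eigenspace n lam, θ' v ∈ eigenspace n lam) ∧
    ∀ g v, θ g (Phi g n v) = Phi g n (θ' v)

namespace InducedByChords

variable {n : ℕ} {θ η : ∀ g : ℕ, Module.End ℚ (⨂[ℚ]^(2 * n) (HQ g))}

theorem one : InducedByChords n fun _ => 1 := ⟨1, fun _ _ hv => hv, fun _ _ => rfl⟩

theorem zero : InducedByChords n fun _ => 0 :=
  ⟨0, fun _ _ _ => Submodule.zero_mem _, fun _ _ => by simp⟩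

theorem add (hθ : InducedByChords n θ) (hη : InducedByChords n η) :
    InducedByChords n fun g => θ g + η g := by
  obtain ⟨θ', h1, h2⟩ := hθ
  obtain ⟨η', h3, h4⟩ := hη
  exact ⟨θ' + η', fun lam v hv => Submodule.add_mem _ (h1 lam v hv) (h3 lam v hv),
    fun g v => by simp [h2, h4]⟩

theorem sub (hθ : InducedByChords n θ) (hη : InducedByChords n η) :
    InducedByChords n fun g => θ g - η g := by
  obtain ⟨θ', h1, h2⟩ := hθ
  obtain ⟨η', h3, h4⟩ := hη
  exact ⟨θ' - η', fun lam v hv => Submodule.sub_mem _ (h1 lam v hv) (h3 lam v hv),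
    fun g v => by simp [h2, h4]⟩

theorem mul (hθ : InducedByChords n θ) (hη : InducedByChords n η) :
    InducedByChords n fun g => θ g * η g := by
  obtain ⟨θ', h1, h2⟩ := hθ
  obtain ⟨η', h3, h4⟩ := hη
  exact ⟨θ' * η', fun lam v hv => h1 lam _ (h3 lam v hv), fun g v => by simp [h2, h4]⟩

theorem permAct (τ : Equiv.Perm (Fin (2 * n))) : InducedByChords n fun g => permAct g τ :=
  ⟨signedPerm τ, fun _ _ hv => signedPerm_mem_eigenspace τ hv, fun _ v => permAct_Phi τ v⟩

theorem sum {ι : Type*} (s : Finset ι) {θ : ι → ∀ g : ℕ, Module.End ℚ (⨂[ℚ]^(2 * n) (HQ g))}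
    (h : ∀ i ∈ s, InducedByChords n (θ i)) : InducedByChords n fun g => ∑ i ∈ s, θ i g := by
  classical
  induction s using Finset.induction_on with
  | empty => simpa using zero
  | insert a s ha ih =>
    simp only [Finset.sum_insert ha]
    exact (h a (Finset.mem_insert_self _ _)).add
      (ih fun i hi => h i (Finset.mem_insert_of_mem hi))

theorem onePAct (m : ℕ) : InducedByChords n fun g => onePAct g (2 * n) m := by
  induction m with
  | zero => exact one
  | succ m ih => exact (one.sub (permAct _)).mul ih

theorem cycSum_mul_onePAct (m : ℕ) :
    InducedByChords n fun g => cycSum g (2 * n) * GenusOne.onePAct g (2 * n) m :=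
  (sum _ fun _ _ => permAct _).mul (onePAct m)

end InducedByChords

/-! ### Projection to genus one -/

theorem repr_map_projOne (hg : 1 ≤ g) {N : ℕ} (t : ⨂[ℚ]^N (HQ g)) (f : Fin N → SpIdx 1) :
    (tensorBasis 1 N).repr (PiTensorProduct.map (fun _ => projOne g hg) t) f =
      (tensorBasis g N).repr t (fun i => Sum.map (Fin.castLE hg) (Fin.castLE hg) (f i)) := by
  induction t using PiTensorProduct.induction_on with
  | smul_tprod r v =>
    rw [map_smul, PiTensorProduct.map_tprod, map_smul, map_smul, Finsupp.smul_apply,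
      Finsupp.smul_apply, tensorBasis, tensorBasis, Basis.piTensorProduct_repr_tprod_apply,
      Basis.piTensorProduct_repr_tprod_apply]
    simp [projOne, LinearMap.funLeft_apply]
  | add s t hs ht =>
    rw [map_add, map_add, map_add, Finsupp.add_apply, Finsupp.add_apply, hs, ht]

theorem map_projOne_Phi (hg : 1 ≤ g) {n : ℕ} (v : ChordDiagram n → ℚ) :
    PiTensorProduct.map (fun _ => projOne g hg) (Phi g n v) = Phi 1 n v := by
  apply (tensorBasis 1 (2 * n)).repr.injective
  ext f
  rw [repr_map_projOne, repr_Phi, repr_Phi]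
  refine Finset.sum_congr rfl fun C _ => ?_
  have h : ∀ a b : SpIdx 1, omegaCoeff g (Sum.map (Fin.castLE hg) (Fin.castLE hg) a)
      (Sum.map (Fin.castLE hg) (Fin.castLE hg) b) = omegaCoeff 1 a b := by
    rintro (a | a) (b | b) <;> simp [omegaCoeff, Subsingleton.elim a b]
  simp only [chordCoeff, h]

/-! ### Invariant tensors in genus one are combinations of chord diagrams -/

theorem swap_ne (a : SpIdx 1) : a.swap ≠ a := by rcases a with a | a <;> simp

theorem eq_or_eq_swap (a b : SpIdx 1) : b = a ∨ b = a.swap := by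
  rcases a with a | a <;> rcases b with b | b <;> simp [Subsingleton.elim a b]

section
variable {V : Type*} [DecidableEq V]

/-- The function `c` on the colourings of `V` by the two basis vectors of `H_1`, which depends only
on the restriction to `S`, is the family of coordinates of a tensor annihilated by `sl₂`: it has
weight zero and is annihilated by the raising and the lowering operator. -/
structure SlInvariant (S : Finset V) (c : (V → SpIdx 1) → ℚ) : Prop where
  congr : ∀ f f', (∀ i ∈ S, f i = f' i) → c f = c f'
  weight : ∀ f, c f ≠ 0 →
    ∀ a : SpIdx 1, (S.filter fun i => f i = a).card = (S.filter fun i => f i = a.swap).card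
  shift : ∀ (a : SpIdx 1) f, ∑ i ∈ S.filter (fun i => f i = a), c (Function.update f i a.swap) = 0

theorem card_filter_comp_swap {S : Finset V} {i j : V} (hi : i ∈ S) (hj : j ∈ S)
    (f : V → SpIdx 1) (a : SpIdx 1) :
    (S.filter fun k => (f ∘ Equiv.swap i j) k = a).card = (S.filter fun k => f k = a).card := by
  refine Finset.card_equiv (Equiv.swap i j) fun k => ?_
  have : Equiv.swap i j k ∈ S ↔ k ∈ S := by
    by_cases h1 : k = i
    · simp [h1, hi, hj]
    by_cases h2 : k = j
    · simp [h2, hi, hj]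
    rw [Equiv.swap_apply_of_ne_of_ne h1 h2]
  simp [this]

/-- A form of the Casimir identity. -/
theorem SlInvariant.card_add_two_mul {S : Finset V} {c : (V → SpIdx 1) → ℚ} (hc : SlInvariant S c)
    {i : V} (hi : i ∈ S) (f : V → SpIdx 1) :
    ((S.card : ℚ) + 2) * c f = 2 * ∑ j ∈ S.erase i, (c f - c (f ∘ Equiv.swap i j)) := by
  by_cases hb : ∀ a : SpIdx 1,
      (S.filter fun i => f i = a).card = (S.filter fun i => f i = a.swap).card
  · set a := f i with ha
    have hsub : S.filter (fun j => f j = a.swap) ⊆ S.erase i := by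
      intro j hj
      rw [Finset.mem_filter] at hj
      refine Finset.mem_erase.mpr ⟨?_, hj.1⟩
      rintro rfl
      exact swap_ne _ hj.2.symm
    rw [← Finset.sum_subset hsub]
    · have hcard : S.card = 2 * (S.filter fun j => f j = a.swap).card := by
        have h1 := Finset.card_filter_add_card_filter_not (s := S) (fun j => f j = a)
        have h2 : S.filter (fun j => ¬f j = a) = S.filter fun j => f j = a.swap :=
          Finset.filter_congr fun j _ => by
            rcases eq_or_eq_swap a (f j) with h | h
            · rw [h]; simp [(swap_ne a).symm]
            · rw [h]; simp [swap_ne]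
        rw [h2, hb a] at h1
        omega
      have hE := hc.shift a.swap (Function.update f i a.swap)
      have hfil : S.filter (fun j => Function.update f i a.swap j = a.swap) =
          insert i (S.filter fun j => f j = a.swap) := by
        ext j
        by_cases h : j = i
        · simp [h, hi]
        · simp [h]
      rw [hfil, Finset.sum_insert (by simp [← ha, (swap_ne a).symm]), Function.update_idem,
        Sum.swap_swap, ha, Function.update_eq_self, ← ha] at hE
      have hsw : ∀ j ∈ S.filter (fun j => f j = a.swap),
          c (Function.update (Function.update f i a.swap) j a) = c (f ∘ Equiv.swap i j) := by
        intro j hj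
        rw [Finset.mem_filter] at hj
        congr 1
        funext k
        by_cases h1 : k = j
        · subst h1; simp [ha]
        by_cases h2 : k = i
        · subst h2; simp [h1, hj.2]
        · simp [h1, h2, Equiv.swap_apply_of_ne_of_ne h2 h1]
      rw [Finset.sum_congr rfl hsw] at hE
      rw [Finset.sum_sub_distrib, Finset.sum_const, nsmul_eq_mul, hcard]
      push_cast
      linear_combination 2 * hE
    · intro j hj hj'
      rw [Finset.mem_erase] at hj
      have hfj : f j = a := by
        rcases eq_or_eq_swap a (f j) with h | h
        · exact h
        · exact absurd (Finset.mem_filter.mpr ⟨hj.2, h⟩) hj'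
      have : f ∘ Equiv.swap i j = f := by
        funext k
        by_cases h1 : k = j
        · subst h1; simp [hfj, ha]
        by_cases h2 : k = i
        · subst h2; simp [hfj, ha]
        · simp [Equiv.swap_apply_of_ne_of_ne h2 h1]
      rw [this, sub_self]
  · have h0 : c f = 0 := by
      by_contra h
      exact hb (hc.weight f h)
    rw [h0, mul_zero, Finset.sum_eq_zero, mul_zero]
    intro j hj
    have : c (f ∘ Equiv.swap i j) = 0 := by
      by_contra h
      refine hb fun a => ?_
      have := hc.weight _ h a
      rwa [card_filter_comp_swap hi (Finset.mem_of_mem_erase hj),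
        card_filter_comp_swap hi (Finset.mem_of_mem_erase hj)] at this
    rw [this, sub_zero]

/-- Contraction of the places `i` and `j` with the symplectic form. -/
def contract (c : (V → SpIdx 1) → ℚ) (i j : V) (f : V → SpIdx 1) : ℚ :=
  c (Function.update (Function.update f i (Sum.inl 0)) j (Sum.inr 0)) -
    c (Function.update (Function.update f i (Sum.inr 0)) j (Sum.inl 0))

theorem sub_comp_swap_eq {c : (V → SpIdx 1) → ℚ} {i j : V} (hij : j ≠ i) (f : V → SpIdx 1) :
    c f - c (f ∘ Equiv.swap i j) = omegaCoeff 1 (f i) (f j) * contract c i j f := by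
  have h1 : c f = c (Function.update (Function.update f i (f i)) j (f j)) := by
    rw [Function.update_eq_self, Function.update_eq_self]
  have h2 : f ∘ Equiv.swap i j = Function.update (Function.update f i (f j)) j (f i) := by
    funext k
    by_cases k1 : k = j
    · subst k1; simp
    by_cases k2 : k = i
    · subst k2; simp [k1]
    · simp [k1, k2, Equiv.swap_apply_of_ne_of_ne k2 k1]
  rw [h1, h2, contract]
  rcases f i with a | a <;> rcases f j with b | b <;>
    simp [omegaCoeff, Subsingleton.elim a 0, Subsingleton.elim b 0]

theorem SlInvariant.contract {S : Finset V} {c : (V → SpIdx 1) → ℚ} (hc : SlInvariant S c)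
    {i j : V} (hi : i ∈ S) (hj : j ∈ S) (hij : j ≠ i) :
    SlInvariant ((S.erase i).erase j) (contract c i j) where
  congr f f' h := by
    rw [GenusOne.contract, GenusOne.contract]
    congr 1 <;>
    · apply hc.congr
      intro k hk
      by_cases h1 : k = j
      · simp [h1]
      by_cases h2 : k = i
      · simp [h2, hij.symm]
      · simp [h1, h2, h k (by simp [h1, h2, hk])]
  weight f hf a := by
    have key : ∀ (p : SpIdx 1) (b : SpIdx 1), (S.filter fun k =>
        Function.update (Function.update f i p) j p.swap k = b).card =
        (((S.erase i).erase j).filter fun k => f k = b).card + 1 := by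
      intro p b
      have hS : S = insert i (insert j ((S.erase i).erase j)) := by
        rw [Finset.insert_erase (Finset.mem_erase.mpr ⟨hij, hj⟩), Finset.insert_erase hi]
      conv_lhs => rw [hS]
      have hrest : ((S.erase i).erase j).filter
          (fun k => Function.update (Function.update f i p) j p.swap k = b) =
          ((S.erase i).erase j).filter fun k => f k = b := by
        refine Finset.filter_congr fun k hk => ?_
        simp only [Finset.mem_erase] at hk
        simp [hk.1, hk.2.1]
      rw [Finset.filter_insert, Finset.filter_insert, hrest]
      rcases eq_or_eq_swap p b with rfl | rfl
      · rw [if_pos (by simp [hij.symm]), if_neg (by simp [swap_ne])]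
        exact Finset.card_insert_of_notMem (by simp)
      · rw [if_neg (by simp [hij.symm, (swap_ne p).symm]), if_pos (by simp)]
        exact Finset.card_insert_of_notMem (by simp)
    have : c (Function.update (Function.update f i (Sum.inl 0)) j (Sum.inl 0 : SpIdx 1).swap) ≠ 0 ∨
        c (Function.update (Function.update f i (Sum.inr 0)) j (Sum.inr 0 : SpIdx 1).swap) ≠ 0 := by
      by_contra! h
      apply hf
      rw [GenusOne.contract]
      simp only [Sum.swap_inl, Sum.swap_inr] at h
      rw [h.1, h.2, sub_zero]
    rcases this with h | h <;>
    · have := hc.weight _ h a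
      rw [key, key] at this
      omega
  shift a f := by
    have key : ∀ p : SpIdx 1, ∑ k ∈ ((S.erase i).erase j).filter (fun k => f k = a),
        c (Function.update (Function.update (Function.update f k a.swap) i p) j p.swap) =
        -c (Function.update (Function.update f i a.swap) j a.swap) := by
      intro p
      have h := hc.shift a (Function.update (Function.update f i p) j p.swap)
      have hS : S = insert i (insert j ((S.erase i).erase j)) := by
        rw [Finset.insert_erase (Finset.mem_erase.mpr ⟨hij, hj⟩), Finset.insert_erase hi]
      have hrest : ((S.erase i).erase j).filter
          (fun k => Function.update (Function.update f i p) j p.swap k = a) =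
          ((S.erase i).erase j).filter fun k => f k = a := by
        refine Finset.filter_congr fun k hk => ?_
        simp only [Finset.mem_erase] at hk
        simp [hk.1, hk.2.1]
      have hterm : ∑ k ∈ ((S.erase i).erase j).filter (fun k => f k = a),
          c (Function.update (Function.update (Function.update f k a.swap) i p) j p.swap) =
          ∑ k ∈ ((S.erase i).erase j).filter (fun k => f k = a),
          c (Function.update (Function.update (Function.update f i p) j p.swap) k a.swap) := by
        refine Finset.sum_congr rfl fun k hk => ?_
        simp only [Finset.mem_filter, Finset.mem_erase] at hk
        rw [Function.update_comm hk.1.2.1, Function.update_comm hk.1.1]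
      rw [hterm]
      conv at h => lhs; rw [hS]
      rw [Finset.filter_insert, Finset.filter_insert, hrest] at h
      rcases eq_or_eq_swap p a with rfl | rfl
      · rw [if_pos (by simp [hij.symm]), if_neg (by simp [swap_ne]),
          Finset.sum_insert (by simp), Function.update_comm hij,
          Function.update_idem] at h
        linarith
      · rw [if_neg (by simp [hij.symm, (swap_ne p).symm]), if_pos (by simp),
          Finset.sum_insert (by simp), Function.update_idem, Sum.swap_swap] at h
        rw [Sum.swap_swap]
        linarith
    simp only [GenusOne.contract, Finset.sum_sub_distrib]
    have h1 := key (Sum.inl 0)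
    have h2 := key (Sum.inr 0)
    simp only [Sum.swap_inl, Sum.swap_inr] at h1 h2
    rw [h1, h2, sub_self]

end

section
variable {V : Type*} [DecidableEq V] [LinearOrder V]

/-- The functions on colourings given by perfect matchings of `S`. -/
def matchingFunctions (S : Finset V) : Set ((V → SpIdx 1) → ℚ) :=
  {F | ∃ C : Equiv.Perm V, (∀ i, C (C i) = i) ∧ (∀ i ∈ S, C i ≠ i) ∧ (∀ i ∉ S, C i = i) ∧
    F = fun f => ∏ i ∈ S.filter (fun i => i < C i), omegaCoeff 1 (f i) (f (C i))}

theorem mul_mem_matchingFunctions {S : Finset V} {i j : V} (hi : i ∈ S) (hj : j ∈ S) (hij : i < j)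
    {F : (V → SpIdx 1) → ℚ} (hF : F ∈ matchingFunctions ((S.erase i).erase j)) :
    (fun f => omegaCoeff 1 (f i) (f j) * F f) ∈ matchingFunctions S := by
  obtain ⟨C, h1, h2, h3, rfl⟩ := hF
  have hCi : C i = i := h3 i (by simp)
  have hCj : C j = j := h3 j (by simp)
  have hC : ∀ k, k ≠ i → k ≠ j → C k ≠ i ∧ C k ≠ j := fun k k1 k2 =>
    ⟨fun h => k1 (C.injective (h.trans hCi.symm)), fun h => k2 (C.injective (h.trans hCj.symm))⟩
  have ev : ∀ k, k ≠ i → k ≠ j → (C * Equiv.swap i j) k = C k := fun k k1 k2 => by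
    rw [Equiv.Perm.mul_apply, Equiv.swap_apply_of_ne_of_ne k1 k2]
  have ei : (C * Equiv.swap i j) i = j := by simp [hCj]
  have ej : (C * Equiv.swap i j) j = i := by simp [hCi]
  refine ⟨C * Equiv.swap i j, fun k => ?_, fun k hk => ?_, fun k hk => ?_, ?_⟩
  · by_cases k1 : k = i
    · rw [k1, ei, ej]
    by_cases k2 : k = j
    · rw [k2, ej, ei]
    rw [ev k k1 k2, ev _ (hC k k1 k2).1 (hC k k1 k2).2, h1]
  · by_cases k1 : k = i
    · rw [k1, ei]; exact hij.ne'
    by_cases k2 : k = j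
    · rw [k2, ej]; exact hij.ne
    rw [ev k k1 k2]
    exact h2 k (by simp [k1, k2, hk])
  · have k1 : k ≠ i := by rintro rfl; exact hk hi
    have k2 : k ≠ j := by rintro rfl; exact hk hj
    rw [ev k k1 k2]
    exact h3 k (by simp [hk])
  · funext f
    have hfil : S.filter (fun k => k < (C * Equiv.swap i j) k) =
        insert i (((S.erase i).erase j).filter fun k => k < C k) := by
      ext k
      by_cases k1 : k = i
      · subst k1; simp [ei, hij, hi, -Equiv.Perm.coe_mul]
      by_cases k2 : k = j
      · subst k2; simp [ej, hij.not_gt, k1, -Equiv.Perm.coe_mul]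
      simp [ev k k1 k2, k1, k2, -Equiv.Perm.coe_mul]
    rw [hfil, Finset.prod_insert (by simp), ei]
    congr 1
    refine Finset.prod_congr rfl fun k hk => ?_
    simp only [Finset.mem_filter, Finset.mem_erase] at hk
    rw [ev k hk.1.2.1 hk.1.1]

theorem SlInvariant.mem_span {S : Finset V} {c : (V → SpIdx 1) → ℚ} (hc : SlInvariant S c) :
    c ∈ Submodule.span ℚ (matchingFunctions S) := by
  induction hN : S.card using Nat.strong_induction_on generalizing S c with
  | _ N ih =>
    rcases S.eq_empty_or_nonempty with rfl | hS
    · have : c = c (fun _ => Sum.inl 0) • fun _ => 1 := by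
        funext f
        rw [Pi.smul_apply, smul_eq_mul, mul_one]
        exact hc.congr _ _ (by simp)
      rw [this]
      exact Submodule.smul_mem _ _ (Submodule.subset_span
        ⟨1, fun _ => rfl, by simp, fun _ _ => rfl, by simp⟩)
    · set i := S.min' hS
      have hi : i ∈ S := S.min'_mem hS
      have hcf : c = (2 / ((S.card : ℚ) + 2)) • ∑ j ∈ S.erase i,
          LinearMap.mulLeft ℚ (fun f : V → SpIdx 1 => omegaCoeff 1 (f i) (f j))
            (GenusOne.contract c i j) := by
        funext f
        have h := hc.card_add_two_mul hi f
        rw [Finset.sum_congr rfl fun j hj =>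
          sub_comp_swap_eq (c := c) (Finset.ne_of_mem_erase hj) f] at h
        simp only [Pi.smul_apply, Finset.sum_apply, LinearMap.mulLeft_apply, Pi.mul_apply,
          smul_eq_mul]
        rw [div_mul_eq_mul_div, ← h, mul_div_cancel_left₀]
        positivity
      rw [hcf]
      refine Submodule.smul_mem _ _ (Submodule.sum_mem _ fun j hj => ?_)
      have hj' := Finset.mem_of_mem_erase hj
      have hne := Finset.ne_of_mem_erase hj
      have hlt : i < j := lt_of_le_of_ne (S.min'_le j hj') hne.symm
      have hmem := ih ((S.erase i).erase j).card (by
        rw [Finset.card_erase_of_mem hj, Finset.card_erase_of_mem hi, ← hN]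
        have := Finset.card_pos.mpr hS
        omega) (hc.contract hi hj' hne) rfl
      have hle : (Submodule.span ℚ (matchingFunctions ((S.erase i).erase j))).map
          (LinearMap.mulLeft ℚ fun f : V → SpIdx 1 => omegaCoeff 1 (f i) (f j)) ≤
          Submodule.span ℚ (matchingFunctions S) := by
        rw [Submodule.map_span]
        refine Submodule.span_mono ?_
        rintro _ ⟨F, hF, rfl⟩
        exact mul_mem_matchingFunctions hi hj' hlt hF
      exact hle ⟨_, hmem, rfl⟩

end

theorem matchingFunctions_subset_range {n : ℕ} {c : (Fin (2 * n) → SpIdx 1) → ℚ}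
    (hc : c ∈ Submodule.span ℚ (matchingFunctions (Finset.univ : Finset (Fin (2 * n))))) :
    ∃ v : ChordDiagram n → ℚ, ∀ f, c f = ∑ C, v C * chordCoeff 1 C f := by
  classical
  induction hc using Submodule.span_induction with
  | mem F hF =>
    obtain ⟨σ, h1, h2, -, rfl⟩ := hF
    let C : ChordDiagram n := ⟨σ, fun i => ⟨h1 i, h2 i (Finset.mem_univ _)⟩⟩
    refine ⟨Pi.single C C.sgn, fun f => ?_⟩
    rw [Finset.sum_eq_single C]
    · rw [Pi.single_eq_same, chordCoeff, ← mul_assoc, C.sgn_mul_self, one_mul]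
    · intro C' _ h
      rw [Pi.single_eq_of_ne h, zero_mul]
    · simp
  | zero => exact ⟨0, by simp⟩
  | add F G _ _ hF hG =>
    obtain ⟨v, hv⟩ := hF
    obtain ⟨w, hw⟩ := hG
    exact ⟨v + w, fun f => by simp [hv, hw, add_mul, Finset.sum_add_distrib]⟩
  | smul r F _ hF =>
    obtain ⟨v, hv⟩ := hF
    exact ⟨r • v, fun f => by simp [hv, Finset.mul_sum, mul_assoc]⟩

/-! ### The symplectic action in coordinates -/

theorem tensorAct_toTensorAlgebra (A : Matrix (SpIdx g) (SpIdx g) ℚ) {N : ℕ}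
    (t : ⨂[ℚ]^N (HQ g)) : tensorAct g A (TensorPower.toTensorAlgebra t) =
      TensorPower.toTensorAlgebra (PiTensorProduct.map (fun _ => Matrix.toLin' A) t) := by
  induction t using PiTensorProduct.induction_on with
  | smul_tprod r v =>
    simp only [map_smul, PiTensorProduct.map_tprod, TensorPower.toTensorAlgebra_tprod,
      TensorAlgebra.tprod_apply, map_list_prod, List.map_ofFn]
    congr 3
    funext i
    simp [tensorAct]
  | add s t hs ht => simp only [map_add, hs, ht]

theorem repr_map_toLin' (A : Matrix (SpIdx g) (SpIdx g) ℚ) {N : ℕ} (t : ⨂[ℚ]^N (HQ g))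
    (f : Fin N → SpIdx g) :
    (tensorBasis g N).repr (PiTensorProduct.map (fun _ => Matrix.toLin' A) t) f =
      ∑ f', (∏ i, A (f i) (f' i)) * (tensorBasis g N).repr t f' := by
  classical
  conv_lhs => rw [← (tensorBasis g N).sum_repr t]
  simp only [map_sum, map_smul, Finsupp.finsetSum_apply, Finsupp.smul_apply, smul_eq_mul]
  refine Finset.sum_congr rfl fun f' _ => ?_
  rw [tensorBasis_apply, PiTensorProduct.map_tprod, mul_comm]
  congr 1
  rw [tensorBasis, Basis.piTensorProduct_repr_tprod_apply]
  simp [basisVec]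

/-! ### Tensors of chord diagrams are invariant -/

/-- A sum over colourings of a product over chords is the product over the chords of the sums over
the colourings of the two ends. -/
theorem ChordDiagram.sum_prod_chords {n : ℕ} (C : ChordDiagram n) {α : Type*} [Fintype α]
    (G : Fin (2 * n) → α → α → ℚ) :
    ∑ f : Fin (2 * n) → α, ∏ i ∈ Finset.univ.filter (fun i => i < C.1 i), G i (f i) (f (C.1 i)) =
      ∏ i ∈ Finset.univ.filter (fun i => i < C.1 i), ∑ a, ∑ b, G i a b := by
  classical
  have h : ∀ i, ∑ a, ∑ b, G i a b = ∑ p : α × α, G i p.1 p.2 := fun i =>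
    (Fintype.sum_prod_type' (f := G i)).symm
  simp only [h]
  rw [Finset.prod_subtype (p := fun i => i < C.1 i) _ (by simp), Finset.prod_univ_sum,
    Fintype.piFinset_univ]
  let e : (Fin (2 * n) → α) ≃ ({i // i < C.1 i} → α × α) :=
    { toFun := fun f i => (f i.1, f (C.1 i.1))
      invFun := fun p i => if hi : i < C.1 i then (p ⟨i, hi⟩).1 else
        (p ⟨C.1 i, by rw [C.apply_apply]; exact (C.not_lt_iff i).mp hi⟩).2
      left_inv := fun f => by
        funext i
        by_cases hi : i < C.1 i
        · simp [hi]
        · simp [hi]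
      right_inv := fun p => by
        funext i
        have h1 := i.2
        have h2 : ¬ C.1 i.1 < C.1 (C.1 i.1) := by rw [C.apply_apply]; exact h1.not_gt
        apply Prod.ext
        · simp only [h1, dif_pos]
        · simp only [h2, dif_neg, not_false_eq_true]
          congr 2
          exact Subtype.ext (C.apply_apply i.1) }
  refine Fintype.sum_equiv e _ _ fun f => ?_
  rw [Finset.prod_subtype (p := fun i => i < C.1 i) _ (by simp)]
  rfl

theorem ChordDiagram.prod_eq_prod_chords {n : ℕ} (C : ChordDiagram n) (F : Fin (2 * n) → ℚ) :
    ∏ i, F i = ∏ i ∈ Finset.univ.filter (fun i => i < C.1 i), F i * F (C.1 i) := by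
  rw [← Finset.prod_filter_mul_prod_filter_not Finset.univ (fun i => i < C.1 i),
    Finset.prod_mul_distrib]
  congr 1
  refine (Finset.prod_equiv C.1 (fun i => ?_) fun i _ => rfl).symm
  simp only [Finset.mem_filter, Finset.mem_univ, true_and, C.apply_apply]
  constructor
  · exact fun h => h.not_gt
  · intro h
    have := (C.not_lt_iff (C.1 i)).mp (by rwa [C.apply_apply])
    rwa [C.apply_apply] at this

theorem map_chordTensor (A : Sp g) {n : ℕ} (C : ChordDiagram n) :
    PiTensorProduct.map (fun _ => Matrix.toLin' A.1) (chordTensor g C) = chordTensor g C := by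
  apply (tensorBasis g (2 * n)).repr.injective
  ext f
  rw [repr_map_toLin']
  simp only [repr_chordTensor, chordCoeff]
  have h : ∀ f' : Fin (2 * n) → SpIdx g, (∏ i, A.1 (f i) (f' i)) * (C.sgn *
      ∏ i ∈ Finset.univ.filter (fun i => i < C.1 i), omegaCoeff g (f' i) (f' (C.1 i))) =
      C.sgn * ∏ i ∈ Finset.univ.filter (fun i => i < C.1 i),
        (fun i a b => A.1 (f i) a * omegaCoeff g a b * A.1 (f (C.1 i)) b) i (f' i)
          (f' (C.1 i)) := by
    intro f'
    rw [C.prod_eq_prod_chords fun i => A.1 (f i) (f' i), mul_left_comm, ← Finset.prod_mul_distrib]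
    congr 1
    exact Finset.prod_congr rfl fun i _ => by ring
  rw [Finset.sum_congr rfl fun f' _ => h f', ← Finset.mul_sum]
  refine congrArg (C.sgn * ·) ((C.sum_prod_chords fun i a b =>
    A.1 (f i) a * omegaCoeff g a b * A.1 (f (C.1 i)) b).trans ?_)
  refine Finset.prod_congr rfl fun i _ => ?_
  have := congrFun (congrFun (symplectic_omegaMat A) (f i)) (f (C.1 i))
  simp only [Matrix.mul_apply, Finset.sum_mul, Matrix.transpose_apply, omegaMat,
    Matrix.of_apply] at this
  rw [← this, Finset.sum_comm]

theorem map_Phi (A : Sp g) {n : ℕ} (v : ChordDiagram n → ℚ) :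
    PiTensorProduct.map (fun _ => Matrix.toLin' A.1) (Phi g n v) = Phi g n v := by
  simp only [Phi, Fintype.linearCombination_apply, map_sum, map_smul, map_chordTensor]

/-! ### Elements of `Sp(2, ℚ)` -/

theorem mem_symplecticGroup_one_of_det {A : Matrix (SpIdx 1) (SpIdx 1) ℚ} (h : A.det = 1) :
    A ∈ Matrix.symplecticGroup (Fin 1) ℚ := by
  have hd : A.det = A (Sum.inl 0) (Sum.inl 0) * A (Sum.inr 0) (Sum.inr 0) -
      A (Sum.inl 0) (Sum.inr 0) * A (Sum.inr 0) (Sum.inl 0) := by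
    rw [← Matrix.det_reindex_self finSumFinEquiv, Matrix.det_fin_two]
    rfl
  rw [hd] at h
  rw [SymplecticGroup.mem_iff]
  ext a b
  rcases a with a | a <;> rcases b with b | b <;>
    simp [Matrix.mul_apply, Matrix.J, Subsingleton.elim a 0, Subsingleton.elim b 0] <;> linarith

theorem exists_transvection (a : SpIdx 1) (s : ℚ) : ∃ A : Sp 1, ∀ b c,
    A.1 b c = (if b = c then 1 else 0) + s * (if b = a ∧ c = a.swap then 1 else 0) := by
  refine ⟨⟨Matrix.transvection a a.swap s, mem_symplecticGroup_one_of_det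
    (Matrix.det_transvection_of_ne _ _ (swap_ne a).symm _)⟩, fun b c => ?_⟩
  simp only [Matrix.transvection, Matrix.add_apply, Matrix.one_apply, Matrix.single_apply]
  congr 1
  by_cases h : a = b ∧ a.swap = c
  · rw [if_pos h, if_pos ⟨h.1.symm, h.2.symm⟩, mul_one]
  · rw [if_neg h, if_neg fun h' => h ⟨h'.1.symm, h'.2.symm⟩, mul_zero]

/-- The element `diag(2, 1/2)` of `Sp(2, ℚ)`. -/
def torus : Sp 1 :=
  ⟨Matrix.diagonal (Sum.elim (fun _ => 2) fun _ => 1 / 2), mem_symplecticGroup_one_of_det (by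
    rw [Matrix.det_diagonal]; simp)⟩

/-! ### Invariants under `Sp(2, ℚ)` -/

theorem slInvariant_repr {N : ℕ} {t : ⨂[ℚ]^N (HQ 1)}
    (ht : ∀ A : Sp 1, PiTensorProduct.map (fun _ => Matrix.toLin' A.1) t = t) :
    SlInvariant Finset.univ fun f => (tensorBasis 1 N).repr t f := by
  have key : ∀ (A : Sp 1) f, ∑ f', (∏ i, A.1 (f i) (f' i)) * (tensorBasis 1 N).repr t f' =
      (tensorBasis 1 N).repr t f := by
    intro A f
    rw [← repr_map_toLin', ht]
  refine ⟨fun f f' h => ?_, fun f hf => ?_, fun a f => ?_⟩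
  · rw [show f = f' from funext fun i => h i (Finset.mem_univ _)]
  · have h1 := key torus f
    have h2 : ∀ f', (∏ i, torus.1 (f i) (f' i)) =
        if f = f' then (∏ i, if f i = Sum.inl 0 then (2 : ℚ) else 1 / 2) else 0 := by
      intro f'
      by_cases h : f = f'
      · subst h
        rw [if_pos rfl]
        refine Finset.prod_congr rfl fun i _ => ?_
        rcases f i with a | a <;> simp [torus, Subsingleton.elim a 0]
      · rw [if_neg h]
        obtain ⟨i, hi⟩ := Function.ne_iff.mp h
        exact Finset.prod_eq_zero (Finset.mem_univ i) (Matrix.diagonal_apply_ne _ hi)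
    simp only [h2, ite_mul, zero_mul, Finset.sum_ite_eq, Finset.mem_univ, if_true] at h1
    rw [mul_eq_right₀ hf, Finset.prod_ite, Finset.prod_const, Finset.prod_const, one_div,
      inv_pow, mul_inv_eq_one₀ (by positivity)] at h1
    have h3 := pow_right_injective₀ (by norm_num : (0 : ℚ) < 2) (by norm_num) h1
    have h4 : (Finset.univ.filter fun i => ¬f i = Sum.inl 0) =
        Finset.univ.filter fun i => f i = Sum.inr 0 := by
      refine Finset.filter_congr fun i _ => ?_
      rcases f i with a | a <;> simp [Subsingleton.elim a 0]
    rw [h4] at h3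
    rintro (a | a) <;> rw [Subsingleton.elim a 0]
    · exact h3
    · exact h3.symm
  · -- compare the coefficients of `s` in the invariance under the transvections
    let P : ℚ[X] := ∑ f', (∏ i, (Polynomial.C (if f i = f' i then 1 else 0) +
      Polynomial.X * Polynomial.C (if f i = a ∧ f' i = a.swap then 1 else 0))) *
        Polynomial.C ((tensorBasis 1 N).repr t f')
    have hP : P = Polynomial.C ((tensorBasis 1 N).repr t f) := by
      refine Polynomial.funext fun s => ?_
      obtain ⟨A, hA⟩ := exists_transvection a s
      rw [Polynomial.eval_C, ← key A f]
      simp only [P, Polynomial.eval_finsetSum, Polynomial.eval_mul, Polynomial.eval_prod,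
        Polynomial.eval_add, Polynomial.eval_C, Polynomial.eval_X, hA]
    have hd := congrArg (fun p => Polynomial.eval 0 (Polynomial.derivative p)) hP
    simp only [P, Polynomial.derivative_C, Polynomial.eval_zero, Polynomial.derivative_sum,
      Polynomial.derivative_mul, Polynomial.derivative_prod_finset, Polynomial.derivative_add,
      Polynomial.derivative_X, Polynomial.eval_finsetSum, Polynomial.eval_mul,
      Polynomial.eval_prod, Polynomial.eval_add, Polynomial.eval_C, Polynomial.eval_X, mul_zero,
      zero_mul, add_zero, zero_add, one_mul, Finset.sum_mul] at hd
    rw [Finset.sum_comm] at hd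
    rw [Finset.sum_filter]
    refine Eq.trans (Finset.sum_congr rfl fun i _ => ?_) hd
    by_cases hi : f i = a
    · rw [if_pos hi, Finset.sum_eq_single (Function.update f i a.swap)]
      · rw [Finset.prod_eq_one, if_pos ⟨hi, by simp⟩]
        · simp
        · intro j hj
          rw [if_pos]
          simp [Finset.ne_of_mem_erase hj]
      · intro f' _ hf'
        by_cases h : f' i = a.swap
        · obtain ⟨j, hj⟩ := Function.ne_iff.mp hf'
          have hji : j ≠ i := by rintro rfl; exact hj (by simp [h])
          rw [Finset.prod_eq_zero (Finset.mem_erase.mpr ⟨hji, Finset.mem_univ _⟩)]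
          · simp
          · rw [if_neg]
            intro h'
            exact hj (by simp [hji, h'])
        · rw [if_neg fun h' => h h'.2]; simp
      · simp
    · rw [if_neg hi]
      symm
      refine Finset.sum_eq_zero fun f' _ => ?_
      rw [if_neg fun h' => hi h'.1, mul_zero, zero_mul]

/-- The first fundamental theorem of invariant theory for `Sp(2, ℚ)`: every invariant tensor is a
combination of the tensors of chord diagrams. -/
theorem exists_Phi_eq {n : ℕ} {t : ⨂[ℚ]^(2 * n) (HQ 1)}
    (ht : ∀ A : Sp 1, PiTensorProduct.map (fun _ => Matrix.toLin' A.1) t = t) :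
    ∃ v : ChordDiagram n → ℚ, Phi 1 n v = t := by
  obtain ⟨v, hv⟩ := matchingFunctions_subset_range (slInvariant_repr ht).mem_span
  refine ⟨v, (tensorBasis 1 (2 * n)).repr.injective ?_⟩
  ext f
  rw [repr_Phi, ← hv]

/-! ### The invariant part of the Lie algebra in genus one -/

theorem map_sympDerInv_eq (k : ℕ) : (sympDerInv 1 (2 * k)).map (derToTensor 1) =
    (HLam 1 (k + 1) (oneRow (k + 1))).map TensorPower.toTensorAlgebra := by
  obtain ⟨θ', hE, hθ⟩ := InducedByChords.cycSum_mul_onePAct (n := k + 1) (2 * (k + 1) - 2)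
  apply le_antisymm
  · rintro _ ⟨D, ⟨hD, hinv⟩, rfl⟩
    obtain ⟨t, ht⟩ := exists_tensor_of_sympDer hD
    have hAt : ∀ A : Sp 1, PiTensorProduct.map (fun _ => Matrix.toLin' A.1) t = t := by
      intro A
      apply toTensorAlgebra_injective
      rw [← tensorAct_toTensorAlgebra, ht, ← tensorRep_apply, ← derToTensor_conjDer, hinv A]
    obtain ⟨v, hv⟩ := exists_Phi_eq (n := k + 1) hAt
    obtain ⟨w, hw, hwv⟩ := exists_mem_eigenspace_Phi_eq v
    have hsym := symmetrize_eq_smul hD ht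
    refine ⟨t, ?_, ht⟩
    have hne : (((2 * k + 1 : ℕ) * (2 * k + 2 : ℕ) : ℚ)) ≠ 0 := by positivity
    have ht' : t = (((2 * k + 1 : ℕ) * (2 * k + 2 : ℕ) : ℚ))⁻¹ •
        (cycSum 1 (2 * k + 2) * onePAct 1 (2 * k + 2) (2 * k)) t := by
      rw [hsym, smul_smul, inv_mul_cancel₀ hne, one_smul]
    rw [ht']
    exact Submodule.smul_mem _ _ ⟨t, ⟨w, hw, hwv.trans hv⟩, rfl⟩
  · rintro _ ⟨_, ⟨_, ⟨w, hw, rfl⟩, rfl⟩, rfl⟩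
    obtain ⟨D, hD, hDt⟩ := exists_sympDer_of_symmetrize (m := 2 * k) (Phi 1 (k + 1) w)
    refine ⟨D, ⟨hD, fun A => ?_⟩, hDt⟩
    have hmem : derRep 1 A D - D ∈ (sympDer 1 (2 * k)).toSubmodule :=
      Submodule.sub_mem _ ((sympDer 1 (2 * k)).apply_mem_toSubmodule A hD) hD
    refine sub_eq_zero.mp (derToTensor_eq_zero hmem ?_)
    have hDt' : derToTensor 1 D = TensorPower.toTensorAlgebra (Phi 1 (k + 1) (θ' w)) := by
      rw [← hθ]; exact hDt
    rw [map_sub, derToTensor_conjDer, hDt', tensorRep_apply, tensorAct_toTensorAlgebra, map_Phi,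
      sub_self]

theorem exists_equiv_HLam (k : ℕ) (hg : 1 ≤ g) :
    ∃ e : sympDerInv 1 (2 * k) ≃ₗ[ℚ] HLam g (k + 1) (oneRow (k + 1)),
      ∀ D : sympDerInv 1 (2 * k),
        TensorPower.toTensorAlgebra (PiTensorProduct.map (fun _ => projOne g hg) (e D).1) =
          derToTensor 1 D.1 := by
  obtain ⟨θ', hE, hθ⟩ := InducedByChords.cycSum_mul_onePAct (n := k + 1) (2 * (k + 1) - 2)
  let α : sympDerInv 1 (2 * k) →ₗ[ℚ] TA 1 := derToTensor 1 ∘ₗ (sympDerInv 1 (2 * k)).subtype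
  let β : HLam g (k + 1) (oneRow (k + 1)) →ₗ[ℚ] TA 1 := TensorPower.toTensorAlgebra ∘ₗ
    PiTensorProduct.map (fun _ => projOne g hg) ∘ₗ (HLam g (k + 1) (oneRow (k + 1))).subtype
  have hα : Function.Injective α := by
    rw [← LinearMap.ker_eq_bot, LinearMap.ker_eq_bot']
    rintro ⟨D, hD⟩ h
    exact Subtype.ext (derToTensor_eq_zero hD.1 h)
  have hβ : Function.Injective β := by
    rintro ⟨_, ⟨_, ⟨w, hw, rfl⟩, rfl⟩⟩ ⟨_, ⟨_, ⟨w', hw', rfl⟩, rfl⟩⟩ h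
    have h1 : PiTensorProduct.map (fun _ => projOne g hg) ((cycSum g (2 * (k + 1)) *
        onePAct g (2 * (k + 1)) (2 * (k + 1) - 2)) (Phi g (k + 1) w)) =
        PiTensorProduct.map (fun _ => projOne g hg) ((cycSum g (2 * (k + 1)) *
        onePAct g (2 * (k + 1)) (2 * (k + 1) - 2)) (Phi g (k + 1) w')) :=
      toTensorAlgebra_injective h
    rw [hθ, hθ, map_projOne_Phi, map_projOne_Phi] at h1
    have h2 : θ' w - θ' w' = 0 :=
      eq_zero_of_Phi_eq_zero (Submodule.sub_mem _ (hE _ w hw) (hE _ w' hw'))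
        (by rw [map_sub, h1, sub_self])
    apply Subtype.ext
    change (cycSum g (2 * (k + 1)) *
        onePAct g (2 * (k + 1)) (2 * (k + 1) - 2)) (Phi g (k + 1) w) = (cycSum g (2 * (k + 1)) *
        onePAct g (2 * (k + 1)) (2 * (k + 1) - 2)) (Phi g (k + 1) w')
    rw [hθ, hθ, sub_eq_zero.mp h2]
  have hrange : LinearMap.range α = LinearMap.range β := by
    have h1 : LinearMap.range α = (sympDerInv 1 (2 * k)).map (derToTensor 1) := by
      rw [LinearMap.range_comp, Submodule.range_subtype]
    rw [h1, map_sympDerInv_eq]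
    have h2 : (HLam g (k + 1) (oneRow (k + 1))).map (PiTensorProduct.map fun _ => projOne g hg) =
        HLam 1 (k + 1) (oneRow (k + 1)) := by
      apply le_antisymm
      · rintro _ ⟨_, ⟨_, ⟨w, hw, rfl⟩, rfl⟩, rfl⟩
        refine ⟨_, ⟨w, hw, rfl⟩, ?_⟩
        rw [hθ, hθ, map_projOne_Phi]
      · rintro _ ⟨_, ⟨w, hw, rfl⟩, rfl⟩
        refine ⟨_, ⟨_, ⟨w, hw, rfl⟩, rfl⟩, ?_⟩
        rw [hθ, hθ, map_projOne_Phi]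
    rw [LinearMap.range_comp, LinearMap.range_comp, Submodule.range_subtype, h2]
  refine ⟨(LinearEquiv.ofInjective α hα).trans ((LinearEquiv.ofEq _ _ hrange).trans
    (LinearEquiv.ofInjective β hβ).symm), fun D => ?_⟩
  have h := (LinearEquiv.ofInjective β hβ).apply_symm_apply
    (LinearEquiv.ofEq _ _ hrange (LinearEquiv.ofInjective α hα D))
  exact congrArg Subtype.val h

/-! ### Polynomials and tensors as representations of `Sp(2, ℚ)` -/

theorem polyRep_apply (A : Sp g) (p : MvPolynomial (SpIdx g) ℚ) :
    polyRep g A p = polyAct g A.1 p := rfl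

theorem polyAct_X (A : Matrix (SpIdx g) (SpIdx g) ℚ) (a : SpIdx g) :
    polyAct g A (MvPolynomial.X a) = ∑ b, A b a • MvPolynomial.X b := by
  rw [polyAct, MvPolynomial.aeval_X]

/-- The chain rule. -/
theorem pderiv_polyAct (A : Matrix (SpIdx g) (SpIdx g) ℚ) (a : SpIdx g)
    (p : MvPolynomial (SpIdx g) ℚ) : MvPolynomial.pderiv a (polyAct g A p) =
      ∑ b, A a b • polyAct g A (MvPolynomial.pderiv b p) := by
  induction p using MvPolynomial.induction_on with
  | C r => simp [polyAct]
  | add p q hp hq => simp only [map_add, hp, hq, smul_add, Finset.sum_add_distrib]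
  | mul_X p c hp =>
    have h1 : MvPolynomial.pderiv a (polyAct g A (MvPolynomial.X c)) =
        algebraMap ℚ (MvPolynomial (SpIdx g) ℚ) (A a c) := by
      rw [polyAct_X, map_sum, Finset.sum_eq_single a]
      · rw [Derivation.map_smul, MvPolynomial.pderiv_X_self, Algebra.smul_def, mul_one]
      · intro b _ hb
        rw [Derivation.map_smul, MvPolynomial.pderiv_X_of_ne hb, smul_zero]
      · simp
    have h2 : ∑ b, A a b • (polyAct g A p * polyAct g A (MvPolynomial.pderiv b
        (MvPolynomial.X c))) = polyAct g A p * algebraMap ℚ _ (A a c) := by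
      rw [Finset.sum_eq_single c]
      · rw [MvPolynomial.pderiv_X_self, map_one, mul_one, Algebra.smul_def, mul_comm]
      · intro b _ hb
        rw [MvPolynomial.pderiv_X_of_ne hb.symm, map_zero, mul_zero, smul_zero]
      · simp
    rw [map_mul, Derivation.leibniz, hp, h1]
    simp only [Derivation.leibniz, map_add, smul_add, Finset.sum_add_distrib, smul_eq_mul, map_mul,
      h2, Finset.mul_sum, mul_smul_comm]

/-- Multiplication of `φ (∂ q)` by the invariant element `∑ e_a ⊗ ∂_a`. -/
def derivIntertwiner (φ : (polyRep g).IntertwiningMap (tensorRep g)) :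
    (polyRep g).IntertwiningMap (tensorRep g) where
  toLinearMap := ∑ a, LinearMap.mulLeft ℚ (letter g a) ∘ₗ φ.toLinearMap ∘ₗ
    (MvPolynomial.pderiv a).toLinearMap
  isIntertwining' A := by
    refine LinearMap.ext fun q => ?_
    have hφ : ∀ q, φ.toLinearMap (polyAct g A.1 q) = tensorAct g A.1 (φ.toLinearMap q) :=
      fun q => Representation.IntertwiningMap.isIntertwining _ _ φ A q
    simp only [LinearMap.comp_apply, LinearMap.sum_apply, LinearMap.mulLeft_apply, polyRep_apply,
      tensorRep_apply, Derivation.coeFn_coe, pderiv_polyAct, map_sum, map_smul, hφ, map_mul,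
      tensorAct_letter, Finset.sum_mul, smul_mul_assoc]
    rw [Finset.sum_comm]

theorem sum_comm_reverse {ι M : Type*} [Fintype ι] [AddCommMonoid M] (F : ι → ι → ι → ι → M) :
    ∑ c, ∑ d, ∑ b, ∑ a, F c d b a = ∑ a, ∑ b, ∑ d, ∑ c, F c d b a := by
  rw [Finset.sum_comm, Finset.sum_congr rfl fun d _ => Finset.sum_comm, Finset.sum_comm,
    Finset.sum_congr rfl fun b _ => Finset.sum_congr rfl fun d _ => Finset.sum_comm,
    Finset.sum_congr rfl fun b _ => Finset.sum_comm, Finset.sum_comm]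

/-- Multiplication of `φ (X q)` by the invariant element `∑ ω_{ab} e_a ⊗ X_b`. -/
def omegaIntertwiner (φ : (polyRep g).IntertwiningMap (tensorRep g)) :
    (polyRep g).IntertwiningMap (tensorRep g) where
  toLinearMap := ∑ a, ∑ b, omegaCoeff g a b • LinearMap.mulLeft ℚ (letter g a) ∘ₗ
    φ.toLinearMap ∘ₗ LinearMap.mulLeft ℚ (MvPolynomial.X b)
  isIntertwining' A := by
    refine LinearMap.ext fun q => ?_
    have hφ : ∀ q, φ.toLinearMap (polyAct g A.1 q) = tensorAct g A.1 (φ.toLinearMap q) :=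
      fun q => Representation.IntertwiningMap.isIntertwining _ _ φ A q
    have hω : ∀ c d, omegaCoeff g c d = ∑ b, ∑ a, A.1 c a * omegaCoeff g a b * A.1 d b := by
      intro c d
      have := congrFun (congrFun (symplectic_omegaMat A) c) d
      simp only [Matrix.mul_apply, Finset.sum_mul, Matrix.transpose_apply, omegaMat,
        Matrix.of_apply] at this
      exact this.symm
    simp only [LinearMap.comp_apply, LinearMap.sum_apply, LinearMap.mulLeft_apply, polyRep_apply,
      LinearMap.smul_apply, tensorRep_apply, map_sum, map_smul, ← hφ, map_mul, tensorAct_letter,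
      polyAct_X, Finset.mul_sum, Finset.sum_mul, smul_mul_assoc, mul_smul_comm, Finset.smul_sum,
      smul_smul]
    have h1 : ∀ c d, omegaCoeff g c d • (letter g c * φ.toLinearMap
        (MvPolynomial.X d * polyAct g A.1 q)) = ∑ b, ∑ a, (A.1 c a * omegaCoeff g a b * A.1 d b) •
          (letter g c * φ.toLinearMap (MvPolynomial.X d * polyAct g A.1 q)) := by
      intro c d
      conv_lhs => rw [hω c d]
      simp only [Finset.sum_smul]
    simp only [h1]
    rw [sum_comm_reverse]
    refine Finset.sum_congr rfl fun a _ => Finset.sum_congr rfl fun b _ =>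
      Finset.sum_congr rfl fun d _ => Finset.sum_congr rfl fun c _ => ?_
    congr 1
    ring

theorem letter_mul_intertwiner (φ : (polyRep 1).IntertwiningMap (tensorRep 1)) (a : SpIdx 1)
    {m : ℕ} {p : MvPolynomial (SpIdx 1) ℚ} (hp : p.IsHomogeneous m) :
    ((m : ℚ) + 1) • (letter 1 a * φ p) = derivIntertwiner φ (MvPolynomial.X a * p) +
      ∑ b, omegaCoeff 1 a b • omegaIntertwiner φ (MvPolynomial.pderiv b p) := by
  have hE := hp.sum_X_mul_pderiv
  have hsum : ((m : ℚ) + 1) • p = p + ∑ i, MvPolynomial.X i * MvPolynomial.pderiv i p := by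
    rw [hE, add_smul, one_smul, Nat.cast_smul_eq_nsmul, add_comm]
  rw [← mul_smul_comm, ← map_smul, hsum]
  have hD : ∀ q, derivIntertwiner φ q = ∑ a, letter 1 a * φ (MvPolynomial.pderiv a q) := by
    intro q
    change (derivIntertwiner φ).toLinearMap q = _
    simp [derivIntertwiner]
  have hB : ∀ q, omegaIntertwiner φ q = ∑ a, ∑ b, omegaCoeff 1 a b •
      (letter 1 a * φ (MvPolynomial.X b * q)) := by
    intro q
    change (omegaIntertwiner φ).toLinearMap q = _
    simp [omegaIntertwiner]
  simp only [hD, hB]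
  rcases a with a | a <;>
  · rw [Subsingleton.elim a 0]
    simp [omegaCoeff, Derivation.leibniz, mul_add, MvPolynomial.pderiv_X]
    abel

/-- The span of the images of the intertwining maps from polynomials to tensors. -/
def polySpan : Submodule ℚ (TA 1) :=
  Submodule.span ℚ {t | ∃ (φ : (polyRep 1).IntertwiningMap (tensorRep 1)) (m : ℕ)
    (p : MvPolynomial (SpIdx 1) ℚ), p.IsHomogeneous m ∧ φ p = t}

theorem intertwiner_mem_polySpan (φ : (polyRep 1).IntertwiningMap (tensorRep 1))
    (p : MvPolynomial (SpIdx 1) ℚ) : φ p ∈ polySpan := by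
  rw [← MvPolynomial.sum_homogeneousComponent p, map_sum]
  exact Submodule.sum_mem _ fun i _ => Submodule.subset_span
    ⟨φ, i, _, MvPolynomial.homogeneousComponent_isHomogeneous i p, rfl⟩

theorem one_mem_polySpan : (1 : TA 1) ∈ polySpan := by
  let φ : (polyRep 1).IntertwiningMap (tensorRep 1) :=
    { toLinearMap := LinearMap.toSpanSingleton ℚ (TA 1) 1 ∘ₗ
        (MvPolynomial.aeval fun _ => (0 : ℚ)).toLinearMap
      isIntertwining' := fun A => by
        have h : (MvPolynomial.aeval fun _ => (0 : ℚ)).comp (polyAct 1 A.1) =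
            MvPolynomial.aeval fun _ => (0 : ℚ) := by
          ext a
          simp [polyAct]
        refine LinearMap.ext fun q => ?_
        have hq := congrArg (fun f => f q) h
        simp only [AlgHom.comp_apply] at hq
        simp only [LinearMap.comp_apply, AlgHom.toLinearMap_apply, polyRep_apply, hq,
          LinearMap.toSpanSingleton_apply, map_smul, tensorRep_apply, map_one] }
  have h : φ 1 = 1 := by
    change φ.toLinearMap 1 = 1
    simp [φ]
  rw [← h]
  exact intertwiner_mem_polySpan φ 1

theorem letter_mul_mem_polySpan (a : SpIdx 1) {t : TA 1} (ht : t ∈ polySpan) :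
    letter 1 a * t ∈ polySpan := by
  induction ht using Submodule.span_induction with
  | mem t ht =>
    obtain ⟨φ, m, p, hp, rfl⟩ := ht
    have hne : (m : ℚ) + 1 ≠ 0 := by positivity
    rw [← inv_smul_smul₀ hne (letter 1 a * φ p), letter_mul_intertwiner φ a hp]
    exact Submodule.smul_mem _ _ (Submodule.add_mem _ (intertwiner_mem_polySpan _ _)
      (Submodule.sum_mem _ fun b _ => Submodule.smul_mem _ _ (intertwiner_mem_polySpan _ _)))
  | zero => rw [mul_zero]; exact Submodule.zero_mem _
  | add s t _ _ hs ht => rw [mul_add]; exact Submodule.add_mem _ hs ht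
  | smul r t _ ht => rw [mul_smul_comm]; exact Submodule.smul_mem _ _ ht

/-- The tensor algebra is a sum of images of symmetric powers. -/
theorem polySpan_eq_top : polySpan = ⊤ := by
  rw [eq_top_iff, ← span_word, Submodule.span_le]
  rintro _ ⟨l, rfl⟩
  induction l with
  | nil => rw [word_nil]; exact one_mem_polySpan
  | cons a l ih => rw [word_cons]; exact letter_mul_mem_polySpan a ih

/-! ### The symmetric powers are irreducible -/

/-- A vector of an invariant subspace which is a sum of eigenvectors with distinct eigenvalues has
its components in the subspace. -/
theorem mem_of_sum_eigenvectors {ι V : Type*} [AddCommGroup V] [Module ℚ V] (T : Module.End ℚ V)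
    {U : Submodule ℚ V} (hU : ∀ u ∈ U, T u ∈ U) (s : Finset ι) (c : ι → ℚ)
    (hc : Set.InjOn c s) (v : ι → V) (hv : ∀ i ∈ s, T (v i) = c i • v i)
    (hsum : ∑ i ∈ s, v i ∈ U) : ∀ i ∈ s, v i ∈ U := by
  classical
  induction s using Finset.induction_on generalizing v with
  | empty => simp
  | insert a s ha ih =>
    have h1 : ∑ i ∈ s, (c i - c a) • v i ∈ U := by
      have h2 := Submodule.sub_mem _ (hU _ hsum) (Submodule.smul_mem _ (c a) hsum)
      rw [map_sum, Finset.smul_sum, ← Finset.sum_sub_distrib, Finset.sum_insert ha,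
        hv a (Finset.mem_insert_self _ _), sub_self, zero_add] at h2
      rwa [Finset.sum_congr rfl fun i hi => by
        rw [hv i (Finset.mem_insert_of_mem hi), ← sub_smul]] at h2
    have h2 : ∀ i ∈ s, v i ∈ U := by
      intro i hi
      have h3 := ih (hc.mono (by simp)) (fun i => (c i - c a) • v i) (fun i hi => by
        simp only [map_smul, hv i (Finset.mem_insert_of_mem hi), smul_smul, mul_comm]) h1 i hi
      have hne : c i - c a ≠ 0 := by
        rw [sub_ne_zero]
        intro h
        have := hc (by simp [hi]) (by simp) h
        exact ha (this ▸ hi)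
      have := Submodule.smul_mem U (c i - c a)⁻¹ h3
      rwa [inv_smul_smul₀ hne] at this
    intro i hi
    rcases Finset.mem_insert.mp hi with rfl | hi
    · rw [Finset.sum_insert ha] at hsum
      have := Submodule.sub_mem _ hsum (Submodule.sum_mem _ h2)
      rwa [add_sub_cancel_right] at this
    · exact h2 i hi

/-- The monomial `x^a y^b`. -/
def mon (a b : ℕ) : MvPolynomial (SpIdx 1) ℚ :=
  MvPolynomial.X (Sum.inl 0) ^ a * MvPolynomial.X (Sum.inr 0) ^ b

theorem polyAct_torus_mon (a b : ℕ) :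
    polyAct 1 torus.1 (mon a b) = ((2 : ℚ) ^ a / 2 ^ b) • mon a b := by
  have hx : polyAct 1 torus.1 (MvPolynomial.X (Sum.inl 0)) =
      (2 : ℚ) • MvPolynomial.X (Sum.inl 0) := by
    rw [polyAct_X]; simp [torus]
  have hy : polyAct 1 torus.1 (MvPolynomial.X (Sum.inr 0)) =
      (1 / 2 : ℚ) • MvPolynomial.X (Sum.inr 0) := by
    rw [polyAct_X]; simp [torus]
  rw [mon, map_mul, map_pow, map_pow, hx, hy, smul_pow, smul_pow, smul_mul_smul_comm, one_div,
    inv_pow, div_eq_mul_inv]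

theorem monomial_eq_mon (d : SpIdx 1 →₀ ℕ) (c : ℚ) :
    MvPolynomial.monomial d c = c • mon (d (Sum.inl 0)) (d (Sum.inr 0)) := by
  rw [MvPolynomial.monomial_eq, Finsupp.prod_fintype _ _ (by simp), Fintype.prod_sum_type,
    MvPolynomial.smul_eq_C_mul, mon]
  simp

theorem degree_eq_of_mem_support {m : ℕ} {p : MvPolynomial (SpIdx 1) ℚ} (hp : p.IsHomogeneous m)
    {d : SpIdx 1 →₀ ℕ} (hd : d ∈ p.support) : d (Sum.inl 0) + d (Sum.inr 0) = m := by
  have h := hp (MvPolynomial.mem_support_iff.mp hd)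
  rw [Finsupp.weight_apply, Finsupp.sum_fintype _ _ (by simp)] at h
  simpa using h

theorem two_pow_div_injective {a b a' b' m : ℕ} (h1 : a + b = m) (h2 : a' + b' = m)
    (h : (2 : ℚ) ^ a / 2 ^ b = 2 ^ a' / 2 ^ b') : a = a' ∧ b = b' := by
  rw [div_eq_div_iff (by positivity) (by positivity), ← pow_add, ← pow_add] at h
  have := pow_right_injective₀ (by norm_num : (0 : ℚ) < 2) (by norm_num) h
  omega

theorem monomial_mem {m : ℕ} {p : MvPolynomial (SpIdx 1) ℚ} (hp : p.IsHomogeneous m)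
    {U : Submodule ℚ (MvPolynomial (SpIdx 1) ℚ)} (hU : ∀ u ∈ U, polyAct 1 torus.1 u ∈ U)
    (h : p ∈ U) : ∀ d ∈ p.support, MvPolynomial.monomial d (p.coeff d) ∈ U := by
  refine mem_of_sum_eigenvectors (polyAct 1 torus.1).toLinearMap hU p.support
    (fun d => (2 : ℚ) ^ d (Sum.inl 0) / 2 ^ d (Sum.inr 0)) ?_
    (fun d => MvPolynomial.monomial d (p.coeff d)) ?_ ?_
  · intro d hd d' hd' hdd
    have h1 := two_pow_div_injective (degree_eq_of_mem_support hp hd)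
      (degree_eq_of_mem_support hp hd') hdd
    ext a
    rcases a with a | a <;> rw [Subsingleton.elim a 0]
    · exact h1.1
    · exact h1.2
  · intro d _
    rw [monomial_eq_mon, map_smul, AlgHom.toLinearMap_apply, polyAct_torus_mon, smul_comm]
  · rwa [MvPolynomial.support_sum_monomial_coeff]

theorem mon_mem_of_shear {U : Submodule ℚ (MvPolynomial (SpIdx 1) ℚ)}
    (hU : ∀ u ∈ U, polyAct 1 torus.1 u ∈ U) {n : ℕ} {a b : ℕ → ℕ} {c : ℕ → ℚ} {s : Finset ℕ}
    (hc : ∀ i ∈ s, c i ≠ 0) (hab : ∀ i ∈ s, a i + b i = n) (ha : Set.InjOn a s)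
    (h : ∑ i ∈ s, c i • mon (a i) (b i) ∈ U) : ∀ i ∈ s, mon (a i) (b i) ∈ U := by
  intro i hi
  have := mem_of_sum_eigenvectors (polyAct 1 torus.1).toLinearMap hU s
    (fun i => (2 : ℚ) ^ a i / 2 ^ b i)
    (fun i hi j hj hij => ha hi hj (two_pow_div_injective (hab i hi) (hab j hj) hij).1)
    (fun i => c i • mon (a i) (b i)) (fun i _ => by
      rw [map_smul, AlgHom.toLinearMap_apply, polyAct_torus_mon, smul_comm]) h i hi
  have := Submodule.smul_mem U (c i)⁻¹ this
  rwa [inv_smul_smul₀ (hc i hi)] at this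

/-- A nonzero invariant subspace of the binary forms of degree `m` contains all of them: it
contains a monomial, a shear of this monomial has `x^m` as a component, and a shear of `x^m` has
all monomials as components. -/
theorem mon_mem_of_invariant {m : ℕ} {U : Submodule ℚ (MvPolynomial (SpIdx 1) ℚ)}
    (hU : ∀ A : Sp 1, ∀ u ∈ U, polyAct 1 A.1 u ∈ U) {p : MvPolynomial (SpIdx 1) ℚ}
    (hp : p.IsHomogeneous m) (hpU : p ∈ U) (hp0 : p ≠ 0) {a b : ℕ} (hab : a + b = m) :
    mon a b ∈ U := by
  obtain ⟨d, hd⟩ := MvPolynomial.support_nonempty.mpr hp0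
  have h1 := monomial_mem hp (hU torus) hpU d hd
  have hdm := degree_eq_of_mem_support hp hd
  rw [monomial_eq_mon] at h1
  have h2 : mon (d (Sum.inl 0)) (d (Sum.inr 0)) ∈ U := by
    have := Submodule.smul_mem U (p.coeff d)⁻¹ h1
    rwa [inv_smul_smul₀ (MvPolynomial.mem_support_iff.mp hd)] at this
  generalize d (Sum.inl 0) = e at h2 hdm
  generalize d (Sum.inr 0) = f at h2 hdm
  have h3 : mon m 0 ∈ U := by
    obtain ⟨A, hA⟩ := exists_transvection (Sum.inl 0) 1
    have h4 := hU A _ h2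
    have h5 : polyAct 1 A.1 (mon e f) =
        ∑ i ∈ Finset.range (f + 1), (f.choose i : ℚ) • mon (e + i) (f - i) := by
      have hx : polyAct 1 A.1 (MvPolynomial.X (Sum.inl 0)) = MvPolynomial.X (Sum.inl 0) := by
        rw [polyAct_X]; simp [hA]
      have hy : polyAct 1 A.1 (MvPolynomial.X (Sum.inr 0)) =
          MvPolynomial.X (Sum.inl 0) + MvPolynomial.X (Sum.inr 0) := by
        rw [polyAct_X]; simp [hA]
      rw [mon, map_mul, map_pow, map_pow, hx, hy, add_pow, Finset.mul_sum]
      refine Finset.sum_congr rfl fun i _ => ?_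
      rw [mon, MvPolynomial.smul_eq_C_mul, pow_add, map_natCast]
      ring
    rw [h5] at h4
    have h6 := mon_mem_of_shear (hU torus) (n := m) (a := fun i => e + i) (b := fun i => f - i)
      (fun i hi => by
        have := Nat.choose_pos (Nat.lt_succ_iff.mp (Finset.mem_range.mp hi))
        positivity)
      (fun i hi => by
        have := Finset.mem_range.mp hi
        omega) (fun i _ j _ hij => by simpa using hij) h4 f (by simp)
    simpa [hdm] using h6
  obtain ⟨A, hA⟩ := exists_transvection (Sum.inr 0) 1
  have h4 := hU A _ h3
  have h5 : polyAct 1 A.1 (mon m 0) =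
      ∑ i ∈ Finset.range (m + 1), (m.choose i : ℚ) • mon i (m - i) := by
    have hx : polyAct 1 A.1 (MvPolynomial.X (Sum.inl 0)) =
        MvPolynomial.X (Sum.inl 0) + MvPolynomial.X (Sum.inr 0) := by
      rw [polyAct_X]; simp [hA]
    rw [mon, pow_zero, mul_one, map_pow, hx, add_pow]
    refine Finset.sum_congr rfl fun i _ => ?_
    rw [mon, MvPolynomial.smul_eq_C_mul, map_natCast]
    ring
  rw [h5] at h4
  have h6 := mon_mem_of_shear (hU torus) (n := m) (a := fun i => i) (b := fun i => m - i)
    (fun i hi => by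
      have := Nat.choose_pos (Nat.lt_succ_iff.mp (Finset.mem_range.mp hi))
      positivity)
    (fun i hi => by
      have := Finset.mem_range.mp hi
      omega) (fun i _ j _ hij => hij) h4 a (by simp; omega)
  rwa [show m - a = b by omega] at h6

theorem mon_mem_symPow {a b m : ℕ} (h : a + b = m) : mon a b ∈ (symPow 1 m).toSubmodule := by
  have := ((MvPolynomial.isHomogeneous_X ℚ (Sum.inl 0 : SpIdx 1)).pow a).mul
    ((MvPolynomial.isHomogeneous_X ℚ (Sum.inr 0 : SpIdx 1)).pow b)
  rw [one_mul, one_mul, h] at this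
  exact this

theorem mon_ne_zero (a b : ℕ) : mon a b ≠ 0 :=
  mul_ne_zero (pow_ne_zero _ (MvPolynomial.X_ne_zero _)) (pow_ne_zero _ (MvPolynomial.X_ne_zero _))

theorem symPow_isIrreducible (m : ℕ) : (symPow 1 m).toRepresentation.IsIrreducible := by
  have hnt : Nontrivial (Subrepresentation (symPow 1 m).toRepresentation) := by
    refine ⟨⊥, ⊤, fun h => mon_ne_zero m 0 ?_⟩
    have h1 : (⟨mon m 0, mon_mem_symPow (by omega)⟩ : (symPow 1 m).toSubmodule) ∈
        (⊥ : Subrepresentation (symPow 1 m).toRepresentation) := by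
      rw [h]; exact Submodule.mem_top
    exact congrArg Subtype.val ((Submodule.mem_bot ℚ).mp h1)
  refine ⟨fun V => or_iff_not_imp_left.mpr fun hV => ?_⟩
  let U := V.toSubmodule.map (symPow 1 m).toSubmodule.subtype
  have hU : ∀ A : Sp 1, ∀ u ∈ U, polyAct 1 A.1 u ∈ U := by
    rintro A _ ⟨u, hu, rfl⟩
    exact ⟨_, V.apply_mem_toSubmodule A hu, rfl⟩
  obtain ⟨u, hu, hu0⟩ : ∃ u ∈ V.toSubmodule, u ≠ 0 := by
    by_contra! h
    refine hV (Subrepresentation.toSubmodule_injective (le_antisymm (fun u hu => ?_) bot_le))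
    exact (Submodule.mem_bot ℚ).mpr (h u hu)
  have hmem : ∀ p ∈ (symPow 1 m).toSubmodule, p ∈ U := by
    intro p hp
    rw [← MvPolynomial.support_sum_monomial_coeff p]
    refine Submodule.sum_mem _ fun d hd => ?_
    rw [monomial_eq_mon]
    exact Submodule.smul_mem _ _ (mon_mem_of_invariant hU u.2 ⟨u, hu, rfl⟩
      (fun h => hu0 (Subtype.ext h)) (degree_eq_of_mem_support hp hd))
  refine Subrepresentation.toSubmodule_injective (le_antisymm le_top fun p _ => ?_)
  obtain ⟨q, hq, hqp⟩ := hmem p.1 p.2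
  rwa [← Subtype.ext hqp]

/-! ### Irreducible decompositions -/

/-- A simple submodule of a semisimple module generated by images of simple modules is isomorphic
to one of these. -/
theorem exists_linearEquiv_of_iSup_range {R M ι : Type*} {N : ι → Type*} [Ring R] [AddCommGroup M]
    [Module R M] [∀ i, AddCommGroup (N i)] [∀ i, Module R (N i)] [∀ i, IsSimpleModule R (N i)]
    [IsSemisimpleModule R M] (f : ∀ i, N i →ₗ[R] M) (hf : ⨆ i, LinearMap.range (f i) = ⊤)
    (P : Submodule R M) [IsSimpleModule R P] : ∃ i, Nonempty (N i ≃ₗ[R] P) := by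
  obtain ⟨P', hP'⟩ := exists_isCompl P
  by_contra! h
  have h1 : ∀ i, P.projectionOnto P' hP' ∘ₗ f i = 0 := fun i =>
    (LinearMap.bijective_or_eq_zero (P.projectionOnto P' hP' ∘ₗ f i)).resolve_left fun hb =>
      (h i).elim (LinearEquiv.ofBijective _ hb)
  have h2 : LinearMap.ker (P.projectionOnto P' hP') = ⊤ := by
    rw [eq_top_iff, ← hf]
    refine iSup_le fun i => ?_
    rw [LinearMap.range_le_ker_iff]
    exact h1 i
  rw [Submodule.ker_projectionOnto] at h2
  have h3 := hP'.inf_eq_bot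
  rw [h2, inf_top_eq] at h3
  exact (IsSimpleModule.isAtom (R := R) (m := P)).1 h3

/-- The group algebra of `Sp(2, ℚ)`. -/
abbrev SpAlg : Type := MonoidAlgebra ℚ (Sp 1)

section
variable {V W : Type} [AddCommGroup V] [Module ℚ V] [AddCommGroup W] [Module ℚ W]
  {ρ : Representation ℚ (Sp 1) V} {σ : Representation ℚ (Sp 1) W}

/-- The space of the representation `ρ`, as a module over the group algebra. -/
def RepModule (_ : Representation ℚ (Sp 1) V) : Type := V

instance : AddCommGroup (RepModule ρ) := inferInstanceAs (AddCommGroup V)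

instance : Module SpAlg (RepModule ρ) :=
  letI : Module SpAlg V := Module.compHom V ρ.asAlgebraHom.toRingHom
  inferInstanceAs (Module SpAlg V)

/-- The identification of a representation with its module over the group algebra. -/
def RepModule.of (ρ : Representation ℚ (Sp 1) V) : V ≃+ RepModule ρ := AddEquiv.refl V

theorem RepModule.single_smul (A : Sp 1) (c : ℚ) (x : V) :
    (MonoidAlgebra.single A c : SpAlg) • RepModule.of ρ x = RepModule.of ρ (c • ρ A x) :=
  LinearMap.congr_fun (Representation.asAlgebraHom_single ρ A c) x

theorem RepModule.single_one_smul (c : ℚ) (x : V) :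
    (MonoidAlgebra.single 1 c : SpAlg) • RepModule.of ρ x = RepModule.of ρ (c • x) := by
  rw [RepModule.single_smul, map_one, Module.End.one_apply]

/-- Intertwining maps are linear over the group algebra. -/
def RepModule.lift (φ : ρ.IntertwiningMap σ) : RepModule ρ →ₗ[SpAlg] RepModule σ where
  toFun x := RepModule.of σ (φ ((RepModule.of ρ).symm x))
  map_add' x y := by rw [map_add, map_add, map_add]
  map_smul' r x := by
    obtain ⟨x, rfl⟩ := (RepModule.of ρ).surjective x
    rw [RingHom.id_apply]
    induction r using MonoidAlgebra.induction_linear with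
    | zero => rw [zero_smul, zero_smul, map_zero, map_zero, map_zero]
    | add r s hr hs => rw [add_smul, add_smul, map_add, map_add, map_add, hr, hs]
    | single A c =>
      rw [RepModule.single_smul, RepModule.single_smul, AddEquiv.symm_apply_apply,
        AddEquiv.symm_apply_apply, map_smul, φ.isIntertwining]

theorem RepModule.lift_of (φ : ρ.IntertwiningMap σ) (x : V) :
    RepModule.lift φ (RepModule.of ρ x) = RepModule.of σ (φ x) := by
  change RepModule.of σ (φ ((RepModule.of ρ).symm (RepModule.of ρ x))) = _
  rw [AddEquiv.symm_apply_apply]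

/-- A linear map over the group algebra is an intertwining map. -/
def RepModule.unlift (f : RepModule ρ →ₗ[SpAlg] RepModule σ) : ρ.IntertwiningMap σ where
  toLinearMap :=
    { toFun := fun x => (RepModule.of σ).symm (f (RepModule.of ρ x))
      map_add' := fun x y => by rw [map_add, map_add, map_add]
      map_smul' := fun c x => by
        obtain ⟨y, hy⟩ := (RepModule.of σ).surjective (f (RepModule.of ρ x))
        rw [← RepModule.single_one_smul, map_smul, ← hy, RepModule.single_one_smul,
          AddEquiv.symm_apply_apply, AddEquiv.symm_apply_apply, RingHom.id_apply] }
  isIntertwining' A := LinearMap.ext fun x => by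
    obtain ⟨y, hy⟩ := (RepModule.of σ).surjective (f (RepModule.of ρ x))
    have h2 := f.map_smul (MonoidAlgebra.single A 1 : SpAlg) (RepModule.of ρ x)
    rw [RepModule.single_smul, ← hy, RepModule.single_smul, one_smul, one_smul] at h2
    change (RepModule.of σ).symm (f (RepModule.of ρ (ρ A x))) =
      σ A ((RepModule.of σ).symm (f (RepModule.of ρ x)))
    rw [h2, ← hy, AddEquiv.symm_apply_apply, AddEquiv.symm_apply_apply]

/-- The subspace underlying a submodule over the group algebra. -/
def RepModule.toSubrep (N : Submodule SpAlg (RepModule ρ)) : Subrepresentation ρ where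
  toSubmodule :=
    { carrier := {x | RepModule.of ρ x ∈ N}
      add_mem' := fun {x y} hx hy => by
        rw [Set.mem_ofPred_eq, map_add]; exact N.add_mem hx hy
      zero_mem' := by rw [Set.mem_ofPred_eq, map_zero]; exact N.zero_mem
      smul_mem' := fun c x hx => by
        rw [Set.mem_ofPred_eq, ← RepModule.single_one_smul]
        exact N.smul_mem _ hx }
  apply_mem_toSubmodule A x hx := by
    have h := N.smul_mem (MonoidAlgebra.single A 1 : SpAlg) (show RepModule.of ρ x ∈ N from hx)
    rwa [RepModule.single_smul, one_smul] at h

theorem RepModule.mem_toSubrep {N : Submodule SpAlg (RepModule ρ)} {x : V} :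
    x ∈ (RepModule.toSubrep N).toSubmodule ↔ RepModule.of ρ x ∈ N := Iff.rfl

theorem RepModule.toSubrep_injective : Function.Injective
    fun N : Submodule SpAlg (RepModule ρ) => (RepModule.toSubrep N).toSubmodule :=
  fun N N' h => Submodule.ext fun x => by
    obtain ⟨x, rfl⟩ := (RepModule.of ρ).surjective x
    rw [← RepModule.mem_toSubrep, ← RepModule.mem_toSubrep]
    exact SetLike.ext_iff.mp h x

theorem RepModule.toSubrep_strictMono :
    StrictMono fun N : Submodule SpAlg (RepModule ρ) => (RepModule.toSubrep N).toSubmodule :=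
  Monotone.strictMono_of_injective (fun _ _ h _ hx => h hx) RepModule.toSubrep_injective

theorem RepModule.isSimpleModule (h : ρ.IsIrreducible) : IsSimpleModule SpAlg (RepModule ρ) := by
  have hbot : (RepModule.toSubrep (⊥ : Submodule SpAlg (RepModule ρ))).toSubmodule = ⊥ :=
    le_antisymm (fun x hx => by
      rw [RepModule.mem_toSubrep, Submodule.mem_bot, map_eq_zero_iff _ (RepModule.of ρ).injective]
        at hx
      rw [hx]; exact Submodule.zero_mem _) bot_le
  have htop : (RepModule.toSubrep (⊤ : Submodule SpAlg (RepModule ρ))).toSubmodule = ⊤ :=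
    eq_top_iff.mpr fun _ _ => Submodule.mem_top
  rw [isSimpleModule_iff]
  have hnt : Nontrivial (Submodule SpAlg (RepModule ρ)) := by
    refine ⟨⊥, ⊤, fun h' => (bot_ne_top : (⊥ : Subrepresentation ρ) ≠ ⊤) ?_⟩
    apply Subrepresentation.toSubmodule_injective
    exact hbot.symm.trans ((congrArg (fun N => (RepModule.toSubrep N).toSubmodule) h').trans htop)
  refine ⟨fun N => (eq_bot_or_eq_top (RepModule.toSubrep N)).imp (fun h' => ?_) fun h' => ?_⟩
  · exact RepModule.toSubrep_injective
      ((congrArg Subrepresentation.toSubmodule h').trans hbot.symm)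
  · exact RepModule.toSubrep_injective
      ((congrArg Subrepresentation.toSubmodule h').trans htop.symm)

/-- The sum of the images of the symmetric powers in a representation. -/
def symPowSpan (σ : Representation ℚ (Sp 1) W) : Submodule ℚ W :=
  Submodule.span ℚ {t | ∃ (m : ℕ) (φ : (symPow 1 m).toRepresentation.IntertwiningMap σ)
    (p : (symPow 1 m).toSubmodule), φ p = t}

theorem iSup_range_lift (hσ : symPowSpan σ = ⊤) :
    ⨆ i : Σ m : ℕ, (symPow 1 m).toRepresentation.IntertwiningMap σ,
      LinearMap.range (RepModule.lift i.2) = ⊤ := by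
  set S := ⨆ i : Σ m : ℕ, (symPow 1 m).toRepresentation.IntertwiningMap σ,
      LinearMap.range (RepModule.lift i.2) with hS
  have hle : symPowSpan σ ≤ (RepModule.toSubrep S).toSubmodule := by
    refine Submodule.span_le.mpr ?_
    rintro _ ⟨m, φ, p, rfl⟩
    rw [SetLike.mem_coe, RepModule.mem_toSubrep, hS]
    exact Submodule.mem_iSup_of_mem ⟨m, φ⟩ ⟨RepModule.of _ p, RepModule.lift_of φ p⟩
  rw [hσ] at hle
  refine eq_top_iff.mpr fun t _ => ?_
  obtain ⟨t, rfl⟩ := (RepModule.of σ).surjective t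
  exact RepModule.mem_toSubrep.mp (hle Submodule.mem_top)

instance (m : ℕ) : IsSimpleModule SpAlg (RepModule (symPow 1 m).toRepresentation) :=
  RepModule.isSimpleModule (symPow_isIrreducible m)

theorem isSemisimpleModule_of_symPowSpan (hσ : symPowSpan σ = ⊤) :
    IsSemisimpleModule SpAlg (RepModule σ) :=
  isSemisimpleModule_of_isSemisimpleModule_submodule' (fun _ => IsSemisimpleModule.range _)
    (iSup_range_lift hσ)

end

/-- The inclusion of the symmetric power into all polynomials. -/
def symPowIncl (m : ℕ) : (symPow 1 m).toRepresentation.IntertwiningMap (polyRep 1) where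
  toLinearMap := (symPow 1 m).toSubmodule.subtype
  isIntertwining' _ := rfl

theorem symPowSpan_tensorRep : symPowSpan (tensorRep 1) = ⊤ := by
  rw [eq_top_iff, ← polySpan_eq_top]
  refine Submodule.span_le.mpr ?_
  rintro _ ⟨φ, m, p, hp, rfl⟩
  exact Submodule.subset_span ⟨m, φ.comp (symPowIncl m), ⟨p, hp⟩, rfl⟩

section
variable {V : Type} [AddCommGroup V] [Module ℚ V]

theorem bijective_toModule_of_isInternal {R W I : Type*} [DecidableEq I] [Ring R] [AddCommGroup W]
    [Module R W] {p : I → Submodule R W} (hp : DirectSum.IsInternal p) {M : I → Type*}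
    [∀ i, AddCommGroup (M i)] [∀ i, Module ℚ (M i)] (o : V ≃+ W) (φ : ∀ i, M i →ₗ[ℚ] V)
    (e : ∀ i, M i ≃+ p i) (h : ∀ i x, o (φ i x) = e i x) :
    Function.Bijective (DirectSum.toModule ℚ I V φ) := by
  have hmap : Function.Bijective (DirectSum.map fun i => (e i).toAddMonoidHom) :=
    ⟨(DirectSum.map_injective _).mpr fun i => (e i).injective,
      (DirectSum.map_surjective _).mpr fun i => (e i).surjective⟩
  have heq : o.toAddMonoidHom.comp (DirectSum.toModule ℚ I V φ).toAddMonoidHom =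
      (DirectSum.coeAddMonoidHom p).comp (DirectSum.map fun i => (e i).toAddMonoidHom) := by
    refine DirectSum.addHom_ext fun i x => ?_
    rw [AddMonoidHom.comp_apply, AddMonoidHom.comp_apply, DirectSum.map_of,
      DirectSum.coeAddMonoidHom_of]
    exact (congrArg o (DirectSum.toModule_lof ℚ i x)).trans (h i x)
  have h2 := hp.comp hmap
  rw [← AddMonoidHom.coe_comp, ← heq] at h2
  exact (Function.Bijective.of_comp_iff' o.bijective _).mp h2

/-- A finite-dimensional representation which embeds into a sum of images of symmetric powers is a
direct sum of symmetric powers. -/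
theorem exists_isIrredDecomp [FiniteDimensional ℚ V] {ρ : Representation ℚ (Sp 1) V}
    {W : Type} [AddCommGroup W] [Module ℚ W] {τ : Representation ℚ (Sp 1) W}
    (hτ : symPowSpan τ = ⊤) (f : ρ.IntertwiningMap τ) (hf : Function.Injective f) :
    ∃ n, IsIrredDecomp ρ n := by
  classical
  have hssτ := isSemisimpleModule_of_symPowSpan hτ
  let F := RepModule.lift f
  have hF : Function.Injective F :=
    (RepModule.of τ).injective.comp (hf.comp (RepModule.of ρ).symm.injective)
  have hss : IsSemisimpleModule SpAlg (RepModule ρ) := IsSemisimpleModule.of_injective F hF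
  obtain ⟨s, hind, hsup, hsimple⟩ :=
    IsSemisimpleModule.exists_sSupIndep_sSup_simples_eq_top SpAlg (RepModule ρ)
  have hiso : ∀ P : s, ∃ j, Nonempty (RepModule (symPow 1 j).toRepresentation ≃ₗ[SpAlg] P.1) := by
    intro P
    have : IsSimpleModule SpAlg P.1 := hsimple P.1 P.2
    have eP := Submodule.equivMapOfInjective F hF P.1
    have : IsSimpleModule SpAlg (P.1.map F) := IsSimpleModule.congr eP.symm
    obtain ⟨i, ⟨e⟩⟩ := exists_linearEquiv_of_iSup_range _
      (iSup_range_lift hτ) (P.1.map F)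
    exact ⟨i.1, ⟨e.trans eP.symm⟩⟩
  choose j hj using hiso
  have hwf : WellFoundedGT (Submodule SpAlg (RepModule ρ)) :=
    RepModule.toSubrep_strictMono.wellFoundedGT
  have hfin : Finite s := WellFoundedGT.finite_of_iSupIndep ((sSupIndep_iff _).mp hind)
    fun P => (isSimpleModule_iff_isAtom.mp (hsimple P.1 P.2)).1
  let n : ℕ → ℕ := fun a => Nat.card {P : s // j P = a}
  let σ : (Σ a, Fin (n a)) ≃ s :=
    (Equiv.sigmaCongrRight fun a => (Finite.equivFin {P : s // j P = a}).symm).trans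
      (Equiv.sigmaFiberEquiv j)
  have hσ : ∀ i, j (σ i) = i.1 := fun i => ((Finite.equivFin {P : s // j P = i.1}).symm i.2).2
  have hE : ∀ i : Σ a, Fin (n a),
      Nonempty (RepModule (symPow 1 i.1).toRepresentation ≃ₗ[SpAlg] (σ i).1) := by
    intro i
    have := hj (σ i)
    rwa [hσ i] at this
  let E := fun i => (hE i).some
  let p : (Σ a, Fin (n a)) → Submodule SpAlg (RepModule ρ) := fun i => (σ i).1
  have hp : DirectSum.IsInternal p := by
    refine DirectSum.isInternal_submodule_of_iSupIndep_of_iSup_eq_top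
      (((sSupIndep_iff _).mp hind).comp σ.injective) ?_
    rw [← hsup, sSup_eq_iSup', ← σ.surjective.iSup_comp]
  let φ : ∀ i : Σ a, Fin (n a), (symPow 1 i.1).toRepresentation.IntertwiningMap ρ := fun i =>
    RepModule.unlift ((p i).subtype ∘ₗ (E i).toLinearMap)
  have hbij : Function.Bijective (DirectSum.toModule ℚ _ V fun i => (φ i).toLinearMap) :=
    bijective_toModule_of_isInternal hp (RepModule.of ρ) (fun i => (φ i).toLinearMap)
      (fun i => (RepModule.of _).trans (E i).toAddEquiv) fun i x =>
        (RepModule.of ρ).apply_symm_apply _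
  refine ⟨n, fun j _ => symPow_isIrreducible j, ⟨(Representation.Equiv.mk
    (LinearEquiv.ofBijective _ hbij) fun A => ?_).symm⟩⟩
  refine DirectSum.linearMap_ext _ fun i => LinearMap.ext fun x => ?_
  simp only [LinearMap.comp_apply, LinearEquiv.coe_coe, LinearEquiv.ofBijective_apply,
    Representation.directSum_apply, DirectSum.lmap_lof, DirectSum.toModule_lof]
  exact Representation.IntertwiningMap.isIntertwining _ _ (φ i) A x

/-! ### Multiplicities and weight spaces -/

/-- The vectors of weight `m`: the eigenspace of `diag(2, 1/2)` with eigenvalue `2^m`. -/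
def weightSpace (ρ : Representation ℚ (Sp 1) V) (m : ℕ) : Submodule ℚ V :=
  Module.End.eigenspace (ρ torus) (2 ^ m)

theorem mem_weightSpace {ρ : Representation ℚ (Sp 1) V} {m : ℕ} {v : V} :
    v ∈ weightSpace ρ m ↔ ρ torus v = (2 : ℚ) ^ m • v := Module.End.mem_eigenspace_iff

/-- In `[j]` with `j ≤ m` there are no vectors of weight `m`, except for the multiples of `x^m`
if `j = m`. -/
theorem eq_smul_mon_of_weight {j m : ℕ} (hjm : j ≤ m) {p : MvPolynomial (SpIdx 1) ℚ}
    (hp : p.IsHomogeneous j) (h : polyAct 1 torus.1 p = (2 : ℚ) ^ m • p) :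
    (p ≠ 0 → j = m) ∧ ∃ c : ℚ, p = c • mon m 0 := by
  have hd : ∀ d ∈ p.support, d (Sum.inl 0) = m ∧ d (Sum.inr 0) = 0 := by
    intro d hd
    have hU : ∀ u ∈ LinearMap.ker ((polyAct 1 torus.1).toLinearMap - (2 : ℚ) ^ m • LinearMap.id),
        polyAct 1 torus.1 u ∈
          LinearMap.ker ((polyAct 1 torus.1).toLinearMap - (2 : ℚ) ^ m • LinearMap.id) := by
      intro u hu
      simp only [LinearMap.mem_ker, LinearMap.sub_apply, AlgHom.toLinearMap_apply,
        LinearMap.smul_apply, LinearMap.id_apply, sub_eq_zero] at hu ⊢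
      rw [hu, map_smul, hu]
    have h1 := monomial_mem hp hU (by simp [h]) d hd
    have hdj := degree_eq_of_mem_support hp hd
    rw [monomial_eq_mon] at h1
    simp only [LinearMap.mem_ker, LinearMap.sub_apply, AlgHom.toLinearMap_apply,
      LinearMap.smul_apply, LinearMap.id_apply, map_smul, polyAct_torus_mon] at h1
    rw [← sub_smul, smul_smul] at h1
    have h2 := (smul_eq_zero.mp h1).resolve_right (mon_ne_zero _ _)
    have h3 := (mul_eq_zero.mp h2).resolve_left (MvPolynomial.mem_support_iff.mp hd)
    rw [sub_eq_zero, div_eq_iff (by positivity), ← pow_add] at h3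
    have := pow_right_injective₀ (by norm_num : (0 : ℚ) < 2) (by norm_num) h3
    omega
  refine ⟨fun h0 => ?_, ?_⟩
  · obtain ⟨d, hd'⟩ := MvPolynomial.support_nonempty.mpr h0
    have := degree_eq_of_mem_support hp hd'
    rw [(hd d hd').1, (hd d hd').2] at this
    omega
  · refine ⟨∑ d ∈ p.support, p.coeff d, ?_⟩
    conv_lhs => rw [← MvPolynomial.support_sum_monomial_coeff p]
    rw [Finset.sum_smul]
    refine Finset.sum_congr rfl fun d hd' => ?_
    rw [monomial_eq_mon, (hd d hd').1, (hd d hd').2]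

theorem mem_weightSpace_directSum {n : ℕ → ℕ} {m : ℕ}
    {v : ⨁ i : Σ j : ℕ, Fin (n j), (symPow 1 i.1).toSubmodule} :
    v ∈ weightSpace (Representation.directSum
      fun i : Σ j : ℕ, Fin (n j) => (symPow 1 i.1).toRepresentation) m ↔
      ∀ i, polyAct 1 torus.1 (v i).1 = (2 : ℚ) ^ m • (v i).1 := by
  rw [mem_weightSpace, Representation.directSum_apply, DirectSum.ext_iff]
  refine forall_congr' fun i => ?_
  rw [DirectSum.lmap_apply, Subtype.ext_iff]
  rfl

theorem mem_weightSpace_equiv {W : Type} [AddCommGroup W] [Module ℚ W]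
    {ρ : Representation ℚ (Sp 1) V} {σ : Representation ℚ (Sp 1) W} (e : ρ.Equiv σ) {m : ℕ}
    {v : V} : v ∈ weightSpace ρ m ↔ e v ∈ weightSpace σ m := by
  have h := Representation.IntertwiningMap.isIntertwining _ _ e.toIntertwiningMap torus v
  simp only [Representation.Equiv.coe_toIntertwiningMap] at h
  rw [mem_weightSpace, mem_weightSpace, ← h, ← map_smul e]
  exact e.injective.eq_iff.symm

end

section
variable {V : Type} [AddCommGroup V] [Module ℚ V]

/-- The highest weight vector `x^m` of the symmetric power `[m]`. -/
def highestVec (m : ℕ) : (symPow 1 m).toSubmodule := ⟨mon m 0, mon_mem_symPow (add_zero m)⟩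

theorem lof_highestVec_mem_weightSpace (n : ℕ → ℕ) (i : Σ j : ℕ, Fin (n j)) :
    DirectSum.lof ℚ _ (fun i : Σ j : ℕ, Fin (n j) => (symPow 1 i.1).toSubmodule) i
        (highestVec i.1) ∈
      weightSpace (Representation.directSum
        fun i : Σ j : ℕ, Fin (n j) => (symPow 1 i.1).toRepresentation) i.1 := by
  rw [mem_weightSpace, Representation.directSum_apply, DirectSum.lmap_lof, ← map_smul]
  congr 1
  refine Subtype.ext ?_
  change polyAct 1 torus.1 (mon i.1 0) = (2 : ℚ) ^ i.1 • mon i.1 0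
  rw [polyAct_torus_mon, pow_zero, div_one]

theorem highestVec_ne_zero (m : ℕ) : highestVec m ≠ 0 := fun h =>
  mon_ne_zero m 0 (congrArg Subtype.val h)

theorem weightSpace_ne_bot {ρ : Representation ℚ (Sp 1) V} {n : ℕ → ℕ} (h : IsIrredDecomp ρ n)
    {j : ℕ} (hj : n j ≠ 0) : weightSpace ρ j ≠ ⊥ := by
  obtain ⟨-, ⟨e⟩⟩ := h
  have hm := lof_highestVec_mem_weightSpace n ⟨j, ⟨0, Nat.pos_of_ne_zero hj⟩⟩
  intro hbot
  have h1 : e.symm (DirectSum.lof ℚ _ (fun i : Σ j : ℕ, Fin (n j) => (symPow 1 i.1).toSubmodule)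
      ⟨j, ⟨0, Nat.pos_of_ne_zero hj⟩⟩ (highestVec j)) = 0 := by
    rw [← Submodule.mem_bot ℚ, ← hbot]
    exact (mem_weightSpace_equiv e.symm).mp hm
  have h2 := e.symm.injective (h1.trans (map_zero e.symm).symm)
  have h3 := DFunLike.congr_fun h2 ⟨j, ⟨0, Nat.pos_of_ne_zero hj⟩⟩
  exact highestVec_ne_zero j ((DirectSum.of_eq_same
    (β := fun i : Σ j : ℕ, Fin (n j) => (symPow 1 i.1).toSubmodule)
    ⟨j, ⟨0, Nat.pos_of_ne_zero hj⟩⟩ (highestVec j)).symm.trans h3)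

/-- If no `[j]` with `j > m` occurs, then the multiplicity of `[m]` is the dimension of the space
of vectors of weight `m`. -/
theorem finrank_weightSpace {ρ : Representation ℚ (Sp 1) V} {n : ℕ → ℕ} (h : IsIrredDecomp ρ n)
    {m : ℕ} (hm : ∀ j, m < j → n j = 0) : Module.finrank ℚ (weightSpace ρ m) = n m := by
  classical
  obtain ⟨-, ⟨e⟩⟩ := h
  let ψ : (Fin (n m) → ℚ) →ₗ[ℚ] ⨁ i : Σ j : ℕ, Fin (n j), (symPow 1 i.1).toSubmodule :=
    Fintype.linearCombination ℚ fun a => DirectSum.lof ℚ _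
      (fun i : Σ j : ℕ, Fin (n j) => (symPow 1 i.1).toSubmodule) ⟨m, a⟩ (highestVec m)
  have hψ : ∀ c, ψ c = ∑ a, DirectSum.lof ℚ _
      (fun i : Σ j : ℕ, Fin (n j) => (symPow 1 i.1).toSubmodule) ⟨m, a⟩ (c a • highestVec m) := by
    intro c
    simp only [ψ, Fintype.linearCombination_apply, map_smul]
  have hinj : Function.Injective ψ := by
    have h1 : ∀ c b, (ψ c) ⟨m, b⟩ = c b • highestVec m := by
      intro c b
      rw [hψ, DirectSum.sum_apply, Finset.sum_eq_single b]
      · exact DirectSum.of_eq_same _ _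
      · intro a _ hab
        refine DirectSum.of_eq_of_ne _ _ _ fun h => hab ?_
        cases h; rfl
      · exact fun h => absurd (Finset.mem_univ b) h
    intro c c' hc
    funext b
    have h2 := h1 c b
    rw [hc, h1] at h2
    exact (smul_left_injective ℚ (highestVec_ne_zero m) h2).symm
  have hmap : weightSpace ρ m = LinearMap.range (e.symm.toLinearMap ∘ₗ ψ) := by
    refine le_antisymm (fun v hv => ?_) ?_
    · have hv' := mem_weightSpace_directSum.mp ((mem_weightSpace_equiv e).mp hv)
      have hr : e v ∈ LinearMap.range ψ := by
        rw [← DirectSum.sum_support_of (e v)]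
        refine Submodule.sum_mem _ fun i hi => ?_
        have hi0 : ((e v) i).1 ≠ 0 := fun h0 => (DFinsupp.mem_support_iff.mp hi) (Subtype.ext h0)
        obtain ⟨j, a⟩ := i
        have hjm : j ≤ m := by
          by_contra hlt
          exact absurd (hm j (not_le.mp hlt)) (Nat.pos_iff_ne_zero.mp a.pos)
        obtain ⟨h1, c, hc⟩ := eq_smul_mon_of_weight hjm
          ((MvPolynomial.mem_homogeneousSubmodule _ _).mp ((e v) ⟨j, a⟩).2) (hv' ⟨j, a⟩)
        obtain rfl := h1 hi0
        refine ⟨Pi.single a c, ?_⟩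
        rw [hψ, Finset.sum_eq_single a]
        · rw [Pi.single_eq_same]
          exact congrArg _ (Subtype.ext hc.symm)
        · intro b _ hb
          rw [Pi.single_eq_of_ne hb, zero_smul, map_zero]
        · exact fun h => absurd (Finset.mem_univ a) h
      obtain ⟨c, hc⟩ := hr
      refine ⟨c, ?_⟩
      change e.symm (ψ c) = v
      rw [hc]
      exact e.symm_apply_apply v
    · rintro _ ⟨c, rfl⟩
      change e.symm (ψ c) ∈ _
      have h : ψ c ∈ weightSpace (Representation.directSum
          fun i : Σ j : ℕ, Fin (n j) => (symPow 1 i.1).toRepresentation) m := by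
        rw [hψ]
        refine Submodule.sum_mem _ fun a _ => ?_
        rw [map_smul]
        exact Submodule.smul_mem _ _ (lof_highestVec_mem_weightSpace n ⟨m, a⟩)
      exact (mem_weightSpace_equiv e.symm).mp h
  rw [hmap, LinearMap.finrank_range_of_inj, Module.finrank_fin_fun]
  exact e.symm.injective.comp hinj

theorem hasLeadingTerm_of_weightSpace [FiniteDimensional ℚ V] {ρ : Representation ℚ (Sp 1) V}
    {W : Type} [AddCommGroup W] [Module ℚ W] {τ : Representation ℚ (Sp 1) W}
    (hτ : symPowSpan τ = ⊤) (f : ρ.IntertwiningMap τ) (hf : Function.Injective f) {c m : ℕ}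
    (hc : 0 < c) (hm : Module.finrank ℚ (weightSpace ρ m) = c)
    (h0 : ∀ j, m < j → weightSpace ρ j = ⊥) : HasLeadingTerm ρ c m := by
  obtain ⟨n, hn⟩ := exists_isIrredDecomp hτ f hf
  have hj : ∀ j, m < j → n j = 0 := fun j hj => by
    by_contra h
    exact weightSpace_ne_bot hn h (h0 j hj)
  exact ⟨hc, n, hn, (finrank_weightSpace hn hj).symm.trans hm, hj⟩

theorem eq_zero_of_weightSpace [FiniteDimensional ℚ V] {ρ : Representation ℚ (Sp 1) V}
    {W : Type} [AddCommGroup W] [Module ℚ W] {τ : Representation ℚ (Sp 1) W}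
    (hτ : symPowSpan τ = ⊤) (f : ρ.IntertwiningMap τ) (hf : Function.Injective f)
    (h0 : ∀ j, weightSpace ρ j = ⊥) (v : V) : v = 0 := by
  obtain ⟨n, hn⟩ := exists_isIrredDecomp hτ f hf
  have hj : ∀ j, n j = 0 := fun j => by
    by_contra h
    exact weightSpace_ne_bot hn h (h0 j)
  obtain ⟨-, ⟨e⟩⟩ := hn
  refine e.injective ?_
  rw [map_zero]
  refine DFinsupp.ext fun i => ?_
  exact absurd (hj i.1) (Nat.pos_iff_ne_zero.mp i.2.pos)

end

/-! ### The bigrading of the free Lie algebra on two generators -/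

/-- The generator `x` of the free Lie algebra on `x`, `y`. -/
def genX : FreeLie 1 := gen 1 (Sum.inl 0)

/-- The generator `y` of the free Lie algebra on `x`, `y`. -/
def genY : FreeLie 1 := gen 1 (Sum.inr 0)

/-- `IsBiMonomial a b u`: the element `u` is an iterated bracket of `a` copies of `x` and `b`
copies of `y`. -/
inductive IsBiMonomial : ℕ → ℕ → FreeLie 1 → Prop
  | x : IsBiMonomial 1 0 genX
  | y : IsBiMonomial 0 1 genY
  | lie {a b c d : ℕ} {u v : FreeLie 1} :
      IsBiMonomial a b u → IsBiMonomial c d v → IsBiMonomial (a + c) (b + d) ⁅u, v⁆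

/-- The part of bidegree `(a, b)` of the free Lie algebra on `x`, `y`. -/
def biL (a b : ℕ) : Submodule ℚ (FreeLie 1) := Submodule.span ℚ {u | IsBiMonomial a b u}

theorem IsBiMonomial.mem {a b : ℕ} {u : FreeLie 1} (h : IsBiMonomial a b u) : u ∈ biL a b :=
  Submodule.subset_span h

theorem biL_induction {p : FreeLie 1 → Prop} {a b : ℕ} (hmon : ∀ u, IsBiMonomial a b u → p u)
    (hzero : p 0) (hadd : ∀ u v, p u → p v → p (u + v)) (hsmul : ∀ (c : ℚ) u, p u → p (c • u))
    {u : FreeLie 1} (hu : u ∈ biL a b) : p u :=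
  Submodule.span_induction hmon hzero (fun _ _ _ _ => hadd _ _) (fun c _ _ => hsmul c _) hu

theorem lie_mem_biL {a b c d : ℕ} {u v : FreeLie 1} (hu : u ∈ biL a b) (hv : v ∈ biL c d) :
    ⁅u, v⁆ ∈ biL (a + c) (b + d) := by
  refine biL_induction (p := fun u => ⁅u, v⁆ ∈ biL (a + c) (b + d)) (fun u hu => ?_) ?_ ?_ ?_ hu
  · refine biL_induction (p := fun v => ⁅u, v⁆ ∈ biL (a + c) (b + d)) (fun v hv => ?_) ?_ ?_ ?_ hv
    · exact (hu.lie hv).mem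
    · rw [lie_zero]; exact zero_mem _
    · intro v w hv hw; rw [lie_add]; exact add_mem hv hw
    · intro c v hv; rw [lie_smul]; exact Submodule.smul_mem _ _ hv
  · rw [zero_lie]; exact zero_mem _
  · intro v w hv hw; rw [add_lie]; exact add_mem hv hw
  · intro c v hv; rw [smul_lie]; exact Submodule.smul_mem _ _ hv

theorem IsBiMonomial.isLieMonomial {a b : ℕ} {u : FreeLie 1} (h : IsBiMonomial a b u) :
    IsLieMonomial 1 (a + b) u := by
  induction h with
  | x => exact IsLieMonomial.gen _
  | y => exact IsLieMonomial.gen _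
  | @lie a b c d u v _ _ hu hv =>
    have h : a + c + (b + d) = a + b + (c + d) := by ring
    rw [h]; exact hu.lie hv

theorem biL_le_lieDegree (a b : ℕ) : biL a b ≤ lieDegree 1 (a + b) :=
  Submodule.span_mono fun _ h => IsBiMonomial.isLieMonomial h

/-- The generator `x` has weight `1` and `y` has weight `-1`. -/
theorem lieAct_torus_of_mem_biL {a b : ℕ} {u : FreeLie 1} (hu : u ∈ biL a b) :
    lieAct 1 torus.1 u = ((2 : ℚ) ^ a / 2 ^ b) • u := by
  refine biL_induction (p := fun u => lieAct 1 torus.1 u = ((2 : ℚ) ^ a / 2 ^ b) • u)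
    (fun u hu' => ?_) ?_ ?_ ?_ hu
  · clear hu
    induction hu' with
    | x => rw [genX, lieAct_gen]; simp [torus]
    | y => rw [genY, lieAct_gen]; simp [torus]
    | lie _ _ hu hv =>
      rw [LieHom.map_lie, hu, hv, smul_lie, lie_smul,
        smul_smul]
      congr 1
      rw [pow_add, pow_add]; field_simp
  · rw [map_zero, smul_zero]
  · intro u v hu hv; rw [map_add, hu, hv, smul_add]
  · intro c u hu; rw [map_smul, hu, smul_comm]

theorem exists_sum_of_mem_lieDegree {n : ℕ} {u : FreeLie 1} (hu : u ∈ lieDegree 1 n) :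
    ∃ v : ℕ × ℕ → FreeLie 1, (∀ p ∈ Finset.HasAntidiagonal.antidiagonal n, v p ∈ biL p.1 p.2) ∧
      ∑ p ∈ Finset.HasAntidiagonal.antidiagonal n, v p = u := by
  classical
  have key : ∀ {n : ℕ} {u : FreeLie 1}, IsLieMonomial 1 n u →
      ∃ a b, a + b = n ∧ IsBiMonomial a b u := by
    intro n u h
    induction h with
    | gen a =>
      rcases a with i | i <;> obtain rfl := Subsingleton.elim i 0
      · exact ⟨1, 0, rfl, IsBiMonomial.x⟩
      · exact ⟨0, 1, rfl, IsBiMonomial.y⟩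
    | lie _ _ hu hv =>
      obtain ⟨a, b, rfl, hu⟩ := hu
      obtain ⟨c, d, rfl, hv⟩ := hv
      exact ⟨a + c, b + d, by ring, hu.lie hv⟩
  induction hu using Submodule.span_induction with
  | mem u hu =>
    obtain ⟨a, b, hab, hu⟩ := key hu
    refine ⟨fun p => if p = (a, b) then u else 0, fun p _ => ?_, ?_⟩
    · dsimp only
      split_ifs with h
      · rw [h]; exact hu.mem
      · exact zero_mem _
    · rw [Finset.sum_ite_eq', if_pos (Finset.HasAntidiagonal.mem_antidiagonal.mpr hab)]
  | zero => exact ⟨0, fun _ _ => zero_mem _, Finset.sum_const_zero⟩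
  | add u v _ _ hu hv =>
    obtain ⟨u', hu', rfl⟩ := hu
    obtain ⟨v', hv', rfl⟩ := hv
    exact ⟨u' + v', fun p hp => add_mem (hu' p hp) (hv' p hp), Finset.sum_add_distrib⟩
  | smul c u _ hu =>
    obtain ⟨u', hu', rfl⟩ := hu
    exact ⟨c • u', fun p hp => Submodule.smul_mem _ _ (hu' p hp), by rw [Finset.smul_sum]; rfl⟩

/-- The weight of a vector determines its bidegree. -/
theorem weight_dichotomy {n : ℕ} {u : FreeLie 1} (hu : u ∈ lieDegree 1 n) {c : ℚ}
    (hc : lieAct 1 torus.1 u = c • u) :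
    (∀ a b, a + b = n → c = 2 ^ a / 2 ^ b → u ∈ biL a b) ∧
      ((∀ a b, a + b = n → c ≠ 2 ^ a / 2 ^ b) → u = 0) := by
  obtain ⟨v, hv, rfl⟩ := exists_sum_of_mem_lieDegree hu
  have hinj : Set.InjOn (fun p : ℕ × ℕ => (2 : ℚ) ^ p.1 / 2 ^ p.2)
      (Finset.HasAntidiagonal.antidiagonal n : Finset (ℕ × ℕ)) := by
    intro p hp q hq hpq
    have := two_pow_div_injective
      (Finset.HasAntidiagonal.mem_antidiagonal.mp hp)
      (Finset.HasAntidiagonal.mem_antidiagonal.mp hq)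
      hpq
    exact Prod.ext this.1 this.2
  have hT : ∀ p ∈ Finset.HasAntidiagonal.antidiagonal n,
      (lieAct 1 torus.1 : FreeLie 1 →ₗ[ℚ] FreeLie 1) (v p) =
      ((2 : ℚ) ^ p.1 / 2 ^ p.2) • v p := fun p hp => lieAct_torus_of_mem_biL (hv p hp)
  have h0 := mem_of_sum_eigenvectors (U := ⊥) (lieAct 1 torus.1 : FreeLie 1 →ₗ[ℚ] FreeLie 1)
    (fun u hu => by rw [Submodule.mem_bot] at hu ⊢; rw [hu, map_zero])
    (Finset.HasAntidiagonal.antidiagonal n)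
    _ hinj (fun p => ((2 : ℚ) ^ p.1 / 2 ^ p.2 - c) • v p)
    (fun p hp => by rw [map_smul, hT p hp, smul_comm]) (by
      rw [Submodule.mem_bot]
      simp only [sub_smul, Finset.sum_sub_distrib, ← Finset.smul_sum]
      rw [← hc, map_sum, sub_eq_zero]
      exact Finset.sum_congr rfl fun p hp => (hT p hp).symm)
  have h1 : ∀ p ∈ Finset.HasAntidiagonal.antidiagonal n, c ≠ 2 ^ p.1 / 2 ^ p.2 → v p = 0 :=
    fun p hp hne =>
    (smul_eq_zero.mp ((Submodule.mem_bot ℚ).mp (h0 p hp))).resolve_left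
      (sub_ne_zero.mpr (Ne.symm hne))
  refine ⟨fun a b hab hcab => ?_, fun h => ?_⟩
  · refine Submodule.sum_mem _ fun p hp => ?_
    by_cases hp' : c = 2 ^ p.1 / 2 ^ p.2
    · have := two_pow_div_injective hab (Finset.HasAntidiagonal.mem_antidiagonal.mp hp)
        (hcab.symm.trans hp')
      rw [this.1, this.2]
      exact hv p hp
    · rw [h1 p hp hp']; exact zero_mem _
  · exact Finset.sum_eq_zero fun p hp =>
      h1 p hp (h _ _ (Finset.HasAntidiagonal.mem_antidiagonal.mp hp))

/-! ### The action of the free Lie algebra on noncommutative polynomials in `ad(x)^i y` -/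

/-- The vector space with basis the words in letters `z_0, z_1, …`. -/
abbrev ZWords : Type := List ℕ →₀ ℚ

/-- The left multiplication by the letter `z_i`. -/
def zCons (i : ℕ) : Module.End ℚ ZWords := Finsupp.lmapDomain ℚ ℚ (List.cons i)

theorem zCons_single (i : ℕ) (l : List ℕ) (c : ℚ) :
    zCons i (Finsupp.single l c) = Finsupp.single (i :: l) c := by
  rw [zCons, Finsupp.lmapDomain_apply, Finsupp.mapDomain_single]

/-- The values on words of the derivation with `z_i ↦ z_{i+1}`. -/
def zDerWord : List ℕ → ZWords
  | [] => 0
  | i :: l => Finsupp.single ((i + 1) :: l) 1 + zCons i (zDerWord l)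

/-- The derivation with `z_i ↦ z_{i+1}`. -/
def zDer : Module.End ℚ ZWords := Finsupp.linearCombination ℚ zDerWord

theorem zDer_single (l : List ℕ) : zDer (Finsupp.single l 1) = zDerWord l := by
  rw [zDer, Finsupp.linearCombination_single, one_smul]

theorem zDer_zCons (i : ℕ) (q : ZWords) :
    zDer (zCons i q) = zCons (i + 1) q + zCons i (zDer q) := by
  have h : zDer ∘ₗ zCons i = zCons (i + 1) + zCons i ∘ₗ zDer := by
    refine Finsupp.lhom_ext' fun l => LinearMap.ext_ring ?_
    change zDer (zCons i (Finsupp.single l 1)) = zCons (i + 1) (Finsupp.single l 1) +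
      zCons i (zDer (Finsupp.single l 1))
    rw [zCons_single, zCons_single, zDer_single, zDer_single, zDerWord]
  exact LinearMap.congr_fun h q

section
attribute [local instance] LieRing.ofAssociativeRing

/-- The representation of the free Lie algebra on words where `x` acts as the derivation
`z_i ↦ z_{i+1}` and `y` as the multiplication by `z_0`. -/
def zHom : FreeLie 1 →ₗ⁅ℚ⁆ Module.End ℚ ZWords :=
  FreeLieAlgebra.lift ℚ (Sum.elim (fun _ => zDer) fun _ => zCons 0)

/-- The linear map underlying `zHom`. -/
def zAct : FreeLie 1 →ₗ[ℚ] Module.End ℚ ZWords := zHom.toLinearMap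

theorem zAct_genX : zAct genX = zDer := FreeLieAlgebra.lift_of_apply _ _

theorem zAct_genY : zAct genY = zCons 0 := FreeLieAlgebra.lift_of_apply _ _

theorem zAct_lie (u v : FreeLie 1) (q : ZWords) :
    zAct ⁅u, v⁆ q = zAct u (zAct v q) - zAct v (zAct u q) :=
  LinearMap.congr_fun (zHom.map_lie u v) q

end

/-- The element `z_i = ad(x)^i(y)` of the free Lie algebra. -/
def zLie : ℕ → FreeLie 1
  | 0 => genY
  | i + 1 => ⁅genX, zLie i⁆

theorem zLie_mem_biL (i : ℕ) : zLie i ∈ biL i 1 := by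
  induction i with
  | zero => exact IsBiMonomial.y.mem
  | succ i ih =>
    have h := lie_mem_biL IsBiMonomial.x.mem ih
    rwa [add_comm 1 i] at h

theorem zAct_zLie (i : ℕ) : zAct (zLie i) = zCons i := by
  induction i with
  | zero => exact zAct_genY
  | succ i ih =>
    refine LinearMap.ext fun q => ?_
    rw [zLie, zAct_lie, ih, zAct_genX, zDer_zCons, add_sub_cancel_right]

/-- The evaluation of an element of the free Lie algebra, as a noncommutative polynomial in the
letters `z_i`: the image of the empty word. -/
def zEval : FreeLie 1 →ₗ[ℚ] ZWords := LinearMap.applyₗ (Finsupp.single [] 1) ∘ₗ zAct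

theorem zEval_apply (u : FreeLie 1) : zEval u = zAct u (Finsupp.single [] 1) := rfl

theorem zEval_genX : zEval genX = 0 := by
  rw [zEval_apply, zAct_genX, zDer_single, zDerWord]

theorem zEval_lie (u v : FreeLie 1) : zEval ⁅u, v⁆ = zAct u (zEval v) - zAct v (zEval u) :=
  zAct_lie u v _

theorem zEval_zLie (i : ℕ) : zEval (zLie i) = Finsupp.single [i] 1 := by
  rw [zEval_apply, zAct_zLie, zCons_single]

/-- The iterated bracket `[z_{i_1}, [z_{i_2}, …, z_{i_r}]…]` attached to a word. -/
def zBracketWord : List ℕ → FreeLie 1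
  | [] => 0
  | [i] => zLie i
  | i :: j :: l => ⁅zLie i, zBracketWord (j :: l)⁆

/-- The linear extension of the iterated bracket. -/
def zBracket : ZWords →ₗ[ℚ] FreeLie 1 := Finsupp.linearCombination ℚ zBracketWord

theorem zBracket_single (l : List ℕ) : zBracket (Finsupp.single l 1) = zBracketWord l := by
  rw [zBracket, Finsupp.linearCombination_single, one_smul]

theorem zBracketWord_mem {l : List ℕ} (hl : l ≠ []) : zBracketWord l ∈ biL l.sum l.length := by
  induction l with
  | nil => exact absurd rfl hl
  | cons i l ih =>
    rcases l with _ | ⟨j, l⟩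
    · exact zLie_mem_biL i
    · have h := lie_mem_biL (zLie_mem_biL i) (ih (List.cons_ne_nil _ _))
      rw [List.sum_cons, List.length_cons, add_comm _ 1]
      exact h

/-- The span of the words of length `b` whose letters have indices of sum `a`. -/
def zDeg (a b : ℕ) : Submodule ℚ ZWords :=
  Finsupp.supported ℚ ℚ {l | l.sum = a ∧ l.length = b}

theorem single_mem_zDeg {a b : ℕ} {l : List ℕ} (h : l.sum = a ∧ l.length = b) :
    Finsupp.single l 1 ∈ zDeg a b := Finsupp.single_mem_supported ℚ 1 h

/-- A linear map which maps the words of bidegree `(c, d)` into a subspace maps everything of this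
bidegree there. -/
theorem map_mem_of_zDeg {V : Type*} [AddCommGroup V] [Module ℚ V] (f : ZWords →ₗ[ℚ] V)
    {U : Submodule ℚ V} {c d : ℕ}
    (h : ∀ l : List ℕ, l.sum = c → l.length = d → f (Finsupp.single l 1) ∈ U) {q : ZWords}
    (hq : q ∈ zDeg c d) : f q ∈ U := by
  rw [zDeg, Finsupp.supported_eq_span_single] at hq
  have hle : Submodule.span ℚ ((fun l => Finsupp.single l (1 : ℚ)) ''
      {l : List ℕ | l.sum = c ∧ l.length = d}) ≤
      U.comap f := by
    refine Submodule.span_le.mpr ?_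
    rintro _ ⟨l, hl, rfl⟩
    exact h l hl.1 hl.2
  exact hle hq

theorem zCons_mem_zDeg {a b : ℕ} (i : ℕ) {q : ZWords} (hq : q ∈ zDeg a b) :
    zCons i q ∈ zDeg (i + a) (b + 1) := by
  refine map_mem_of_zDeg (zCons i) (fun l h1 h2 => ?_) hq
  rw [zCons_single]
  refine single_mem_zDeg ⟨?_, ?_⟩
  · rw [List.sum_cons, h1]
  · rw [List.length_cons, h2]

theorem zDerWord_mem (l : List ℕ) : zDerWord l ∈ zDeg (l.sum + 1) l.length := by
  induction l with
  | nil => exact zero_mem _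
  | cons i l ih =>
    rw [zDerWord]
    refine add_mem (single_mem_zDeg ⟨?_, rfl⟩) ?_
    · rw [List.sum_cons, List.sum_cons]; ring
    · have h := zCons_mem_zDeg i ih
      rwa [← add_assoc] at h

theorem zAct_mem_zDeg {a b : ℕ} {u : FreeLie 1} (hu : IsBiMonomial a b u) :
    ∀ {c d : ℕ} {q : ZWords}, q ∈ zDeg c d → zAct u q ∈ zDeg (a + c) (b + d) := by
  induction hu with
  | x =>
    intro c d q hq
    rw [zAct_genX]
    refine map_mem_of_zDeg zDer (fun l h1 h2 => ?_) hq
    have h := zDerWord_mem l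
    rwa [zDer_single, add_comm 1 c, zero_add, ← h1, ← h2]
  | y =>
    intro c d q hq
    rw [zAct_genY, add_comm 1 d]
    exact zCons_mem_zDeg 0 hq
  | @lie a b a' b' u v _ _ hu hv =>
    intro c d q hq
    rw [zAct_lie]
    refine sub_mem ?_ ?_
    · have h := hu (hv hq)
      rwa [← add_assoc, ← add_assoc] at h
    · have h := hv (hu hq)
      rwa [← add_assoc, ← add_assoc, add_comm a', add_comm b'] at h

theorem zEval_mem_zDeg {a b : ℕ} {u : FreeLie 1} (hu : u ∈ biL a b) : zEval u ∈ zDeg a b := by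
  refine biL_induction (p := fun u => zEval u ∈ zDeg a b) (fun u hu => ?_) ?_ ?_ ?_ hu
  · exact zAct_mem_zDeg hu (single_mem_zDeg ⟨rfl, rfl⟩)
  · rw [map_zero]; exact zero_mem _
  · intro u v hu hv; rw [map_add]; exact add_mem hu hv
  · intro c u hu; rw [map_smul]; exact Submodule.smul_mem _ _ hu

theorem zBracket_zCons (i : ℕ) {c d : ℕ} {q : ZWords} (hq : q ∈ zDeg c (d + 1)) :
    zBracket (zCons i q) = ⁅zLie i, zBracket q⁆ := by
  have h := map_mem_of_zDeg (U := ⊥) (zBracket ∘ₗ zCons i -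
    (LieAlgebra.ad ℚ (FreeLie 1) (zLie i) : FreeLie 1 →ₗ[ℚ] FreeLie 1) ∘ₗ zBracket)
    (fun l _ h2 => by
      obtain ⟨j, l, rfl⟩ := List.exists_cons_of_length_eq_add_one h2
      rw [Submodule.mem_bot, LinearMap.sub_apply, LinearMap.comp_apply, LinearMap.comp_apply,
        zCons_single, zBracket_single, zBracket_single, LieAlgebra.ad_apply, zBracketWord,
        sub_self])
    hq
  rw [Submodule.mem_bot, LinearMap.sub_apply, sub_eq_zero] at h
  exact h

theorem zBracket_zDer {c d : ℕ} {q : ZWords} (hq : q ∈ zDeg c (d + 1)) :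
    zBracket (zDer q) = ⁅genX, zBracket q⁆ := by
  have key : ∀ l : List ℕ, zBracket (zDerWord l) = ⁅genX, zBracketWord l⁆ := by
    intro l
    induction l with
    | nil => rw [zDerWord, zBracketWord, map_zero, lie_zero]
    | cons i l ih =>
      rcases l with _ | ⟨j, l⟩
      · rw [zDerWord, zDerWord, map_zero, add_zero, zBracket_single, zBracketWord, zBracketWord,
          zLie]
      · rw [zDerWord, map_add, zBracket_single, zBracketWord, zBracketWord, zLie,
          zBracket_zCons i (zDerWord_mem (j :: l)), ih, leibniz_lie genX]
  have h := map_mem_of_zDeg (U := ⊥) (zBracket ∘ₗ zDer -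
    (LieAlgebra.ad ℚ (FreeLie 1) genX : FreeLie 1 →ₗ[ℚ] FreeLie 1) ∘ₗ zBracket)
    (fun l _ _ => by
      rw [Submodule.mem_bot, LinearMap.sub_apply, LinearMap.comp_apply, LinearMap.comp_apply,
        zDer_single, zBracket_single, LieAlgebra.ad_apply, key, sub_self])
    hq
  rw [Submodule.mem_bot, LinearMap.sub_apply, sub_eq_zero] at h
  exact h

/-- The iterated bracket intertwines the action on words with the adjoint action. -/
theorem zBracket_zAct {a b : ℕ} {u : FreeLie 1} (hu : IsBiMonomial a b u) :
    ∀ {c d : ℕ} {q : ZWords}, q ∈ zDeg c (d + 1) → zBracket (zAct u q) = ⁅u, zBracket q⁆ := by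
  induction hu with
  | x => intro c d q hq; rw [zAct_genX]; exact zBracket_zDer hq
  | y => intro c d q hq; rw [zAct_genY]; exact zBracket_zCons 0 hq
  | @lie a b a' b' u v hu' hv' hu hv =>
    intro c d q hq
    have h1 := zAct_mem_zDeg hu' hq
    have h2 := zAct_mem_zDeg hv' hq
    rw [← add_assoc] at h1 h2
    rw [zAct_lie, map_sub, hu h2, hv h1, hu hq, hv hq, lie_lie]

/-- The Dynkin identity: evaluation followed by the iterated bracket multiplies an element by its
degree in `y`. -/
theorem zBracket_zEval {a b : ℕ} {u : FreeLie 1} (hu : u ∈ biL a b) :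
    zBracket (zEval u) = (b : ℚ) • u := by
  have key : ∀ {a b : ℕ} {u v : FreeLie 1}, IsBiMonomial a b u → ∀ {c d : ℕ},
      IsBiMonomial c d v → zBracket (zEval v) = (d : ℚ) • v →
      zBracket (zAct u (zEval v)) = (d : ℚ) • ⁅u, v⁆ := by
    intro a b u v hu c d hv h
    rcases d with _ | d
    · have h1 : ∀ {c d : ℕ} {v : FreeLie 1}, IsBiMonomial c d v → d = 0 → zEval v = 0 := by
        intro c d v hv
        induction hv with
        | x => exact fun _ => zEval_genX
        | y => exact fun h => absurd h one_ne_zero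
        | lie _ _ h1 h2 =>
          intro h
          rw [Nat.add_eq_zero_iff] at h
          rw [zEval_lie, h1 h.1, h2 h.2, map_zero, map_zero, sub_zero]
      rw [h1 hv rfl, map_zero, map_zero, Nat.cast_zero, zero_smul]
    · rw [zBracket_zAct hu (zEval_mem_zDeg hv.mem), h, lie_smul]
  refine biL_induction (p := fun u => zBracket (zEval u) = (b : ℚ) • u) (fun u hu => ?_) ?_ ?_ ?_ hu
  · clear * - hu key
    induction hu with
    | x => rw [zEval_genX, map_zero, Nat.cast_zero, zero_smul]
    | y =>
      have h := zEval_zLie 0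
      rw [zLie] at h
      rw [h, zBracket_single, zBracketWord, zLie, Nat.cast_one, one_smul]
    | @lie a b c d u v hu' hv' hu hv =>
      rw [zEval_lie, map_sub, key hu' hv' hv, key hv' hu' hu, ← lie_skew v u,
        Nat.cast_add, add_smul,
        smul_neg, sub_neg_eq_add, add_comm]
  · rw [map_zero, map_zero, smul_zero]
  · intro u v hu hv; rw [map_add, map_add, hu, hv, smul_add]
  · intro c u hu; rw [map_smul, map_smul, hu, smul_comm]

/-! ### Dimensions of the parts of low degree in `y` -/

section
variable {a b : ℕ} {S : Finset (List ℕ)}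

/-- The iterated brackets of the words in a finite set of bidegree `(a, b)`. -/
def bracketSum (b : ℕ) (hS : ∀ l, l ∈ S ↔ l.sum = a ∧ l.length = b + 1) :
    (S → ℚ) →ₗ[ℚ] biL a (b + 1) :=
  Fintype.linearCombination ℚ fun l => ⟨zBracketWord l.1, by
    obtain ⟨h1, h2⟩ := (hS l.1).mp l.2
    have h : l.1 ≠ [] := fun h => by rw [h] at h2; exact absurd h2 (Nat.succ_ne_zero b).symm
    rw [← h1, ← h2]
    exact zBracketWord_mem h⟩

theorem coe_bracketSum (hS : ∀ l, l ∈ S ↔ l.sum = a ∧ l.length = b + 1) (c : S → ℚ) :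
    (bracketSum b hS c : FreeLie 1) = ∑ l, c l • zBracketWord l.1 := by
  rw [bracketSum, Fintype.linearCombination_apply, AddSubmonoidClass.coe_finsetSum]
  rfl

/-- The coefficients of the evaluation at the words in a finite set. -/
def evalCoeff (a b : ℕ) (S : Finset (List ℕ)) : biL a b →ₗ[ℚ] (S → ℚ) :=
  LinearMap.pi fun l => Finsupp.lapply l.1 ∘ₗ zEval ∘ₗ (biL a b).subtype

theorem evalCoeff_apply (u : biL a b) (l : S) : evalCoeff a b S u l = zEval u.1 l.1 := rfl

theorem bracketSum_evalCoeff (hS : ∀ l, l ∈ S ↔ l.sum = a ∧ l.length = b + 1)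
    (u : biL a (b + 1)) : bracketSum b hS (evalCoeff a (b + 1) S u) = ((b + 1 : ℕ) : ℚ) • u := by
  refine Subtype.ext ?_
  rw [coe_bracketSum, Submodule.coe_smul, ← zBracket_zEval u.2, zBracket,
    Finsupp.linearCombination_apply, Finsupp.sum_of_support_subset (s := S)]
  · rw [← Finset.sum_coe_sort S]; rfl
  · intro l hl
    exact (hS l).mpr (((Finsupp.mem_supported ℚ _).mp (zEval_mem_zDeg u.2)) hl)
  · exact fun _ _ => zero_smul _ _

theorem bracketSum_surjective (hS : ∀ l, l ∈ S ↔ l.sum = a ∧ l.length = b + 1) :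
    Function.Surjective (bracketSum b hS) := fun u =>
  ⟨((b + 1 : ℕ) : ℚ)⁻¹ • evalCoeff a (b + 1) S u, by
    rw [map_smul, bracketSum_evalCoeff, smul_smul, inv_mul_cancel₀, one_smul]
    exact Nat.cast_ne_zero.mpr (Nat.succ_ne_zero b)⟩

/-- By the Dynkin identity a multiple of the composition of evaluation and iterated bracket is a
projection; its trace gives the dimension. -/
theorem finrank_biL_eq_sum (hS : ∀ l, l ∈ S ↔ l.sum = a ∧ l.length = b + 1) :
    ((b + 1 : ℕ) : ℚ) * Module.finrank ℚ (biL a (b + 1)) =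
      ∑ l ∈ S, zEval (zBracketWord l) l := by
  classical
  have : Module.Finite ℚ (biL a (b + 1)) := Module.Finite.of_surjective _ (bracketSum_surjective hS)
  have h1 : bracketSum b hS ∘ₗ evalCoeff a (b + 1) S = ((b + 1 : ℕ) : ℚ) • LinearMap.id :=
    LinearMap.ext (bracketSum_evalCoeff hS)
  have h2 := LinearMap.trace_comp_comm' (bracketSum b hS) (evalCoeff a (b + 1) S)
  rw [h1, map_smul, LinearMap.trace_id, smul_eq_mul,
    LinearMap.trace_eq_matrix_trace ℚ (Pi.basisFun ℚ S), Matrix.trace] at h2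
  rw [← h2, ← Finset.sum_coe_sort S]
  refine Finset.sum_congr rfl fun l _ => ?_
  rw [Matrix.diag_apply, LinearMap.toMatrix_apply, Pi.basisFun_repr, Pi.basisFun_apply,
    LinearMap.comp_apply, evalCoeff_apply, coe_bracketSum, Finset.sum_eq_single l]
  · rw [Pi.single_eq_same, one_smul]
  · intro l' _ h
    rw [Pi.single_eq_of_ne h, zero_smul]
  · exact fun h => absurd (Finset.mem_univ l) h

end

theorem list_length_one {a : ℕ} {l : List ℕ} : l ∈ ({[a]} : Finset (List ℕ)) ↔
    l.sum = a ∧ l.length = 0 + 1 := by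
  rw [Finset.mem_singleton]
  constructor
  · rintro rfl; simp
  · rintro ⟨h1, h2⟩
    obtain ⟨i, rfl⟩ := List.length_eq_one_iff.mp h2
    simpa using h1

theorem finrank_biL_one (a : ℕ) : Module.finrank ℚ (biL a 1) = 1 := by
  have h := finrank_biL_eq_sum (fun l => list_length_one (a := a) (l := l))
  rw [Finset.sum_singleton, zBracketWord, zEval_zLie, Finsupp.single_eq_same] at h
  simpa using h

theorem finrank_biL_zero {a : ℕ} (ha : a ≠ 1) : Module.finrank ℚ (biL a 0) = 0 := by
  have key : ∀ {a b : ℕ} {u : FreeLie 1}, IsBiMonomial a b u → b = 0 →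
      (a = 1 ∧ u = genX) ∨ u = 0 := by
    intro a b u h
    induction h with
    | x => exact fun _ => Or.inl ⟨rfl, rfl⟩
    | y => exact fun h => absurd h one_ne_zero
    | lie _ _ hu hv =>
      intro h
      rw [Nat.add_eq_zero_iff] at h
      right
      rcases hu h.1 with ⟨-, rfl⟩ | rfl
      · rcases hv h.2 with ⟨-, rfl⟩ | rfl
        · exact lie_self _
        · exact lie_zero _
      · exact zero_lie _
  have h : biL a 0 = ⊥ := by
    rw [biL, Submodule.span_eq_bot]
    exact fun u hu => (key hu rfl).resolve_left fun h => ha h.1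
  rw [h, finrank_bot]

/-- The words of two letters with indices of sum `a`. -/
def pairWords (a : ℕ) : Finset (List ℕ) :=
  (Finset.HasAntidiagonal.antidiagonal a).image fun p => [p.1, p.2]

theorem mem_pairWords {a : ℕ} (l : List ℕ) : l ∈ pairWords a ↔
    l.sum = a ∧ l.length = 1 + 1 := by
  rw [pairWords, Finset.mem_image]
  constructor
  · rintro ⟨p, hp, rfl⟩
    simpa using hp
  · rintro ⟨h1, h2⟩
    obtain ⟨i, j, rfl⟩ := List.length_eq_two.mp h2
    exact ⟨(i, j), by simpa using h1, rfl⟩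

theorem zEval_bracket_two (i j : ℕ) : zEval ⁅zLie i, zLie j⁆ =
    Finsupp.single [i, j] 1 - Finsupp.single [j, i] 1 := by
  rw [zEval_lie, zAct_zLie, zAct_zLie, zEval_zLie, zEval_zLie, zCons_single, zCons_single]

theorem sum_antidiagonal_diag (a : ℕ) :
    ∑ p ∈ Finset.HasAntidiagonal.antidiagonal a, (if p.1 = p.2 then (1 : ℚ) else 0) =
      if 2 ∣ a then 1 else 0 := by
  have h : ∀ p ∈ Finset.HasAntidiagonal.antidiagonal a,
      (if p.1 = p.2 then (1 : ℚ) else 0) =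
        if p = (a / 2, a / 2) then (if 2 ∣ a then 1 else 0) else 0 := by
    intro p hp
    rw [Finset.HasAntidiagonal.mem_antidiagonal] at hp
    simp only [Prod.ext_iff]
    grind
  rw [Finset.sum_congr rfl h, Finset.sum_ite_eq']
  by_cases h2 : 2 ∣ a
  · rw [if_pos, if_pos h2]
    rw [Finset.HasAntidiagonal.mem_antidiagonal]; omega
  · rw [if_neg h2, ite_self]

theorem finrank_biL_two (a : ℕ) : Module.finrank ℚ (biL a 2) = (a + 1) / 2 := by
  have h := finrank_biL_eq_sum (mem_pairWords (a := a))
  have h1 : ∀ p ∈ Finset.HasAntidiagonal.antidiagonal a,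
      zEval (zBracketWord [p.1, p.2]) [p.1, p.2] = 1 - if p.1 = p.2 then (1 : ℚ) else 0 := by
    intro p _
    rw [zBracketWord, zBracketWord, zEval_bracket_two, Finsupp.sub_apply, Finsupp.single_eq_same,
      Finsupp.single_apply]
    congr 1
    refine if_congr ?_ rfl rfl
    simp only [List.cons.injEq, and_true]
    tauto
  rw [pairWords, Finset.sum_image (by
    rintro ⟨i, j⟩ _ ⟨i', j'⟩ _ h
    simpa using h), Finset.sum_congr rfl h1, Finset.sum_sub_distrib, sum_antidiagonal_diag,
    Finset.sum_const, Finset.Nat.card_antidiagonal, nsmul_one] at h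
  have h2 : 2 * Module.finrank ℚ (biL a 2) + (if 2 ∣ a then 1 else 0) = a + 1 := by
    have h3 : (2 : ℚ) * Module.finrank ℚ (biL a 2) + (if 2 ∣ a then 1 else 0) = a + 1 := by
      push_cast at h
      linarith
    exact_mod_cast h3
  split_ifs at h2 <;> omega

/-- The triples of natural numbers of sum `a`. -/
def triples (a : ℕ) : Finset (Σ _ : ℕ × ℕ, ℕ × ℕ) :=
  (Finset.HasAntidiagonal.antidiagonal a).sigma fun p => Finset.HasAntidiagonal.antidiagonal p.2

theorem mem_triples {a : ℕ} {t : Σ _ : ℕ × ℕ, ℕ × ℕ} :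
    t ∈ triples a ↔ t.1.1 + t.1.2 = a ∧ t.2.1 + t.2.2 = t.1.2 := by
  rw [triples, Finset.mem_sigma, Finset.HasAntidiagonal.mem_antidiagonal,
    Finset.HasAntidiagonal.mem_antidiagonal]

/-- The words of three letters with indices of sum `a`. -/
def tripleWords (a : ℕ) : Finset (List ℕ) :=
  (triples a).image fun t => [t.1.1, t.2.1, t.2.2]

theorem mem_tripleWords {a : ℕ} (l : List ℕ) : l ∈ tripleWords a ↔
    l.sum = a ∧ l.length = 2 + 1 := by
  rw [tripleWords, Finset.mem_image]
  constructor
  · rintro ⟨t, ht, rfl⟩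
    rw [mem_triples] at ht
    refine ⟨?_, rfl⟩
    simp only [List.sum_cons, List.sum_nil]
    omega
  · rintro ⟨h1, h2⟩
    obtain ⟨i, j, k, rfl⟩ := List.length_eq_three.mp h2
    refine ⟨⟨(i, j + k), (j, k)⟩, ?_, rfl⟩
    rw [mem_triples]
    simpa using h1

theorem zEval_bracket_three (i j k : ℕ) : zEval ⁅zLie i, ⁅zLie j, zLie k⁆⁆ =
    Finsupp.single [i, j, k] 1 - Finsupp.single [i, k, j] 1 -
      (Finsupp.single [j, k, i] 1 - Finsupp.single [k, j, i] 1) := by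
  rw [zEval_lie, zEval_bracket_two, zAct_lie, zAct_zLie, zAct_zLie, zAct_zLie, zEval_zLie, map_sub]
  simp only [zCons_single]

/-- The words with equal last two letters and those with equal outer letters are equally many. -/
theorem sum_triples_symm (a : ℕ) :
    ∑ t ∈ triples a, (if t.2.1 = t.2.2 then (1 : ℚ) else 0) =
      ∑ t ∈ triples a, if t.1.1 = t.2.2 then (1 : ℚ) else 0 := by
  refine Finset.sum_nbij' (fun t => ⟨(t.2.1, t.1.1 + t.2.2), (t.1.1, t.2.2)⟩)
    (fun t => ⟨(t.2.1, t.1.1 + t.2.2), (t.1.1, t.2.2)⟩) ?_ ?_ ?_ ?_ ?_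
  · intro t ht; rw [mem_triples] at ht ⊢; dsimp only; omega
  · intro t ht; rw [mem_triples] at ht ⊢; dsimp only; omega
  · rintro ⟨⟨i, m⟩, ⟨j, k⟩⟩ ht
    rw [mem_triples] at ht
    dsimp only at ht
    obtain ⟨-, rfl⟩ := ht
    rfl
  · rintro ⟨⟨i, m⟩, ⟨j, k⟩⟩ ht
    rw [mem_triples] at ht
    dsimp only at ht
    obtain ⟨-, rfl⟩ := ht
    rfl
  · intro t _; rfl

theorem sum_triples_diag (a : ℕ) :
    ∑ t ∈ triples a, (if t.1.1 = t.2.1 ∧ t.2.1 = t.2.2 then (1 : ℚ) else 0) =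
      if 3 ∣ a then 1 else 0 := by
  have h : ∀ t ∈ triples a, (if t.1.1 = t.2.1 ∧ t.2.1 = t.2.2 then (1 : ℚ) else 0) =
        if t = ⟨(a / 3, a / 3 + a / 3), (a / 3, a / 3)⟩ then (if 3 ∣ a then 1 else 0) else 0 := by
    rintro ⟨⟨i, m⟩, ⟨j, k⟩⟩ ht
    rw [mem_triples] at ht
    simp only [Sigma.mk.injEq, Prod.mk.injEq, heq_eq_eq] at ht ⊢
    grind
  rw [Finset.sum_congr rfl h, Finset.sum_ite_eq']
  by_cases h3 : 3 ∣ a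
  · rw [if_pos, if_pos h3]
    rw [mem_triples]; dsimp only; omega
  · rw [if_neg h3, ite_self]

theorem card_triples (a : ℕ) : 2 * (triples a).card = (a + 1) * (a + 2) := by
  rw [triples, Finset.card_sigma]
  simp only [Finset.Nat.card_antidiagonal]
  induction a with
  | zero => simp
  | succ a ih =>
    rw [Finset.Nat.sum_antidiagonal_succ, mul_add]
    dsimp only
    rw [ih]; ring

theorem finrank_biL_three (a : ℕ) : 6 * Module.finrank ℚ (biL a 3) + (if 3 ∣ a then 2 else 0) =
    (a + 1) * (a + 2) := by
  have h := finrank_biL_eq_sum (mem_tripleWords (a := a))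
  have h1 : ∀ t ∈ triples a, zEval (zBracketWord [t.1.1, t.2.1, t.2.2]) [t.1.1, t.2.1, t.2.2] =
      1 - (if t.2.1 = t.2.2 then (1 : ℚ) else 0) -
        ((if t.1.1 = t.2.1 ∧ t.2.1 = t.2.2 then (1 : ℚ) else 0) -
          if t.1.1 = t.2.2 then (1 : ℚ) else 0) := by
    intro t _
    rw [zBracketWord, zBracketWord, zBracketWord, zEval_bracket_three]
    simp only [Finsupp.sub_apply, Finsupp.single_apply, List.cons.injEq, and_true]
    grind
  rw [tripleWords, Finset.sum_image (by
    rintro ⟨⟨i, m⟩, ⟨j, k⟩⟩ ht ⟨⟨i', m'⟩, ⟨j', k'⟩⟩ ht' h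
    rw [Finset.mem_coe, mem_triples] at ht ht'
    dsimp only at ht ht'
    obtain ⟨-, rfl⟩ := ht
    obtain ⟨-, rfl⟩ := ht'
    simp only [List.cons.injEq, and_true] at h
    obtain ⟨rfl, rfl, rfl⟩ := h
    rfl), Finset.sum_congr rfl h1, Finset.sum_sub_distrib, Finset.sum_sub_distrib,
    Finset.sum_sub_distrib, sum_triples_diag, sum_triples_symm, Finset.sum_const, nsmul_one] at h
  have h2 : (2 : ℚ) * (triples a).card = (a + 1) * (a + 2) := by exact_mod_cast card_triples a
  have h3 : (6 : ℚ) * Module.finrank ℚ (biL a 3) + (if 3 ∣ a then 2 else 0) =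
      (a + 1) * (a + 2) := by
    push_cast at h
    rw [← h2]
    norm_num at h
    split_ifs at h ⊢ <;> linarith
  exact_mod_cast h3

/-! ### Weight spaces of symplectic derivations -/

instance finiteDimensional_wordDegree (N : ℕ) : FiniteDimensional ℚ (wordDegree g N) := by
  have : FiniteDimensional ℚ (⨂[ℚ]^N (HQ g)) := Module.Finite.of_basis (tensorBasis g N)
  rw [← range_toTensorAlgebra]
  infer_instance

instance finiteDimensional_lieDegree (n : ℕ) : FiniteDimensional ℚ (lieDegree g (n + 1)) := by
  refine Module.Finite.of_injective ((lieToTensorLin g ∘ₗ (lieDegree g (n + 1)).subtype).codRestrict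
    (wordDegree g (n + 1)) fun u => lieToTensorLin_mem_wordDegree u.2) ?_
  refine (injective_iff_map_eq_zero _).mpr fun u hu => Subtype.ext ?_
  exact lieToTensorLin_eq_zero n.succ_ne_zero u.2 (congrArg Subtype.val hu)

/-- The values of a symplectic derivation of degree `k` on the generators. -/
def genValues (g k : ℕ) :
    (sympDer g k).toSubmodule →ₗ[ℚ] (SpIdx g → lieDegree g (k + 1)) where
  toFun D a := ⟨D.1 (gen g a), by
    rw [add_comm]; exact D.2.1 1 _ (Submodule.subset_span (IsLieMonomial.gen a))⟩
  map_add' _ _ := rfl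
  map_smul' _ _ := rfl

instance finiteDimensional_sympDer (k : ℕ) : FiniteDimensional ℚ (sympDer g k).toSubmodule :=
  Module.Finite.of_injective (genValues g k) fun _ _ h => Subtype.ext
    (der_ext fun a => congrArg Subtype.val (congrFun h a))

/-- The identification of symplectic derivations with tensors is equivariant. -/
def sympDerToTensor (k : ℕ) : (sympDerRep 1 k).IntertwiningMap (tensorRep 1) where
  toLinearMap := derToTensor 1 ∘ₗ (sympDer 1 k).toSubmodule.subtype
  isIntertwining' A := LinearMap.ext fun D => derToTensor_conjDer A D.1

theorem sympDerToTensor_injective (k : ℕ) : Function.Injective (sympDerToTensor k) := by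
  intro D E h
  have h1 : derToTensor 1 (D - E).1 = 0 := by
    change derToTensor 1 (D.1 - E.1) = 0
    rw [map_sub]
    exact sub_eq_zero.mpr h
  exact sub_eq_zero.mp (Subtype.ext (derToTensor_eq_zero (D - E).2 h1))

theorem der_ext_genusOne {D E : Der 1} (hx : D genX = E genX) (hy : D genY = E genY) : D = E :=
  der_ext fun a => by
    rcases a with i | i <;> obtain rfl := Subsingleton.elim i 0
    · exact hx
    · exact hy

theorem omega_genusOne : omega 1 = ⁅genX, genY⁆ := Fin.sum_univ_one _

theorem lieAct_torus_genX : lieAct 1 torus.1 genX = (2 : ℚ) • genX := by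
  have h := lieAct_torus_of_mem_biL IsBiMonomial.x.mem
  rwa [pow_one, pow_zero, div_one] at h

theorem lieAct_torus_genY : lieAct 1 torus.1 genY = (2 : ℚ)⁻¹ • genY := by
  have h := lieAct_torus_of_mem_biL IsBiMonomial.y.mem
  rwa [pow_one, pow_zero, one_div] at h

theorem lieAct_torus_inv_torus (u : FreeLie 1) :
    lieAct 1 (torus⁻¹).1 (lieAct 1 torus.1 u) = u := by
  rw [← lieAct_mul]
  have h : (torus⁻¹).1 * torus.1 = 1 := congrArg Subtype.val (inv_mul_cancel torus)
  rw [h, lieAct_one]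

/-- A derivation has weight `w` when its value on `x` has weight `w + 1` and its value on `y` has
weight `w - 1`. -/
theorem derRep_torus_eq_iff {D : Der 1} {w : ℕ} : derRep 1 torus D = (2 : ℚ) ^ w • D ↔
    lieAct 1 torus.1 (D genX) = (2 : ℚ) ^ (w + 1) • D genX ∧
      lieAct 1 torus.1 (D genY) = ((2 : ℚ) ^ w / 2) • D genY := by
  have hx : derRep 1 torus D genX = (2 : ℚ)⁻¹ • lieAct 1 torus.1 (D genX) := by
    change lieAct 1 torus.1 (D (lieAct 1 (torus⁻¹).1 genX)) = _
    have h := lieAct_torus_inv_torus ((2 : ℚ)⁻¹ • genX)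
    rw [map_smul, lieAct_torus_genX, smul_smul, inv_mul_cancel₀ two_ne_zero, one_smul] at h
    rw [h, map_smul, map_smul]
  have hy : derRep 1 torus D genY = (2 : ℚ) • lieAct 1 torus.1 (D genY) := by
    change lieAct 1 torus.1 (D (lieAct 1 (torus⁻¹).1 genY)) = _
    have h := lieAct_torus_inv_torus ((2 : ℚ) • genY)
    rw [map_smul, lieAct_torus_genY, smul_smul, mul_inv_cancel₀ two_ne_zero, one_smul] at h
    rw [h, map_smul, map_smul]
  have h2 : (2 : ℚ) ≠ 0 := two_ne_zero
  constructor
  · intro h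
    rw [h, LieDerivation.smul_apply] at hx hy
    constructor
    · rw [pow_succ', mul_smul, hx, smul_smul, mul_inv_cancel₀ h2, one_smul]
    · rw [div_eq_inv_mul, mul_smul, hy, smul_smul, inv_mul_cancel₀ h2, one_smul]
  · rintro ⟨h1, h3⟩
    refine der_ext_genusOne ?_ ?_
    · rw [hx, h1, LieDerivation.smul_apply, smul_smul, pow_succ', inv_mul_cancel_left₀ h2]
    · rw [hy, h3, LieDerivation.smul_apply, smul_smul, mul_div_cancel₀ _ h2]

theorem mem_weightSpace_sympDer {k w : ℕ} {D : (sympDer 1 k).toSubmodule} :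
    D ∈ weightSpace (sympDerRep 1 k) w ↔
    lieAct 1 torus.1 (D.1 genX) = (2 : ℚ) ^ (w + 1) • D.1 genX ∧
      lieAct 1 torus.1 (D.1 genY) = ((2 : ℚ) ^ w / 2) • D.1 genY := by
  rw [mem_weightSpace, ← derRep_torus_eq_iff, Subtype.ext_iff]
  rfl

instance finiteDimensional_biL (a b : ℕ) : FiniteDimensional ℚ (biL a b) := by
  rcases hab : a + b with _ | n
  · have key : ∀ {a b : ℕ} {u : FreeLie 1}, IsBiMonomial a b u → a + b ≠ 0 := by
      intro a b u h
      induction h with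
      | x => exact one_ne_zero
      | y => exact one_ne_zero
      | lie _ _ h1 h2 => omega
    have h : biL a b = ⊥ := by
      rw [biL, Submodule.span_eq_bot]
      exact fun u hu => absurd hab (key hu)
    rw [h]; infer_instance
  · have h := biL_le_lieDegree a b
    rw [hab] at h
    exact Submodule.finiteDimensional_of_le h

theorem biL_zero_right {a : ℕ} (ha : a ≠ 1) : biL a 0 = ⊥ :=
  Submodule.finrank_eq_zero.mp (finrank_biL_zero ha)

theorem sympDer_genX_mem {k : ℕ} (D : (sympDer 1 k).toSubmodule) :
    D.1 genX ∈ lieDegree 1 (k + 1) := (genValues 1 k D (Sum.inl 0)).2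

theorem sympDer_genY_mem {k : ℕ} (D : (sympDer 1 k).toSubmodule) :
    D.1 genY ∈ lieDegree 1 (k + 1) := (genValues 1 k D (Sum.inr 0)).2

theorem two_pow_eq_div_iff {a b c : ℕ} : (2 : ℚ) ^ c = 2 ^ a / 2 ^ b ↔ c + b = a := by
  rw [eq_div_iff (by positivity), ← pow_add]
  exact (pow_right_injective₀ (by norm_num : (0 : ℚ) < 2) (by norm_num)).eq_iff

theorem two_pow_half_eq_div_iff {a b c : ℕ} : (2 : ℚ) ^ c / 2 = 2 ^ a / 2 ^ b ↔ c + b = a + 1 := by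
  rw [div_eq_div_iff (by positivity) (by positivity), ← pow_add, ← pow_succ]
  exact (pow_right_injective₀ (by norm_num : (0 : ℚ) < 2) (by norm_num)).eq_iff

/-- The weights of the derivations of degree `k` are at most `k` and of the same parity. -/
theorem weightSpace_sympDer_eq_bot {k w : ℕ} (hk : k ≠ 0)
    (h : ∀ p q, p + q = k → p ≠ w + q) : weightSpace (sympDerRep 1 k) w = ⊥ := by
  rw [eq_bot_iff]
  intro D hD
  obtain ⟨hx, hy⟩ := mem_weightSpace_sympDer.mp hD
  rw [Submodule.mem_bot]
  refine Subtype.ext (der_ext_genusOne ?_ ?_)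
  · refine (weight_dichotomy (sympDer_genX_mem D) hx).2 fun a b hab heq => ?_
    rw [two_pow_eq_div_iff] at heq
    exact h (w + b) b (by omega) rfl
  · -- the weight `k + 1` of `D(y)` would require a multiple of `x` alone, which vanishes as `k ≠ 0`
    by_cases hw : w = k + 2
    · have hm := (weight_dichotomy (sympDer_genY_mem D) hy).1 (k + 1) 0 (by omega)
        (two_pow_half_eq_div_iff.mpr (by omega))
      rw [biL_zero_right (by omega)] at hm
      exact hm
    · refine (weight_dichotomy (sympDer_genY_mem D) hy).2 fun a b hab heq => ?_
      rw [two_pow_half_eq_div_iff] at heq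
      exact h a (b - 1) (by omega) (by omega)

/-- The map `(u, v) ↦ [u, y] + [x, v]`, whose value is `D(ω₀)` for the derivation `D` with
`D(x) = u` and `D(y) = v`. -/
def omegaMap (p q : ℕ) : biL (p + 1) q × biL p (q + 1) →ₗ[ℚ] biL (p + 1) (q + 1) where
  toFun z := ⟨⁅z.1.1, genY⁆ + ⁅genX, z.2.1⁆, add_mem (by
    have h := lie_mem_biL z.1.2 IsBiMonomial.y.mem
    rwa [add_zero] at h) (by
    have h := lie_mem_biL IsBiMonomial.x.mem z.2.2
    rwa [add_comm 1 p, zero_add] at h)⟩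
  map_add' z z' := Subtype.ext <| by
    change ⁅z.1.1 + z'.1.1, genY⁆ + ⁅genX, z.2.1 + z'.2.1⁆ = _
    rw [add_lie, lie_add]
    exact add_add_add_comm _ _ _ _
  map_smul' c z := Subtype.ext <| by
    change ⁅c • z.1.1, genY⁆ + ⁅genX, c • z.2.1⁆ = c • (⁅z.1.1, genY⁆ + ⁅genX, z.2.1⁆)
    rw [smul_lie, lie_smul, smul_add]

/-- By the Jacobi identity every bracket is a sum of brackets with a generator on the left. -/
theorem omegaMap_surjective (p q : ℕ) : Function.Surjective (omegaMap p q) := by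
  have key : ∀ {a b : ℕ} {u : FreeLie 1}, IsBiMonomial a b u → ∀ {c d : ℕ} {v : FreeLie 1},
      v ∈ biL c d → a + c = p + 1 → b + d = q + 1 →
      ⁅u, v⁆ ∈ (LinearMap.range (omegaMap p q)).map (biL (p + 1) (q + 1)).subtype := by
    intro a b u hu
    induction hu with
    | x =>
      intro c d v hv h1 h2
      obtain rfl : c = p := by omega
      obtain rfl : d = q + 1 := by omega
      refine ⟨_, ⟨(0, ⟨v, hv⟩), rfl⟩, ?_⟩
      change ⁅(0 : FreeLie 1), genY⁆ + ⁅genX, v⁆ = ⁅genX, v⁆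
      rw [zero_lie, zero_add]
    | y =>
      intro c d v hv h1 h2
      obtain rfl : c = p + 1 := by omega
      obtain rfl : d = q := by omega
      refine ⟨_, ⟨(-⟨v, hv⟩, 0), rfl⟩, ?_⟩
      change ⁅-v, genY⁆ + ⁅genX, (0 : FreeLie 1)⁆ = ⁅genY, v⁆
      rw [neg_lie, lie_zero, add_zero, lie_skew]
    | lie hu' hv' hu hv =>
      intro c d w hw h1 h2
      rw [lie_lie]
      exact sub_mem (hu (lie_mem_biL hv'.mem hw) (by omega) (by omega))
        (hv (lie_mem_biL hu'.mem hw) (by omega) (by omega))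
  have hmon : ∀ {a b : ℕ} {u : FreeLie 1}, IsBiMonomial a b u → a = p + 1 → b = q + 1 →
      u ∈ (LinearMap.range (omegaMap p q)).map (biL (p + 1) (q + 1)).subtype := by
    intro a b u hu h1 h2
    cases hu with
    | x => omega
    | y => omega
    | lie hu hv => exact key hu hv.mem h1 h2
  intro u
  have hu : u.1 ∈ (LinearMap.range (omegaMap p q)).map (biL (p + 1) (q + 1)).subtype := by
    have hle : biL (p + 1) (q + 1) ≤
        (LinearMap.range (omegaMap p q)).map (biL (p + 1) (q + 1)).subtype :=
      Submodule.span_le.mpr fun u hu => hmon hu rfl rfl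
    exact hle u.2
  obtain ⟨_, ⟨z, rfl⟩, hz⟩ := hu
  exact ⟨z, Subtype.ext hz⟩

/-- The values of a derivation of weight `w` and degree `2 q + w` on the generators. -/
def weightValues (w q : ℕ) : weightSpace (sympDerRep 1 (w + q + q)) w →ₗ[ℚ]
    biL (w + q + 1) q × biL (w + q) (q + 1) where
  toFun D := (⟨D.1.1 genX, (weight_dichotomy (sympDer_genX_mem D.1)
      (mem_weightSpace_sympDer.mp D.2).1).1 _ _ (by ring) (two_pow_eq_div_iff.mpr (by ring))⟩,
    ⟨D.1.1 genY, (weight_dichotomy (sympDer_genY_mem D.1)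
      (mem_weightSpace_sympDer.mp D.2).2).1 _ _ (by ring) (two_pow_half_eq_div_iff.mpr (by ring))⟩)
  map_add' _ _ := rfl
  map_smul' _ _ := rfl

theorem weightValues_injective (w q : ℕ) : Function.Injective (weightValues w q) := by
  intro D E h
  refine Subtype.ext (Subtype.ext (der_ext_genusOne ?_ ?_))
  · exact congrArg (fun z => z.1.1) h
  · exact congrArg (fun z => z.2.1) h

theorem der_omega_genusOne (D : Der 1) : D (omega 1) = ⁅D genX, genY⁆ + ⁅genX, D genY⁆ := by
  rw [omega_genusOne, LieDerivation.apply_lie_eq_add, add_comm]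

theorem range_weightValues (w q : ℕ) :
    LinearMap.range (weightValues w q) = LinearMap.ker (omegaMap (w + q) q) := by
  refine le_antisymm ?_ fun z hz => ?_
  · rintro _ ⟨D, rfl⟩
    refine Subtype.ext ?_
    exact (der_omega_genusOne D.1.1).symm.trans D.1.2.2
  · let D : Der 1 := derOfGen (Sum.elim (fun _ => z.1.1) fun _ => z.2.1)
    have hx : D genX = z.1.1 := derOfGen_gen _ _
    have hy : D genY = z.2.1 := derOfGen_gen _ _
    have hzx := biL_le_lieDegree _ _ z.1.2
    have hzy := biL_le_lieDegree _ _ z.2.2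
    have hD : D ∈ (sympDer 1 (w + q + q)).toSubmodule := by
      refine ⟨fun n u hu => der_mem_lieDegree (fun a => ?_) hu, ?_⟩
      · rw [derOfGen_gen]
        rcases a with i | i
        · exact (show w + q + 1 + q = w + q + q + 1 by ring) ▸ hzx
        · exact hzy
      · rw [der_omega_genusOne, hx, hy]
        exact congrArg Subtype.val hz
    refine ⟨⟨⟨D, hD⟩, mem_weightSpace_sympDer.mpr ⟨?_, ?_⟩⟩, ?_⟩
    · change lieAct 1 torus.1 (D genX) = (2 : ℚ) ^ (w + 1) • D genX
      rw [hx, lieAct_torus_of_mem_biL z.1.2,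
        two_pow_eq_div_iff.mpr (show w + 1 + q = w + q + 1 by ring)]
    · change lieAct 1 torus.1 (D genY) = ((2 : ℚ) ^ w / 2) • D genY
      rw [hy, lieAct_torus_of_mem_biL z.2.2,
        two_pow_half_eq_div_iff.mpr (show w + (q + 1) = w + q + 1 by ring)]
    · exact Prod.ext (Subtype.ext hx) (Subtype.ext hy)

/-- The dimension of the space of derivations of weight `w` and degree `w + 2 q`. -/
theorem finrank_weightSpace_sympDer (w q : ℕ) :
    Module.finrank ℚ (biL (w + q + 1) (q + 1)) +
        Module.finrank ℚ (weightSpace (sympDerRep 1 (w + q + q)) w) =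
      Module.finrank ℚ (biL (w + q + 1) q) + Module.finrank ℚ (biL (w + q) (q + 1)) := by
  have h := LinearMap.finrank_range_add_finrank_ker (omegaMap (w + q) q)
  rw [LinearMap.range_eq_top.mpr (omegaMap_surjective _ _), finrank_top, Module.finrank_prod,
    ← range_weightValues, LinearMap.finrank_range_of_inj (weightValues_injective w q)] at h
  exact h

theorem finrank_weightSpace_zero {w : ℕ} (hw : w ≠ 0) :
    Module.finrank ℚ (weightSpace (sympDerRep 1 w) w) = 0 := by
  have h : Module.finrank ℚ (biL (w + 1) 1) +
      Module.finrank ℚ (weightSpace (sympDerRep 1 w) w) =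
      Module.finrank ℚ (biL (w + 1) 0) + Module.finrank ℚ (biL w 1) :=
    finrank_weightSpace_sympDer w 0
  rw [finrank_biL_one, finrank_biL_one, finrank_biL_zero (by omega)] at h
  omega

theorem finrank_weightSpace_one (w : ℕ) :
    Module.finrank ℚ (weightSpace (sympDerRep 1 (w + 2)) w) = if Even w then 1 else 0 := by
  have h : Module.finrank ℚ (biL (w + 2) 2) +
      Module.finrank ℚ (weightSpace (sympDerRep 1 (w + 2)) w) =
      Module.finrank ℚ (biL (w + 2) 1) + Module.finrank ℚ (biL (w + 1) 2) :=
    finrank_weightSpace_sympDer w 1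
  rw [finrank_biL_one, finrank_biL_two, finrank_biL_two] at h
  split_ifs with hw <;> rw [Nat.even_iff] at hw <;> omega

theorem finrank_weightSpace_two {w : ℕ} (hw : Odd w) :
    Module.finrank ℚ (weightSpace (sympDerRep 1 (w + 4)) w) = (w + 4) / 6 := by
  have h : Module.finrank ℚ (biL (w + 3) 3) +
      Module.finrank ℚ (weightSpace (sympDerRep 1 (w + 4)) w) =
      Module.finrank ℚ (biL (w + 3) 2) + Module.finrank ℚ (biL (w + 2) 3) :=
    finrank_weightSpace_sympDer w 2
  have h1 := finrank_biL_three (w + 3)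
  have h2 := finrank_biL_three (w + 2)
  rw [finrank_biL_two] at h
  rw [Nat.odd_iff] at hw
  have e1 : (w + 3 + 1) * (w + 3 + 2) = (w + 2 + 1) * (w + 2 + 2) + 2 * (w + 4) := by ring
  rw [e1, ← h2] at h1
  split_ifs at h1 <;> omega

/-- In positive degree `k` only weights up to `k - 2` occur. -/
theorem weightSpace_sympDer_of_lt {k w : ℕ} (hk : k ≠ 0) (h : k < w + 2) :
    weightSpace (sympDerRep 1 k) w = ⊥ := by
  by_cases hw : w = k
  · subst hw
    exact Submodule.finrank_eq_zero.mp (finrank_weightSpace_zero hk)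
  · exact weightSpace_sympDer_eq_bot hk fun p q hpq hp => by omega

/-- In odd degree the weights `k` and `k - 2` do not occur. -/
theorem weightSpace_sympDer_odd {k w : ℕ} (hk : Odd k) (h : k < w + 4) :
    weightSpace (sympDerRep 1 k) w = ⊥ := by
  have hk0 : k ≠ 0 := fun h0 => by rw [h0] at hk; exact absurd hk (by decide)
  by_cases hw : k = w + 2
  · subst hw
    refine Submodule.finrank_eq_zero.mp ?_
    rw [finrank_weightSpace_one, if_neg]
    rw [Nat.even_iff]; rw [Nat.odd_iff] at hk; omega
  · by_cases hw2 : k < w + 2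
    · exact weightSpace_sympDer_of_lt hk0 hw2
    · rw [Nat.odd_iff] at hk
      exact weightSpace_sympDer_eq_bot hk0 fun p q hpq hp => by omega

theorem hasLeadingTerm_even {k : ℕ} (hk : 1 ≤ k) (h : Even k) :
    HasLeadingTerm (sympDerRep 1 k) 1 (k - 2) := by
  obtain ⟨w, rfl⟩ : ∃ w, k = w + 2 := ⟨k - 2, by rw [Nat.even_iff] at h; omega⟩
  refine hasLeadingTerm_of_weightSpace symPowSpan_tensorRep (sympDerToTensor _)
    (sympDerToTensor_injective _) one_pos ?_ fun j hj => ?_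
  · rw [Nat.add_sub_cancel, finrank_weightSpace_one, if_pos]
    rw [Nat.even_iff] at h ⊢; omega
  · exact weightSpace_sympDer_of_lt (by omega) (by omega)

theorem hasLeadingTerm_odd {k : ℕ} (hk : 7 ≤ k) (h : Odd k) :
    HasLeadingTerm (sympDerRep 1 k) (k / 6) (k - 4) := by
  obtain ⟨w, rfl⟩ : ∃ w, k = w + 4 := ⟨k - 4, by omega⟩
  refine hasLeadingTerm_of_weightSpace symPowSpan_tensorRep (sympDerToTensor _)
    (sympDerToTensor_injective _) (by omega) ?_ fun j hj => ?_
  · rw [Nat.add_sub_cancel, finrank_weightSpace_two]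
    rw [Nat.odd_iff] at h ⊢; omega
  · exact weightSpace_sympDer_odd h (by omega)

theorem sympDer_eq_bot {k : ℕ} (hk : Odd k) (h : k < 7) : (sympDer 1 k).toSubmodule = ⊥ := by
  have hw : ∀ w, weightSpace (sympDerRep 1 k) w = ⊥ := by
    intro w
    by_cases h4 : k < w + 4
    · exact weightSpace_sympDer_odd hk h4
    · by_cases h5 : k = w + 4
      · subst h5
        refine Submodule.finrank_eq_zero.mp ?_
        rw [finrank_weightSpace_two]
        · rw [Nat.odd_iff] at hk; omega
        · rw [Nat.odd_iff] at hk ⊢; omega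
      · rw [Nat.odd_iff] at hk
        exact weightSpace_sympDer_eq_bot (by omega) fun p q hpq hp => by omega
  rw [Submodule.eq_bot_iff]
  intro D hD
  exact congrArg Subtype.val (eq_zero_of_weightSpace symPowSpan_tensorRep (sympDerToTensor k)
    (sympDerToTensor_injective k) hw ⟨D, hD⟩)

end GenusOne

end

theorem proposition8 :
    (∀ k : ℕ, 1 ≤ k → Even k →
      GenusOne.HasLeadingTerm (GenusOne.sympDerRep 1 k) 1 (k - 2)) ∧
    (∀ k : ℕ, 7 ≤ k → Odd k →
      GenusOne.HasLeadingTerm (GenusOne.sympDerRep 1 k) (k / 6) (k - 4)) ∧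
    (∀ k : ℕ, k = 1 ∨ k = 3 ∨ k = 5 → (GenusOne.sympDer 1 k).toSubmodule = ⊥) ∧
    (∀ k : ℕ, (GenusOne.sympDerInv 1 (2 * k)).map (GenusOne.derToTensor 1) =
      (GenusOne.HLam 1 (k + 1) (GenusOne.oneRow (k + 1))).map TensorPower.toTensorAlgebra) ∧
    (∀ (g k : ℕ) (hg : 1 ≤ g),
      ∃ e : GenusOne.sympDerInv 1 (2 * k) ≃ₗ[ℚ]
          GenusOne.HLam g (k + 1) (GenusOne.oneRow (k + 1)),
        ∀ D : GenusOne.sympDerInv 1 (2 * k),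
          TensorPower.toTensorAlgebra
              (PiTensorProduct.map (fun _ => GenusOne.projOne g hg) (e D).1) =
            GenusOne.derToTensor 1 D.1) := by
  refine ⟨fun k => GenusOne.hasLeadingTerm_even, fun k => GenusOne.hasLeadingTerm_odd,
    fun k hk => ?_, GenusOne.map_sympDerInv_eq, fun g k hg => GenusOne.exists_equiv_HLam k hg⟩
  rcases hk with rfl | rfl | rfl <;> exact GenusOne.sympDer_eq_bot (by decide) (by norm_num)
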